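/- **Theorem (Correspondence Theorem).** Let $X$ be a smooth, reduced scheme of finite type over $\mathbb{C}$, let $Y=T^*[1]X$ be its shifted cotangent bundle (over an affine open $U\subset X$ the functions on $Y$ are the polyvector fields $\bigwedge^\bullet_{\mathcal O(U)}\mathrm{Der}_{\mathbb C}(\mathcal O(U))$), and let $X_\infty$, $Y_\infty$ be the arc spaces. The structure sheaves of $X_\infty$ and $Y_\infty$ are regarded as sheaves on $X$, given on affine opens $U$: $\mathcal A_U=\mathcal O_{X_\infty}(U)$ and $\hat{\mathcal A}_U=\mathcal O_{Y_\infty}(U)$ are the commutative, respectively graded-commutative, differential algebras freely generated by $\mathcal O(U)$, respectively by $\bigwedge^\bullet_{\mathcal O(U)}\mathrm{Der}_{\mathbb C}(\mathcal O(U))$; the derivation is denoted by $\partial$. Elements of $\Gamma(Y_\infty,\mathcal O_{Y_\infty})_2$ are the compatible families of elements of degree $2$ of the $\hat{\mathcal A}_U$. Write $\int:\hat{\mathcal A}_U\to\hat{\mathcal A}_U/\partial\hat{\mathcal A}_U$ for the quotient map to local functionals. (0) On each $\hat{\mathcal A}_U$ there is exactly one chiral Gerstenhaber bracket (a $\lambda$-bracket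 of degree $-1$ that is sesquilinear and satisfies $\{b_\lambda a\}=-(-1)^{(|a|+1)(|b|+1)}\{a_{-\lambda-\partial}b\}$, $\{a_\lambda\{b_\mu c\}\}=\{\{a_\lambda b\}_{\lambda+\mu}c\}+(-1)^{(|a|+1)(|b|+1)}\{b_\mu\{a_\lambda c\}\}$ and $\{a_\lambda bc\}=\{a_\lambda b\}c+(-1)^{(|a|+1)|b|}b\{a_\lambda c\}$) that extends the Schouten bracket of polyvector fields, normalized by $\{a_\lambda \theta_D\}=D(a)$ for a function $a$ and a vector field $D$ with associated odd function $\theta_D$. It induces the bracket $[\int a,\int b]=\int\{a_\lambda b\}|_{\lambda=0}$ on local functionals. Say that a $\lambda$-bracket on the sheaf $\mathcal O_{X_\infty}$ (a family of $\lambda$-brackets on the $\mathcal A_U$ compatible with restrictions) *corresponds* to $P\in\Gamma(Y_\infty,\mathcal O_{Y_\infty})_2$ if for every affine open $U$ and all coordinates on $U$ (functions $u^1,\dots,u^n$ and a basis $\partial_1,\dots,\partial_n$ of the vector fields with $\partial_\alpha u^\beta=\delta_\alpha^\beta$; put $\theta_\alpha=\theta_{\partial_\alpha}$) one has $$\int P=\frac12\int\sum_{\alpha,\beta}\theta_\alpha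 H^{\alpha\beta}(\partial)\theta_\beta,\qquad H^{\beta\alpha}(\lambda)=\{u^\alpha{}_\lambda u^\beta\}.$$ (1) For every $P\in\Gamma(Y_\infty,\mathcal O_{Y_\infty})_2$ there is exactly one $\lambda$-bracket on $\mathcal O_{X_\infty}$ that is sesquilinear, skew-symmetric, satisfies the Leibniz rule and corresponds to $P$. This bracket makes $\mathcal O_{X_\infty}$ a sheaf of Poisson vertex algebras (that is, it also satisfies the Jacobi identity) if and only if $[\int P,\int P]=0$ over every affine open of $X$. (2) Conversely, for every $\lambda$-bracket that makes $\mathcal O_{X_\infty}$ a sheaf of Poisson vertex algebras there is a $P\in\Gamma(Y_\infty,\mathcal O_{Y_\infty})_2$ to which it corresponds; it satisfies $[\int P,\int P]=0$, and the elements $P'$ to which the bracket corresponds are exactly the elements $P'=P+\partial Q$ with $Q\in\Gamma(Y_\infty,\mathcal O_{Y_\infty})_2$. -/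

import Mathlib

noncomputable section

open Polynomial

namespace ArcPVA

/-! ### Arc algebras

For a commutative `ℂ`-algebra `A`, the algebra of functions on the arc space of `Spec A` is the
commutative differential `ℂ`-algebra freely generated by the algebra `A`: polynomials in symbols
`a⁽ⁿ⁾`, with `∂ a⁽ⁿ⁾ = a⁽ⁿ⁺¹⁾`, modulo the differential ideal generated by the relations that make
`a ↦ a⁽⁰⁾` a homomorphism of `ℂ`-algebras. -/

section Arc

variable (A : Type) [CommRing A] [Algebra ℂ A]

/-- The derivation `a⁽ⁿ⁾ ↦ a⁽ⁿ⁺¹⁾` of the free differential algebra on the set `A`. -/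
def freeD : Derivation ℂ (MvPolynomial (A × ℕ) ℂ) (MvPolynomial (A × ℕ) ℂ) :=
  MvPolynomial.mkDerivation ℂ fun x => MvPolynomial.X (x.1, x.2 + 1)

/-- The relations in order zero. -/
inductive ArcRel : MvPolynomial (A × ℕ) ℂ → Prop
  | add (a b : A) : ArcRel
      (MvPolynomial.X (a + b, 0) - (MvPolynomial.X (a, 0) + MvPolynomial.X (b, 0)))
  | smul (c : ℂ) (a : A) : ArcRel (MvPolynomial.X (c • a, 0) - c • MvPolynomial.X (a, 0))
  | one : ArcRel (MvPolynomial.X (1, 0) - 1)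
  | mul (a b : A) : ArcRel
      (MvPolynomial.X (a * b, 0) - MvPolynomial.X (a, 0) * MvPolynomial.X (b, 0))

/-- The differential ideal generated by the relations. -/
def arcIdeal : Ideal (MvPolynomial (A × ℕ) ℂ) :=
  Ideal.span {p | ∃ (n : ℕ) (g : MvPolynomial (A × ℕ) ℂ), ArcRel A g ∧ p = (freeD A)^[n] g}

/-- Functions on the arc space of `Spec A`. -/
def Arc : Type := MvPolynomial (A × ℕ) ℂ ⧸ arcIdeal A

instance : CommRing (Arc A) := inferInstanceAs (CommRing (_ ⧸ arcIdeal A))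

instance : Algebra ℂ (Arc A) := inferInstanceAs (Algebra ℂ (_ ⧸ arcIdeal A))

/-- The quotient map. -/
def Arc.mk : MvPolynomial (A × ℕ) ℂ →ₐ[ℂ] Arc A := Ideal.Quotient.mkₐ ℂ (arcIdeal A)

theorem Arc.mk_surjective : Function.Surjective (Arc.mk A) :=
  Ideal.Quotient.mkₐ_surjective ℂ (arcIdeal A)

theorem Arc.mk_eq_zero {p : MvPolynomial (A × ℕ) ℂ} : Arc.mk A p = 0 ↔ p ∈ arcIdeal A :=
  Ideal.Quotient.eq_zero_iff_mem

theorem freeD_mem {p : MvPolynomial (A × ℕ) ℂ} (hp : p ∈ arcIdeal A) :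
    freeD A p ∈ arcIdeal A := by
  refine Submodule.span_induction ?_ ?_ ?_ ?_ hp
  · rintro _ ⟨n, g, hg, rfl⟩
    exact Ideal.subset_span ⟨n + 1, g, hg, (Function.iterate_succ_apply' _ _ _).symm⟩
  · simp
  · intro x y _ _ hx hy
    rw [map_add]
    exact add_mem hx hy
  · intro r x hx' hx
    rw [smul_eq_mul, Derivation.leibniz]
    exact add_mem (Ideal.mul_mem_left _ _ hx)
      (by rw [smul_eq_mul]; exact Ideal.mul_mem_right _ _ hx')

/-- The translation operator `∂` as a linear map. -/
def Arc.dLin : Arc A →ₗ[ℂ] Arc A :=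
  Submodule.mapQ ((arcIdeal A).restrictScalars ℂ) ((arcIdeal A).restrictScalars ℂ)
    (freeD A : MvPolynomial (A × ℕ) ℂ →ₗ[ℂ] MvPolynomial (A × ℕ) ℂ) (fun _ hp => freeD_mem A hp)

theorem Arc.dLin_mk (p : MvPolynomial (A × ℕ) ℂ) :
    Arc.dLin A (Arc.mk A p) = Arc.mk A (freeD A p) := rfl

/-- The translation operator `∂` of the arc space. -/
def Arc.d : Derivation ℂ (Arc A) (Arc A) :=
  Derivation.mk' (Arc.dLin A) (by
    intro x y
    obtain ⟨p, rfl⟩ := Arc.mk_surjective A x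
    obtain ⟨q, rfl⟩ := Arc.mk_surjective A y
    rw [← map_mul, Arc.dLin_mk, Derivation.leibniz, map_add, smul_eq_mul, smul_eq_mul, map_mul,
      map_mul, Arc.dLin_mk, Arc.dLin_mk, smul_eq_mul, smul_eq_mul])

theorem Arc.d_mk (p : MvPolynomial (A × ℕ) ℂ) :
    Arc.d A (Arc.mk A p) = Arc.mk A (freeD A p) := rfl

/-- The class of the symbol `a⁽ⁿ⁾`. -/
def Arc.jet (a : A) (n : ℕ) : Arc A := Arc.mk A (MvPolynomial.X (a, n))

theorem Arc.jet_rel {g : MvPolynomial (A × ℕ) ℂ} (hg : ArcRel A g) : Arc.mk A g = 0 :=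
  (Arc.mk_eq_zero A).2 (Ideal.subset_span ⟨0, g, hg, rfl⟩)

/-- Pull-back of functions along the projection from the arc space to `Spec A`. -/
def Arc.of : A →ₐ[ℂ] Arc A :=
  AlgHom.ofLinearMap
    { toFun := fun a => Arc.jet A a 0
      map_add' := fun a b => by
        have h := Arc.jet_rel A (.add a b)
        rw [map_sub, sub_eq_zero, map_add] at h
        exact h
      map_smul' := fun c a => by
        have h := Arc.jet_rel A (.smul c a)
        rw [map_sub, sub_eq_zero, map_smul] at h
        exact h }
    (by
      have h := Arc.jet_rel A .one
      rw [map_sub, sub_eq_zero, map_one] at h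
      exact h)
    (fun a b => by
      have h := Arc.jet_rel A (.mul a b)
      rw [map_sub, sub_eq_zero, map_mul] at h
      exact h)

variable {A} {B : Type} [CommRing B] [Algebra ℂ B]

/-- Symbol-wise extension of a homomorphism of algebras. -/
def Arc.preMap (f : A →ₐ[ℂ] B) : MvPolynomial (A × ℕ) ℂ →ₐ[ℂ] Arc B :=
  MvPolynomial.aeval fun x => Arc.jet B (f x.1) x.2

theorem Arc.preMap_d (f : A →ₐ[ℂ] B) (p : MvPolynomial (A × ℕ) ℂ) :
    Arc.preMap f (freeD A p) = Arc.d B (Arc.preMap f p) := by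
  induction p using MvPolynomial.induction_on with
  | C c =>
    rw [← MvPolynomial.algebraMap_eq, Derivation.map_algebraMap, map_zero, AlgHom.commutes,
      Derivation.map_algebraMap]
  | add p q hp hq => simp only [map_add, hp, hq]
  | mul_X p x hp =>
    have hx : Arc.preMap f (freeD A (MvPolynomial.X x)) =
        Arc.d B (Arc.preMap f (MvPolynomial.X x)) := by
      simp only [freeD, MvPolynomial.mkDerivation_X, Arc.preMap, MvPolynomial.aeval_X, Arc.jet,
        Arc.d_mk]
    simp only [Derivation.leibniz, smul_eq_mul, map_add, map_mul, hp, hx]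

theorem Arc.preMap_mem (f : A →ₐ[ℂ] B) {p : MvPolynomial (A × ℕ) ℂ} (hp : p ∈ arcIdeal A) :
    Arc.preMap f p = 0 := by
  suffices h : arcIdeal A ≤ RingHom.ker (Arc.preMap f) from h hp
  refine Ideal.span_le.2 ?_
  rintro _ ⟨n, g, hg, rfl⟩
  have h0 : Arc.preMap f g = 0 := by
    have key : ∀ a : A, Arc.preMap f (MvPolynomial.X (a, 0)) = Arc.of B (f a) := fun a => by
      rw [Arc.preMap, MvPolynomial.aeval_X]
      rfl
    cases hg <;> simp [key]
  have h : ∀ n : ℕ, Arc.preMap f ((freeD A)^[n] g) = 0 := by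
    intro n
    induction n with
    | zero => exact h0
    | succ n ih => rw [Function.iterate_succ_apply', Arc.preMap_d, ih, map_zero]
  exact h n

/-- Functoriality of the arc algebra: `a⁽ⁿ⁾ ↦ (f a)⁽ⁿ⁾`. -/
def Arc.map (f : A →ₐ[ℂ] B) : Arc A →ₐ[ℂ] Arc B :=
  Ideal.Quotient.liftₐ (arcIdeal A) (Arc.preMap f) fun _ hp => Arc.preMap_mem f hp

theorem Arc.map_mk (f : A →ₐ[ℂ] B) (p : MvPolynomial (A × ℕ) ℂ) :
    Arc.map f (Arc.mk A p) = Arc.preMap f p := rfl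

theorem Arc.map_d (f : A →ₐ[ℂ] B) (x : Arc A) : Arc.map f (Arc.d A x) = Arc.d B (Arc.map f x) := by
  obtain ⟨p, rfl⟩ := Arc.mk_surjective A x
  rw [Arc.d_mk, Arc.map_mk, Arc.map_mk, Arc.preMap_d]

theorem Arc.map_of (f : A →ₐ[ℂ] B) (a : A) : Arc.map f (Arc.of A a) = Arc.of B (f a) := by
  change Arc.preMap f (MvPolynomial.X (a, 0)) = _
  rw [Arc.preMap, MvPolynomial.aeval_X]
  rfl

end Arc

/-! ### Arc modules

For an `A`-module `M`, the differential `Arc A`-module freely generated by the `A`-module `M`. -/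

section ArcModule

variable (A : Type) [CommRing A] [Algebra ℂ A] (M : Type) [AddCommGroup M] [Module A M]

/-- `r m⁽ⁿ⁾ ↦ (∂ r) m⁽ⁿ⁾ + r m⁽ⁿ⁺¹⁾` on the free module on the symbols `m⁽ⁿ⁾`. -/
def freeModD : ((M × ℕ) →₀ Arc A) →ₗ[ℂ] ((M × ℕ) →₀ Arc A) :=
  Finsupp.mapRange.linearMap (Arc.d A : Arc A →ₗ[ℂ] Arc A) +
    Finsupp.lmapDomain (Arc A) ℂ fun x : M × ℕ => (x.1, x.2 + 1)

set_option linter.unusedSectionVars false in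
theorem freeModD_smul (r : Arc A) (x : (M × ℕ) →₀ Arc A) :
    freeModD A M (r • x) = Arc.d A r • x + r • freeModD A M x := by
  have h1 : Finsupp.mapRange.linearMap (α := M × ℕ) (Arc.d A : Arc A →ₗ[ℂ] Arc A) (r • x) =
      Arc.d A r • x + r • Finsupp.mapRange.linearMap (Arc.d A : Arc A →ₗ[ℂ] Arc A) x := by
    ext i
    simp [Derivation.leibniz, mul_comm, add_comm]
  have h2 : Finsupp.lmapDomain (Arc A) ℂ (fun x : M × ℕ => (x.1, x.2 + 1)) (r • x) =
      r • Finsupp.lmapDomain (Arc A) ℂ (fun x : M × ℕ => (x.1, x.2 + 1)) x := by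
    simp only [Finsupp.lmapDomain_apply]
    exact Finsupp.mapDomain_smul r x
  simp only [freeModD, LinearMap.add_apply, h1, h2, smul_add]
  abel

/-- The relations in order zero. -/
inductive ArcModRel : ((M × ℕ) →₀ Arc A) → Prop
  | add (m m' : M) : ArcModRel
      (Finsupp.single (m + m', 0) 1 - (Finsupp.single (m, 0) 1 + Finsupp.single (m', 0) 1))
  | smul (a : A) (m : M) : ArcModRel
      (Finsupp.single (a • m, 0) 1 - Arc.of A a • Finsupp.single (m, 0) 1)

/-- The differential submodule generated by the relations. -/
def arcSubmodule : Submodule (Arc A) ((M × ℕ) →₀ Arc A) :=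
  Submodule.span (Arc A)
    {p | ∃ (n : ℕ) (g : (M × ℕ) →₀ Arc A), ArcModRel A M g ∧ p = (freeModD A M)^[n] g}

/-- The arc module of `M`. -/
def ArcMod : Type := ((M × ℕ) →₀ Arc A) ⧸ arcSubmodule A M

instance : AddCommGroup (ArcMod A M) := inferInstanceAs (AddCommGroup (_ ⧸ arcSubmodule A M))

instance : Module (Arc A) (ArcMod A M) :=
  inferInstanceAs (Module (Arc A) (_ ⧸ arcSubmodule A M))

instance : Module ℂ (ArcMod A M) := inferInstanceAs (Module ℂ (_ ⧸ arcSubmodule A M))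

instance : IsScalarTower ℂ (Arc A) (ArcMod A M) :=
  inferInstanceAs (IsScalarTower ℂ (Arc A) (_ ⧸ arcSubmodule A M))

/-- The quotient map. -/
def ArcMod.mk : ((M × ℕ) →₀ Arc A) →ₗ[Arc A] ArcMod A M := (arcSubmodule A M).mkQ

theorem ArcMod.mk_surjective : Function.Surjective (ArcMod.mk A M) :=
  (arcSubmodule A M).mkQ_surjective

theorem ArcMod.mk_eq_zero {p : (M × ℕ) →₀ Arc A} : ArcMod.mk A M p = 0 ↔ p ∈ arcSubmodule A M :=
  Submodule.Quotient.mk_eq_zero _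

theorem freeModD_mem {p : (M × ℕ) →₀ Arc A} (hp : p ∈ arcSubmodule A M) :
    freeModD A M p ∈ arcSubmodule A M := by
  refine Submodule.span_induction ?_ ?_ ?_ ?_ hp
  · rintro _ ⟨n, g, hg, rfl⟩
    exact Submodule.subset_span ⟨n + 1, g, hg, (Function.iterate_succ_apply' _ _ _).symm⟩
  · simp
  · intro x y _ _ hx hy
    rw [map_add]
    exact add_mem hx hy
  · intro r x hx' hx
    rw [freeModD_smul]
    exact add_mem (Submodule.smul_mem _ _ hx') (Submodule.smul_mem _ _ hx)

/-- The translation operator on the arc module. -/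
def ArcMod.d : ArcMod A M →ₗ[ℂ] ArcMod A M :=
  Submodule.mapQ ((arcSubmodule A M).restrictScalars ℂ) ((arcSubmodule A M).restrictScalars ℂ)
    (freeModD A M) (fun _ hp => freeModD_mem A M hp)

theorem ArcMod.d_mk (p : (M × ℕ) →₀ Arc A) :
    ArcMod.d A M (ArcMod.mk A M p) = ArcMod.mk A M (freeModD A M p) := rfl

theorem ArcMod.d_smul (r : Arc A) (x : ArcMod A M) :
    ArcMod.d A M (r • x) = Arc.d A r • x + r • ArcMod.d A M x := by
  obtain ⟨p, rfl⟩ := ArcMod.mk_surjective A M x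
  rw [← map_smul, ArcMod.d_mk, freeModD_smul, map_add, map_smul, map_smul, ArcMod.d_mk]

/-- The class of the symbol `m⁽ⁿ⁾`. -/
def ArcMod.jet (m : M) (n : ℕ) : ArcMod A M := ArcMod.mk A M (Finsupp.single (m, n) 1)

theorem ArcMod.mk_rel {g : (M × ℕ) →₀ Arc A} (hg : ArcModRel A M g) : ArcMod.mk A M g = 0 :=
  (ArcMod.mk_eq_zero A M).2 (Submodule.subset_span ⟨0, g, hg, rfl⟩)

theorem ArcMod.jet_add (m m' : M) :
    ArcMod.jet A M (m + m') 0 = ArcMod.jet A M m 0 + ArcMod.jet A M m' 0 := by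
  have h := ArcMod.mk_rel A M (.add m m')
  rw [map_sub, sub_eq_zero, map_add] at h
  exact h

theorem ArcMod.jet_smul (a : A) (m : M) :
    ArcMod.jet A M (a • m) 0 = Arc.of A a • ArcMod.jet A M m 0 := by
  have h := ArcMod.mk_rel A M (.smul a m)
  rw [map_sub, sub_eq_zero, map_smul] at h
  exact h

set_option linter.unusedSectionVars false in
theorem freeModD_single (m : M) (n : ℕ) :
    freeModD A M (Finsupp.single (m, n) 1) = Finsupp.single (m, n + 1) 1 := by
  simp [freeModD]

theorem ArcMod.d_jet (m : M) (n : ℕ) :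
    ArcMod.d A M (ArcMod.jet A M m n) = ArcMod.jet A M m (n + 1) := by
  rw [ArcMod.jet, ArcMod.d_mk, freeModD_single, ArcMod.jet]

variable {A M} {B : Type} [CommRing B] [Algebra ℂ B] {N : Type} [AddCommGroup N] [Module B N]

/-- Symbol-wise extension of a semilinear map. -/
def ArcMod.preMap (f : A →ₐ[ℂ] B) (g : M →ₛₗ[(f : A →+* B)] N) :
    ((M × ℕ) →₀ Arc A) →ₛₗ[(Arc.map f : Arc A →+* Arc B)] ArcMod B N where
  toFun p := p.sum fun x r => Arc.map f r • ArcMod.jet B N (g x.1) x.2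
  map_add' p q := Finsupp.sum_add_index'
    (h := fun (x : M × ℕ) r => Arc.map f r • ArcMod.jet B N (g x.1) x.2)
    (fun i => by rw [map_zero, zero_smul]) (fun i r s => by rw [map_add, add_smul])
  map_smul' r p := by
    have h := Finsupp.sum_smul_index (g := p) (b := r)
      (h := fun x r => Arc.map f r • ArcMod.jet B N (g x.1) x.2)
      (fun i => by rw [map_zero, zero_smul])
    refine h.trans ?_
    simp only [map_mul, mul_smul, RingHom.coe_coe, Finsupp.sum, Finset.smul_sum]

theorem ArcMod.preMap_single (f : A →ₐ[ℂ] B) (g : M →ₛₗ[(f : A →+* B)] N) (m : M) (n : ℕ)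
    (r : Arc A) : ArcMod.preMap f g (Finsupp.single (m, n) r) =
      Arc.map f r • ArcMod.jet B N (g m) n := by
  exact Finsupp.sum_single_index
    (h := fun (x : M × ℕ) r => Arc.map f r • ArcMod.jet B N (g x.1) x.2)
    (by rw [map_zero, zero_smul])

theorem ArcMod.preMap_d (f : A →ₐ[ℂ] B) (g : M →ₛₗ[(f : A →+* B)] N) (p : (M × ℕ) →₀ Arc A) :
    ArcMod.preMap f g (freeModD A M p) = ArcMod.d B N (ArcMod.preMap f g p) := by
  induction p using Finsupp.induction_linear with
  | zero => simp
  | add p q hp hq => simp only [map_add, hp, hq]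
  | single x r =>
    obtain ⟨m, n⟩ := x
    have h : Finsupp.single (m, n) r = r • (Finsupp.single (m, n) 1 : (M × ℕ) →₀ Arc A) := by simp
    rw [h, freeModD_smul, freeModD_single, map_add]
    simp only [LinearMap.map_smulₛₗ, ArcMod.preMap_single, map_one, one_smul, RingHom.coe_coe,
      ArcMod.d_smul, ArcMod.d_jet, Arc.map_d]

theorem ArcMod.preMap_mem (f : A →ₐ[ℂ] B) (g : M →ₛₗ[(f : A →+* B)] N)
    {p : (M × ℕ) →₀ Arc A} (hp : p ∈ arcSubmodule A M) : ArcMod.preMap f g p = 0 := by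
  suffices h : arcSubmodule A M ≤ LinearMap.ker (ArcMod.preMap f g) from h hp
  refine Submodule.span_le.2 ?_
  rintro _ ⟨n, x, hx, rfl⟩
  have h0 : ArcMod.preMap f g x = 0 := by
    cases hx with
    | add m m' =>
      simp only [map_sub, map_add, ArcMod.preMap_single, map_one, one_smul, ArcMod.jet_add,
        sub_self]
    | smul a m =>
      simp only [map_sub, LinearMap.map_smulₛₗ, ArcMod.preMap_single, map_one, one_smul,
        RingHom.coe_coe, ArcMod.jet_smul, Arc.map_of, sub_self]
  have h : ∀ n : ℕ, ArcMod.preMap f g ((freeModD A M)^[n] x) = 0 := by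
    intro n
    induction n with
    | zero => exact h0
    | succ n ih => rw [Function.iterate_succ_apply', ArcMod.preMap_d, ih, map_zero]
  exact h n

/-- Functoriality of the arc module: `m⁽ⁿ⁾ ↦ (g m)⁽ⁿ⁾`. -/
def ArcMod.map (f : A →ₐ[ℂ] B) (g : M →ₛₗ[(f : A →+* B)] N) :
    ArcMod A M →ₛₗ[(Arc.map f : Arc A →+* Arc B)] ArcMod B N :=
  (arcSubmodule A M).liftQ (ArcMod.preMap f g) fun _ hp => ArcMod.preMap_mem f g hp

end ArcModule

/-! ### Functions on the arc space of an odd vector bundle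

The functions on the odd bundle whose linear fibre coordinates are `M` form the exterior algebra
`Λ_A M`. The graded-commutative differential algebra freely generated by it is
`Λ_{Arc A} (ArcMod A M)`: it is generated by the symbols `a⁽ⁿ⁾` (even) and `m⁽ⁿ⁾` (odd) subject to
the relations that are obtained by applying powers of `∂` to the relations of `Λ_A M`. -/

section OddArc

/-- Extension of a ring homomorphism with central values on the scalars and of a semilinear map
with square-zero values to the exterior algebra. -/
def extLift {R M S : Type} [CommRing R] [AddCommGroup M] [Module R M] [Ring S] (φ : R →+* S)
    (hφ : ∀ r x, φ r * x = x * φ r) (g : M →+ S) (hg : ∀ (r : R) m, g (r • m) = φ r * g m)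
    (hsq : ∀ m, g m * g m = 0) : ExteriorAlgebra R M →+* S :=
  letI := φ.toAlgebra' hφ
  (ExteriorAlgebra.lift R (A := S)
    ⟨{ toFun := g, map_add' := g.map_add, map_smul' := fun r m => by
        rw [hg, Algebra.smul_def]; rfl }, hsq⟩ : ExteriorAlgebra R M →ₐ[R] S)

theorem extLift_ι {R M S : Type} [CommRing R] [AddCommGroup M] [Module R M] [Ring S] (φ : R →+* S)
    (hφ : ∀ r x, φ r * x = x * φ r) (g : M →+ S) (hg : ∀ (r : R) m, g (r • m) = φ r * g m)
    (hsq : ∀ m, g m * g m = 0) (m : M) : extLift φ hφ g hg hsq (ExteriorAlgebra.ι R m) = g m := by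
  let _ := φ.toAlgebra' hφ
  exact ExteriorAlgebra.lift_ι_apply R (A := S) _ _ _

theorem extLift_algebraMap {R M S : Type} [CommRing R] [AddCommGroup M] [Module R M] [Ring S]
    (φ : R →+* S)
    (hφ : ∀ r x, φ r * x = x * φ r) (g : M →+ S) (hg : ∀ (r : R) m, g (r • m) = φ r * g m)
    (hsq : ∀ m, g m * g m = 0) (r : R) :
    extLift φ hφ g hg hsq (algebraMap R (ExteriorAlgebra R M) r) = φ r := by
  let _ := φ.toAlgebra' hφ
  exact AlgHom.commutes (ExteriorAlgebra.lift R (A := S) _) r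

section extDer

variable {R M : Type} [CommRing R] [Algebra ℂ R] [AddCommGroup M] [Module R M] [Module ℂ M]
  [IsScalarTower ℂ R M] (δ : Derivation ℂ R R) (δM : M →ₗ[ℂ] M)

/-- The homomorphism `x ↦ x + ε ∂x` to the dual numbers that encodes a derivation `∂` of the
exterior algebra. -/
def extDerHom (h : ∀ (r : R) m, δM (r • m) = δ r • m + r • δM m) :
    ExteriorAlgebra R M →+* TrivSqZeroExt (ExteriorAlgebra R M) (ExteriorAlgebra R M) :=
  extLift
    { toFun := fun r => TrivSqZeroExt.inl (algebraMap R (ExteriorAlgebra R M) r) +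
        TrivSqZeroExt.inr (algebraMap R (ExteriorAlgebra R M) (δ r))
      map_one' := by
        rw [map_one, Derivation.map_one_eq_zero, map_zero, TrivSqZeroExt.inr_zero, add_zero,
          TrivSqZeroExt.inl_one]
      map_zero' := by
        rw [map_zero, map_zero, map_zero, TrivSqZeroExt.inr_zero, add_zero,
          TrivSqZeroExt.inl_zero]
      map_add' := fun r s => by
        rw [map_add, map_add, map_add, TrivSqZeroExt.inl_add, TrivSqZeroExt.inr_add]
        abel
      map_mul' := fun r s => by
        refine TrivSqZeroExt.ext ?_ ?_
        · simp only [TrivSqZeroExt.fst_mul, TrivSqZeroExt.fst_add, TrivSqZeroExt.fst_inl,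
            TrivSqZeroExt.fst_inr, add_zero, map_mul]
        · simp only [TrivSqZeroExt.snd_mul, TrivSqZeroExt.fst_add, TrivSqZeroExt.fst_inl,
            TrivSqZeroExt.fst_inr, add_zero, TrivSqZeroExt.snd_add, TrivSqZeroExt.snd_inl,
            TrivSqZeroExt.snd_inr, zero_add, Derivation.leibniz, map_add, map_mul, smul_eq_mul,
            MulOpposite.smul_eq_mul_unop, MulOpposite.unop_op]
          rw [Algebra.commutes s] }
    (by
      intro r x
      refine TrivSqZeroExt.ext ?_ ?_
      · simp only [RingHom.coe_mk, MonoidHom.coe_mk, OneHom.coe_mk, TrivSqZeroExt.fst_mul,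
          TrivSqZeroExt.fst_add, TrivSqZeroExt.fst_inl, TrivSqZeroExt.fst_inr, add_zero]
        exact Algebra.commutes r _
      · simp only [RingHom.coe_mk, MonoidHom.coe_mk, OneHom.coe_mk, TrivSqZeroExt.snd_mul,
          TrivSqZeroExt.fst_add, TrivSqZeroExt.fst_inl, TrivSqZeroExt.fst_inr, add_zero,
          TrivSqZeroExt.snd_add, TrivSqZeroExt.snd_inl, TrivSqZeroExt.snd_inr, zero_add,
          smul_eq_mul, MulOpposite.smul_eq_mul_unop, MulOpposite.unop_op]
        rw [Algebra.commutes r, Algebra.commutes (δ r), add_comm])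
    { toFun := fun m => TrivSqZeroExt.inl (ExteriorAlgebra.ι R m) +
        TrivSqZeroExt.inr (ExteriorAlgebra.ι R (δM m))
      map_zero' := by
        rw [map_zero, map_zero, map_zero, TrivSqZeroExt.inr_zero, add_zero,
          TrivSqZeroExt.inl_zero]
      map_add' := fun r s => by
        rw [map_add, map_add, map_add, TrivSqZeroExt.inl_add, TrivSqZeroExt.inr_add]
        abel }
    (by
      intro r m
      refine TrivSqZeroExt.ext ?_ ?_
      · simp only [RingHom.coe_mk, MonoidHom.coe_mk, OneHom.coe_mk, AddMonoidHom.coe_mk,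
          ZeroHom.coe_mk, TrivSqZeroExt.fst_mul,
          TrivSqZeroExt.fst_add, TrivSqZeroExt.fst_inl, TrivSqZeroExt.fst_inr, add_zero,
          map_smul, Algebra.smul_def]
      · simp only [RingHom.coe_mk, MonoidHom.coe_mk, OneHom.coe_mk, AddMonoidHom.coe_mk,
          ZeroHom.coe_mk, TrivSqZeroExt.snd_mul,
          TrivSqZeroExt.fst_add, TrivSqZeroExt.fst_inl, TrivSqZeroExt.fst_inr, add_zero,
          TrivSqZeroExt.snd_add, TrivSqZeroExt.snd_inl, TrivSqZeroExt.snd_inr, zero_add,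
          smul_eq_mul, MulOpposite.smul_eq_mul_unop, MulOpposite.unop_op, h, map_add, map_smul]
        rw [Algebra.smul_def, Algebra.smul_def, add_comm])
    (by
      intro m
      refine TrivSqZeroExt.ext ?_ ?_
      · simp only [AddMonoidHom.coe_mk, ZeroHom.coe_mk, TrivSqZeroExt.fst_mul,
          TrivSqZeroExt.fst_add, TrivSqZeroExt.fst_inl, TrivSqZeroExt.fst_inr, add_zero,
          ExteriorAlgebra.ι_sq_zero, TrivSqZeroExt.fst_zero]
      · simp only [AddMonoidHom.coe_mk, ZeroHom.coe_mk, TrivSqZeroExt.snd_mul,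
          TrivSqZeroExt.fst_add, TrivSqZeroExt.fst_inl, TrivSqZeroExt.fst_inr, add_zero,
          TrivSqZeroExt.snd_add, TrivSqZeroExt.snd_inl, TrivSqZeroExt.snd_inr, zero_add,
          smul_eq_mul, MulOpposite.smul_eq_mul_unop, MulOpposite.unop_op,
          TrivSqZeroExt.snd_zero]
        exact ExteriorAlgebra.ι_add_mul_swap _ _)

/-- The derivation of the exterior algebra that restricts to `δ` on the scalars and to `δM` on
the module. -/
def extDer (h : ∀ (r : R) m, δM (r • m) = δ r • m + r • δM m) :
    ExteriorAlgebra R M →ₗ[ℂ] ExteriorAlgebra R M where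
  toFun x := (extDerHom δ δM h x).snd
  map_add' x y := by rw [map_add, TrivSqZeroExt.snd_add]
  map_smul' c x := by
    have h' : ∀ y : ExteriorAlgebra R M,
        c • y = algebraMap R (ExteriorAlgebra R M) (algebraMap ℂ R c) * y := fun y => by
      rw [← Algebra.smul_def, algebraMap_smul]
    rw [h', map_mul, extDerHom, extLift_algebraMap, TrivSqZeroExt.snd_mul, RingHom.id_apply, h']
    simp only [RingHom.coe_mk, MonoidHom.coe_mk, OneHom.coe_mk,
      TrivSqZeroExt.fst_add, TrivSqZeroExt.fst_inl, TrivSqZeroExt.fst_inr, add_zero,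
      TrivSqZeroExt.snd_add, TrivSqZeroExt.snd_inl, TrivSqZeroExt.snd_inr,
      Derivation.map_algebraMap, map_zero, smul_eq_mul, MulOpposite.smul_eq_mul_unop,
      MulOpposite.unop_op, zero_mul, add_zero]

end extDer

variable (A : Type) [CommRing A] [Algebra ℂ A] (M : Type) [AddCommGroup M] [Module A M]

/-- Functions on the arc space of the odd bundle with linear fibre coordinates `M`. -/
abbrev OddArc : Type := ExteriorAlgebra (Arc A) (ArcMod A M)

/-- The component of degree `p`. -/
abbrev OddArc.deg (p : ℕ) : Submodule ℂ (OddArc A M) :=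
  (⋀[Arc A]^p (ArcMod A M)).restrictScalars ℂ

/-- The translation operator `∂`: the derivation that restricts to `∂` on `Arc A` and on
`ArcMod A M`. -/
def OddArc.d : OddArc A M →ₗ[ℂ] OddArc A M :=
  extDer (Arc.d A) (ArcMod.d A M) (ArcMod.d_smul A M)

variable {A M} {B : Type} [CommRing B] [Algebra ℂ B] {N : Type} [AddCommGroup N] [Module B N]

/-- `m ↦ g m` on the generators, as a map to the exterior algebra. -/
def OddArc.mapGen (f : A →ₐ[ℂ] B) (g : M →ₛₗ[(f : A →+* B)] N) : ArcMod A M →+ OddArc B N where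
  toFun m := ExteriorAlgebra.ι (Arc B) (ArcMod.map f g m)
  map_zero' := by rw [map_zero, map_zero]
  map_add' m m' := by rw [map_add, map_add]

/-- `r ↦ f r` on the scalars, as a map to the exterior algebra. -/
def OddArc.mapFn (f : A →ₐ[ℂ] B) (N : Type) [AddCommGroup N] [Module B N] :
    Arc A →+* OddArc B N :=
  (algebraMap (Arc B) (OddArc B N)).comp (Arc.map f : Arc A →+* Arc B)

theorem OddArc.mapFn_comm (f : A →ₐ[ℂ] B) (r : Arc A) (x : OddArc B N) :
    OddArc.mapFn f N r * x = x * OddArc.mapFn f N r :=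
  Algebra.commutes (Arc.map f r) x

theorem OddArc.mapGen_smul (f : A →ₐ[ℂ] B) (g : M →ₛₗ[(f : A →+* B)] N) (r : Arc A)
    (m : ArcMod A M) :
    OddArc.mapGen f g (r • m) = OddArc.mapFn f N r * OddArc.mapGen f g m := by
  change ExteriorAlgebra.ι (Arc B) (ArcMod.map f g (r • m)) =
    algebraMap (Arc B) (OddArc B N) (Arc.map f r) * ExteriorAlgebra.ι (Arc B) (ArcMod.map f g m)
  rw [LinearMap.map_smulₛₗ, map_smul, Algebra.smul_def]
  rfl

theorem OddArc.mapGen_sq (f : A →ₐ[ℂ] B) (g : M →ₛₗ[(f : A →+* B)] N) (m : ArcMod A M) :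
    OddArc.mapGen f g m * OddArc.mapGen f g m = 0 :=
  ExteriorAlgebra.ι_sq_zero _

/-- Functoriality. -/
def OddArc.map (f : A →ₐ[ℂ] B) (g : M →ₛₗ[(f : A →+* B)] N) : OddArc A M →+* OddArc B N :=
  extLift (OddArc.mapFn f N) (OddArc.mapFn_comm f) (OddArc.mapGen f g) (OddArc.mapGen_smul f g)
    (OddArc.mapGen_sq f g)

end OddArc

/-! ### `λ`-brackets

A `λ`-bracket is a bilinear map with values in polynomials in `λ`; here `λ` is `Polynomial.X`. -/

section Lambda

variable {V : Type} [Ring V] [Algebra ℂ V]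

/-- Bilinear maps `V × V → V[λ]`. -/
abbrev LambdaBracket (V : Type) [Ring V] [Algebra ℂ V] : Type := V →ₗ[ℂ] V →ₗ[ℂ] V[X]

/-- The coefficientwise action of an operator on `V[λ]`. -/
def coeffMap (D : V →ₗ[ℂ] V) : V[X] →ₗ[ℂ] V[X] :=
  lsum fun n => ((monomial n : V →ₗ[V] V[X]).restrictScalars ℂ) ∘ₗ D

/-- `q(λ) ↦ q(-λ-∂)`, that is `∑ λⁿ qₙ ↦ ∑ (-λ-∂)ⁿ qₙ`. -/
def negShift (D : V →ₗ[ℂ] V) : V[X] →ₗ[ℂ] V[X] :=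
  lsum fun n => ((-(LinearMap.mulLeft ℂ (X : V[X]) + coeffMap D)) ^ n) ∘ₗ
    ((monomial 0 : V →ₗ[V] V[X]).restrictScalars ℂ)

/-- In `V[λ][μ]`, the variable `λ`. -/
def lam : V[X][X] := C X

/-- In `V[λ][μ]`, the variable `μ`. -/
def mu : V[X][X] := X

/-- Substitution of a central element `s` of `V[λ][μ]` for the variable of a polynomial. -/
def substVar (s : V[X][X]) (q : V[X]) : V[X][X] := q.sum fun n v => C (C v) * s ^ n

/-- `{a_λ {b_μ c}}`. -/
def jacobiLeft (B : LambdaBracket V) (a b c : V) : V[X][X] :=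
  (B b c).sum fun n v => substVar lam (B a v) * mu ^ n

/-- `{{a_λ b}_{λ+μ} c}`. -/
def jacobiMid (B : LambdaBracket V) (a b c : V) : V[X][X] :=
  (B a b).sum fun n v => substVar (lam + mu) (B v c) * lam ^ n

/-- `{b_μ {a_λ c}}`. -/
def jacobiRight (B : LambdaBracket V) (a b c : V) : V[X][X] :=
  (B a c).sum fun n v => substVar mu (B b v) * lam ^ n

/-- Sesquilinearity. -/
structure IsSesquilinear (D : V →ₗ[ℂ] V) (B : LambdaBracket V) : Prop where
  left : ∀ a b, B (D a) b = -(X * B a b)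
  right : ∀ a b, B a (D b) = X * B a b + coeffMap D (B a b)

/-- The axioms of a Poisson vertex algebra except for the Jacobi identity, on a commutative
differential algebra. -/
structure IsSkewLeibniz {V : Type} [CommRing V] [Algebra ℂ V] (D : V →ₗ[ℂ] V)
    (B : LambdaBracket V) : Prop extends IsSesquilinear D B where
  skew : ∀ a b, B b a = -negShift D (B a b)
  leibniz : ∀ a b c, B a (b * c) = B a b * C c + C b * B a c

/-- Poisson vertex algebra structures on a commutative differential algebra. -/
structure IsPVA {V : Type} [CommRing V] [Algebra ℂ V] (D : V →ₗ[ℂ] V)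
    (B : LambdaBracket V) : Prop extends IsSkewLeibniz D B where
  jacobi : ∀ a b c, jacobiLeft B a b c = jacobiMid B a b c + jacobiRight B a b c

/-- Chiral Gerstenhaber algebra structures on a graded-commutative differential algebra `V`
with homogeneous components `deg p`. -/
@[ext]
structure ChiralGerstenhaber (deg : ℕ → Submodule ℂ V) (D : V →ₗ[ℂ] V) where
  /-- the bracket `{a_λ b}` -/
  br : LambdaBracket V
  degree : ∀ p q r : ℕ, p + q = r + 1 → ∀ a ∈ deg p, ∀ b ∈ deg q, ∀ n, (br a b).coeff n ∈ deg r
  degree_zero : ∀ a ∈ deg 0, ∀ b ∈ deg 0, br a b = 0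
  sesquilinear : IsSesquilinear D br
  skew : ∀ p q : ℕ, ∀ a ∈ deg p, ∀ b ∈ deg q,
    br b a = -((-1 : ℂ) ^ ((p + 1) * (q + 1)) • negShift D (br a b))
  jacobi : ∀ p q : ℕ, ∀ a ∈ deg p, ∀ b ∈ deg q, ∀ c,
    jacobiLeft br a b c =
      jacobiMid br a b c + (-1 : ℂ) ^ ((p + 1) * (q + 1)) • jacobiRight br a b c
  leibniz : ∀ p q : ℕ, ∀ a ∈ deg p, ∀ b ∈ deg q, ∀ c,
    br a (b * c) = br a b * C c + (-1 : ℂ) ^ ((p + 1) * q) • (C b * br a c)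

/-- Local functionals `V / ∂V`. -/
abbrev LocalFunctional (D : V →ₗ[ℂ] V) : Type := V ⧸ LinearMap.range D

/-- The class `∫ a` of `a`. -/
abbrev integral (D : V →ₗ[ℂ] V) : V →ₗ[ℂ] LocalFunctional D := (LinearMap.range D).mkQ

/-- `a, b ↦ ∫ {a_λ b}|_{λ=0}`. -/
def ChiralGerstenhaber.preBracket {deg : ℕ → Submodule ℂ V} {D : V →ₗ[ℂ] V}
    (G : ChiralGerstenhaber deg D) : V →ₗ[ℂ] V →ₗ[ℂ] LocalFunctional D :=
  G.br.compr₂ (integral D ∘ₗ (lcoeff V 0).restrictScalars ℂ)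

theorem coeffMap_coeff (D : V →ₗ[ℂ] V) (q : V[X]) (n : ℕ) :
    (coeffMap D q).coeff n = D (q.coeff n) := by
  induction q using Polynomial.induction_on' with
  | add p q hp hq => simp only [map_add, coeff_add, hp, hq]
  | monomial m v =>
    rw [coeffMap, lsum_apply, sum_monomial_index _ _ (by simp)]
    simp only [LinearMap.comp_apply, LinearMap.restrictScalars_apply, coeff_monomial]
    split <;> simp

/-- The bracket `[∫ a, ∫ b] = ∫ {a_λ b}|_{λ=0}` on local functionals. -/
def ChiralGerstenhaber.functionalBracket {deg : ℕ → Submodule ℂ V} {D : V →ₗ[ℂ] V}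
    (G : ChiralGerstenhaber deg D) :
    LocalFunctional D →ₗ[ℂ] LocalFunctional D →ₗ[ℂ] LocalFunctional D :=
  (LinearMap.range D).liftQ
    { toFun := fun a => (LinearMap.range D).liftQ (G.preBracket a) (by
        rintro _ ⟨b, rfl⟩
        change integral D ((G.br a (D b)).coeff 0) = 0
        rw [G.sesquilinear.right, coeff_add, coeff_X_mul_zero, zero_add, coeffMap_coeff]
        exact (Submodule.Quotient.mk_eq_zero _).2 ⟨_, rfl⟩)
      map_add' := fun a b => by
        ext x
        simp
      map_smul' := fun c a => by
        ext x
        simp }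
    (by
      rintro _ ⟨a, rfl⟩
      rw [LinearMap.mem_ker]
      ext b
      change integral D ((G.br (D a) b).coeff 0) = 0
      rw [G.sesquilinear.left, coeff_neg, coeff_X_mul_zero, neg_zero, map_zero])

end Lambda

/-! ### The shifted cotangent bundle of an affine scheme -/

section Shifted

variable (A : Type) [CommRing A] [Algebra ℂ A]

/-- Functions on the arc space of `T*[1] Spec A`, whose linear fibre coordinates are the vector
fields on `Spec A`. -/
abbrev ShiftedArc : Type := OddArc A (Derivation ℂ A A)

/-- The component of degree `p`. -/
abbrev ShiftedArc.deg (p : ℕ) : Submodule ℂ (ShiftedArc A) := OddArc.deg A (Derivation ℂ A A) p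

/-- The translation operator `∂`. -/
abbrev ShiftedArc.d : ShiftedArc A →ₗ[ℂ] ShiftedArc A := OddArc.d A (Derivation ℂ A A)

/-- The inclusion of functions on the arc space of `Spec A`. -/
abbrev ShiftedArc.fn : Arc A →+* ShiftedArc A := algebraMap (Arc A) (ShiftedArc A)

/-- The odd function `θ_D` defined by a vector field `D`. -/
def ShiftedArc.theta (D : Derivation ℂ A A) : ShiftedArc A :=
  ExteriorAlgebra.ι (Arc A) (ArcMod.jet A (Derivation ℂ A A) D 0)

variable {A}

/-- A chiral Gerstenhaber structure that extends the Schouten bracket of polyvector fields, with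
the sign normalization `{a_λ θ_D} = D(a)`, so that `{u^α_λ θ_β} = δ^α_β` in coordinates. -/
structure ExtendsSchouten (G : ChiralGerstenhaber (ShiftedArc.deg A) (ShiftedArc.d A)) :
    Prop where
  fn_fn : ∀ a b : A, G.br (ShiftedArc.fn A (Arc.of A a)) (ShiftedArc.fn A (Arc.of A b)) = 0
  fn_theta : ∀ (a : A) (D : Derivation ℂ A A),
    G.br (ShiftedArc.fn A (Arc.of A a)) (ShiftedArc.theta A D) =
      C (ShiftedArc.fn A (Arc.of A (D a)))
  theta_theta : ∀ D E : Derivation ℂ A A,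
    G.br (ShiftedArc.theta A D) (ShiftedArc.theta A E) = -C (ShiftedArc.theta A ⁅D, E⁆)

variable (A) in
/-- Coordinate systems: functions `u^α` and a basis `∂_α` of the vector fields with
`∂_α u^β = δ_α^β`. -/
structure Coordinates where
  /-- the number of coordinates -/
  n : ℕ
  /-- the coordinate functions -/
  u : Fin n → A
  /-- the coordinate vector fields -/
  frame : Module.Basis (Fin n) A (Derivation ℂ A A)
  dual : ∀ α β, frame α (u β) = if α = β then 1 else 0

/-- The density `½ ∑ θ_α H^{αβ}(∂) θ_β` of a `λ`-bracket `B`, where `H^{βα}(λ) = {u^α_λ u^β}`. -/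
def density (c : Coordinates A) (B : LambdaBracket (Arc A)) : ShiftedArc A :=
  (1 / 2 : ℂ) • ∑ α, ∑ β, (B (Arc.of A (c.u β)) (Arc.of A (c.u α))).sum fun s h =>
    ShiftedArc.theta A (c.frame α) *
      (ShiftedArc.fn A h * (ShiftedArc.d A)^[s] (ShiftedArc.theta A (c.frame β)))

variable {B : Type} [CommRing B] [Algebra ℂ B]

/-- The unique extension of a derivation along an étale homomorphism. -/
def extendDer (f : A →ₐ[ℂ] B) (hf : (f : A →+* B).Etale) (D : Derivation ℂ A A) :
    Derivation ℂ B B :=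
  letI : Algebra A B := (f : A →+* B).toAlgebra
  haveI : IsScalarTower ℂ A B := IsScalarTower.of_algebraMap_eq fun c => (f.commutes c).symm
  haveI : Algebra.Etale A B := hf
  ((TensorProduct.AlgebraTensorModule.lift
    ((LinearMap.lsmul B (Ω[A⁄ℂ] →ₗ[A] B)).flip
      ((Algebra.linearMap A B) ∘ₗ D.liftKaehlerDifferential))) ∘ₗ
    (KaehlerDifferential.tensorKaehlerEquivOfFormallyEtale ℂ A B).symm.toLinearMap).compDer
      (KaehlerDifferential.D ℂ B)

theorem extendDer_apply (f : A →ₐ[ℂ] B) (hf : (f : A →+* B).Etale) (D : Derivation ℂ A A)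
    (a : A) : extendDer f hf D (f a) = f (D a) := by
  let _ : Algebra A B := (f : A →+* B).toAlgebra
  have : IsScalarTower ℂ A B := IsScalarTower.of_algebraMap_eq fun c => (f.commutes c).symm
  have : Algebra.Etale A B := hf
  have h := KaehlerDifferential.tensorKaehlerEquivOfFormallyEtale_symm_D_algebraMap ℂ A B a
  change (TensorProduct.AlgebraTensorModule.lift _)
    ((KaehlerDifferential.tensorKaehlerEquivOfFormallyEtale ℂ A B).symm
      (KaehlerDifferential.D ℂ B (algebraMap A B a))) = _
  rw [h]
  simp
  rfl

theorem der_ext (f : A →ₐ[ℂ] B) (hf : (f : A →+* B).Etale) {D E : Derivation ℂ B B}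
    (h : ∀ a, D (f a) = E (f a)) : D = E := by
  let _ : Algebra A B := (f : A →+* B).toAlgebra
  have : IsScalarTower ℂ A B := IsScalarTower.of_algebraMap_eq fun c => (f.commutes c).symm
  have : Algebra.Etale A B := hf
  let F : Derivation A B B := Derivation.mk' (R := A)
    { toFun := fun b => (D - E) b
      map_add' := fun x y => map_add _ x y
      map_smul' := fun a b => by
        have h0 : (D - E) (algebraMap A B a) = 0 := sub_eq_zero.2 (h a)
        rw [Algebra.smul_def a b, Derivation.leibniz, h0, smul_zero, add_zero, RingHom.id_apply,
          Algebra.smul_def a, smul_eq_mul] }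
    (fun x y => (D - E).leibniz x y)
  have hF : F = 0 := by
    rw [← F.liftKaehlerDifferential_comp, Subsingleton.elim F.liftKaehlerDifferential 0]
    ext
    rfl
  ext b
  exact sub_eq_zero.1 (congrArg (fun G : Derivation A B B => G b) hF)

/-- Restriction of vector fields along an étale homomorphism, as a semilinear map. -/
def restrictDer (f : A →ₐ[ℂ] B) (hf : (f : A →+* B).Etale) :
    Derivation ℂ A A →ₛₗ[(f : A →+* B)] Derivation ℂ B B where
  toFun := extendDer f hf
  map_add' D E := der_ext f hf fun a => by
    simp only [Derivation.add_apply, extendDer_apply, map_add]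
  map_smul' r D := der_ext f hf fun a => by
    simp only [Derivation.smul_apply, extendDer_apply, smul_eq_mul, map_mul, RingHom.coe_coe]

/-- Restriction of functions on the arc space of the shifted cotangent bundle. -/
def ShiftedArc.map (f : A →ₐ[ℂ] B) (hf : (f : A →+* B).Etale) : ShiftedArc A →+* ShiftedArc B :=
  OddArc.map f (restrictDer f hf)

end Shifted

/-! ### Sheaves on a scheme over `ℂ`

The arc spaces of `X` and of `T*[1]X` are affine over `X`; their structure sheaves are given by
their sections over the preimages of the affine open subsets of `X`. -/

section Sheaf

open AlgebraicGeometry CategoryTheory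

variable {X : Scheme.{0}} (s : X ⟶ Spec (CommRingCat.of ℂ))

/-- The sections of the structure sheaf over `U`, as a `ℂ`-algebra. -/
def Sec (_ : X ⟶ Spec (CommRingCat.of ℂ)) (U : X.Opens) : Type := Γ(X, U)

instance (U : X.Opens) : CommRing (Sec s U) := inferInstanceAs (CommRing Γ(X, U))

instance (U : X.Opens) : Algebra ℂ (Sec s U) :=
  RingHom.toAlgebra
    ((Scheme.ΓSpecIso (CommRingCat.of ℂ)).inv ≫ s.appLE ⊤ U le_top).hom

/-- Restriction of functions. -/
def Sec.res {U V : X.Opens} (h : V ≤ U) : Sec s U →ₐ[ℂ] Sec s V :=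
  { (X.presheaf.map (homOfLE h).op).hom with
    commutes' := fun c => by
      have := Scheme.Hom.appLE_map s (U := ⊤) (V := U) le_top (homOfLE h).op
      exact congrArg (fun φ => φ.hom ((Scheme.ΓSpecIso (CommRingCat.of ℂ)).inv.hom c)) this }

theorem Sec.res_etale {U V : X.affineOpens} (h : V.1 ≤ U.1) :
    (Sec.res s h : Sec s U.1 →+* Sec s V.1).Etale := by
  have h1 := Scheme.Hom.etale_appLE (𝟙 X) U.2 V.2 h
  have h2 : (𝟙 X : X ⟶ X).appLE U.1 V.1 h = X.presheaf.map (homOfLE h).op := by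
    simp only [Scheme.Hom.appLE, Scheme.Hom.id_app]
    exact Category.id_comp _
  rw [h2] at h1
  exact h1

/-- Sections over `U` of the structure sheaf of the arc space of `X`. -/
abbrev ArcSec (U : X.affineOpens) : Type := Arc (Sec s U.1)

/-- Sections over `U` of the structure sheaf of the arc space of `T*[1]X`. -/
abbrev ShiftedArcSec (U : X.affineOpens) : Type := ShiftedArc (Sec s U.1)

/-- Restriction of functions on the arc space of `X`. -/
abbrev ArcSec.res {U V : X.affineOpens} (h : V.1 ≤ U.1) : ArcSec s U →ₐ[ℂ] ArcSec s V :=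
  Arc.map (Sec.res s h)

/-- Restriction of functions on the arc space of `T*[1]X`. -/
abbrev ShiftedArcSec.res {U V : X.affineOpens} (h : V.1 ≤ U.1) :
    ShiftedArcSec s U →+* ShiftedArcSec s V :=
  ShiftedArc.map (Sec.res s h) (Sec.res_etale s h)

/-- Global functions of degree `p` on the arc space of `T*[1]X`. -/
@[ext]
structure GlobalSection (p : ℕ) where
  /-- the restriction to an affine open subset -/
  val : ∀ U : X.affineOpens, ShiftedArcSec s U
  mem : ∀ U, val U ∈ ShiftedArc.deg (Sec s U.1) p
  res : ∀ (U V : X.affineOpens) (h : V.1 ≤ U.1), ShiftedArcSec.res s h (val U) = val V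

/-- `λ`-brackets on the structure sheaf of the arc space of `X`. -/
@[ext]
structure SheafBracket where
  /-- the bracket on the sections over an affine open subset -/
  br : ∀ U : X.affineOpens, LambdaBracket (ArcSec s U)
  res : ∀ (U V : X.affineOpens) (h : V.1 ≤ U.1) (a b : ArcSec s U),
    br V (ArcSec.res s h a) (ArcSec.res s h b) =
      (br U a b).map (ArcSec.res s h : ArcSec s U →+* ArcSec s V)

variable {s}

/-- The bracket satisfies sesquilinearity, skew-symmetry and the Leibniz rule. -/
def SheafBracket.IsSkewLeibniz (B : SheafBracket s) : Prop :=
  ∀ U : X.affineOpens, ArcPVA.IsSkewLeibniz (Arc.d (Sec s U.1) : ArcSec s U →ₗ[ℂ] ArcSec s U)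
    (B.br U)

/-- The bracket makes the structure sheaf of the arc space a sheaf of Poisson vertex algebras. -/
def SheafBracket.IsPVA (B : SheafBracket s) : Prop :=
  ∀ U : X.affineOpens, ArcPVA.IsPVA (Arc.d (Sec s U.1) : ArcSec s U →ₗ[ℂ] ArcSec s U) (B.br U)

/-- The `λ`-bracket `B` corresponds to `P`: in all local coordinates
`∫ P = ½ ∫ ∑ θ_α H^{αβ}(∂) θ_β` with `H^{βα}(λ) = {u^α_λ u^β}`. -/
def Corresponds (B : SheafBracket s) (P : GlobalSection s 2) : Prop :=
  ∀ (U : X.affineOpens) (c : Coordinates (Sec s U.1)),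
    integral (ShiftedArc.d (Sec s U.1)) (P.val U) =
      integral (ShiftedArc.d (Sec s U.1)) (density c (B.br U))

variable (s) in
/-- Chiral Gerstenhaber structures on the functions on the arc space of `T*[1]X`, over all affine
open subsets. -/
abbrev ChiralFamily : Type :=
  ∀ U : X.affineOpens,
    ChiralGerstenhaber (ShiftedArc.deg (Sec s U.1)) (ShiftedArc.d (Sec s U.1))

/-- `[∫ P, ∫ P] = 0` in the sheaf of local functionals. -/
def SelfCommutes (G : ChiralFamily s) (P : GlobalSection s 2) : Prop :=
  ∀ U : X.affineOpens,
    (G U).functionalBracket (integral (ShiftedArc.d (Sec s U.1)) (P.val U))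
      (integral (ShiftedArc.d (Sec s U.1)) (P.val U)) = 0

/-- `P` and `P'` differ by the total derivative of a global function. -/
def EqModTotalDerivative {p : ℕ} (P P' : GlobalSection s p) : Prop :=
  ∃ Q : GlobalSection s p,
    ∀ U : X.affineOpens, P'.val U = P.val U + ShiftedArc.d (Sec s U.1) (Q.val U)

end Sheaf

end ArcPVA

end

/-! The bracket on the functions of the shifted cotangent arc space is built one slot at a time. For
a generator `x`, a function `a` or an odd function `θ_D`, the operator `{x_λ ·}` has to be a twisted
derivation `φ` with `φ∂ = (λ+∂)φ`. Such operators are determined by their values on generators and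
can be prescribed there (`LamDer.ext`, `exists_lamDer`). For general `y`, skew-symmetry forces the
values of `{y_λ ·}` on generators. These values define a derivation because generators satisfy the
Leibniz rule in the first slot (`fnBracket_mul`, `thetaBracket_smul`), which the substitution `λ ↦
-λ-∂` turns into the ordinary one (`exists_hamiltonian`). The Jacobi identity is checked on
generators and spreads to all arguments by skew-symmetry and the Leibniz rule (`jacobiAt`). A
differential homomorphism that respects brackets of generators respects all brackets
(`IsDifferential.map_br`). Applied to the identity this gives uniqueness, applied to restriction
maps it gives naturality.

The correspondence is a derived bracket: an element `P` of degree 2 yields `{a_λ {P_0 b}}`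
(`derivedBracket`). Skew-symmetry and the Leibniz rule follow from the Schouten bracket, since
functions commute with each other. Up to sign its Jacobiator is `{a_z {b_w {P_0 {P_0 c}}}}`, and
`2{P_0 {P_0 c}} = {{P_0 P}_0 c}`. Hence the Jacobi identity amounts to `∫{P_0 P} = 0`, provided the
bracket with functions is nondegenerate in two senses. An element `y` of positive degree with `{a_λ
y} = 0` for all functions `a` of order zero is zero. If `{y_0 a} = 0` for all such `a`, then `y` is
a total derivative. Both are consequences of the Euler field `∑ θ_i ∂/∂θ_i`, which multiplies by the
degree (`QuasiCoordinates.euler`, `QuasiCoordinates.euler_functional`).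

The inverse construction is the density `½ ∑ θ_i H^{ij}(∂) θ_j`. Its derived bracket is the given
bracket (`QuasiCoordinates.derivedBracket_density`), and the density of the derived bracket of `P`
equals `P` modulo total derivatives. Coordinates exist only locally, but all these formulas need
only functions `u^i` and vector fields `D_i` with `da = ∑ D_i(a) du^i`. Such quasi-coordinates exist
on every smooth affine scheme, by splitting a surjection from a free module to the projective module
of differentials. The density does not depend on them (`QuasiCoordinates.density_eq`), so it is a
global section.

Genuine coordinates matter only because the correspondence is tested on charts. A bracket that
corresponds to `P` is the derived bracket on each chart, and everywhere because functions on the arc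
space are determined by their restrictions to charts (`arcSec_eq_zero`). Finally, `∂` is injective
in positive degrees, so local primitives `Q` of `P' - P` are unique and glue. -/

noncomputable section

open Polynomial

namespace ArcPVA

set_option linter.unusedSectionVars false

/-! ### Calculus of polynomials in `λ`: the operators `λ+∂` and `λ ↦ -λ-∂`, and evaluation at
numbers. -/

section LambdaCalculus

variable {V : Type} [Ring V] [Algebra ℂ V]

/-- A predicate on `V[λ]` that holds for constants and is stable under addition and under
multiplication by `λ` holds everywhere. -/
theorem poly_induction {p : V[X] → Prop} (hC : ∀ v, p (C v)) (hadd : ∀ q r, p q → p r → p (q + r))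
    (hX : ∀ q, p q → p (X * q)) (q : V[X]) : p q := by
  refine Polynomial.induction_on q hC hadd fun n a h => ?_
  have := hX _ h
  rwa [← mul_assoc, X_mul_C, mul_assoc, ← pow_succ'] at this

theorem coeffMap_C (D : V →ₗ[ℂ] V) (v : V) : coeffMap D (C v) = C (D v) := by
  ext n
  rw [coeffMap_coeff, coeff_C, coeff_C]
  split <;> simp

theorem coeffMap_X_mul (D : V →ₗ[ℂ] V) (q : V[X]) : coeffMap D (X * q) = X * coeffMap D q := by
  ext n
  cases n with
  | zero => rw [coeffMap_coeff, coeff_X_mul_zero, coeff_X_mul_zero, map_zero]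
  | succ n => rw [coeffMap_coeff, coeff_X_mul, coeff_X_mul, coeffMap_coeff]

/-- The operator `λ + ∂` on `V[λ]`. -/
def shiftOp (D : V →ₗ[ℂ] V) : V[X] →ₗ[ℂ] V[X] := LinearMap.mulLeft ℂ (X : V[X]) + coeffMap D

theorem shiftOp_apply (D : V →ₗ[ℂ] V) (q : V[X]) : shiftOp D q = X * q + coeffMap D q := rfl

theorem shiftOp_X_mul (D : V →ₗ[ℂ] V) (q : V[X]) : shiftOp D (X * q) = X * shiftOp D q := by
  rw [shiftOp_apply, shiftOp_apply, coeffMap_X_mul, mul_add]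

/-- `λ + ∂` is injective. -/
theorem eq_zero_of_shiftOp_eq_zero (D : V →ₗ[ℂ] V) {q : V[X]} (h : shiftOp D q = 0) : q = 0 := by
  by_contra hq
  have h1 := congrArg (fun r : V[X] => r.coeff (q.natDegree + 1)) h
  simp only [shiftOp_apply, coeff_add, coeff_X_mul, coeffMap_coeff, coeff_zero,
    coeff_eq_zero_of_natDegree_lt (Nat.lt_succ_self q.natDegree), map_zero, add_zero] at h1
  exact hq (leadingCoeff_eq_zero.1 h1)

theorem negShift_C (D : V →ₗ[ℂ] V) (v : V) : negShift D (C v) = C v := by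
  rw [negShift, lsum_apply, sum_C_index (by simp)]
  simp

/-- Together with `negShift_C` this recursion determines the substitution. It lets the later
identities be proved by `poly_induction`, without binomial expansions. -/
theorem negShift_X_mul (D : V →ₗ[ℂ] V) (q : V[X]) :
    negShift D (X * q) = -shiftOp D (negShift D q) := by
  induction q using Polynomial.induction_on' with
  | add p q hp hq => simp only [mul_add, map_add, hp, hq, neg_add]
  | monomial n v =>
    rw [X_mul_monomial, negShift, lsum_apply, lsum_apply, sum_monomial_index _ _ (by simp),
      sum_monomial_index _ _ (by simp), LinearMap.comp_apply, LinearMap.comp_apply, pow_succ']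
    rfl

theorem negShift_shiftOp (D : V →ₗ[ℂ] V) (q : V[X]) :
    negShift D (shiftOp D q) = -(X * negShift D q) := by
  induction q using poly_induction with
  | hC v =>
    rw [shiftOp_apply, coeffMap_C, map_add, negShift_X_mul, negShift_C, negShift_C, shiftOp_apply,
      coeffMap_C]
    abel
  | hadd q r hq hr => simp only [map_add, hq, hr, mul_add, neg_add]
  | hX q hq => rw [shiftOp_X_mul, negShift_X_mul, hq, map_neg, shiftOp_X_mul, negShift_X_mul,
      mul_neg]

/-- The substitution is an involution because `-(-λ-∂)-∂ = λ`. This makes skew-symmetry a symmetric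
relation between the two arguments. -/
theorem negShift_negShift (D : V →ₗ[ℂ] V) (q : V[X]) : negShift D (negShift D q) = q := by
  induction q using poly_induction with
  | hC v => rw [negShift_C, negShift_C]
  | hadd q r hq hr => simp only [map_add, hq, hr]
  | hX q hq => rw [negShift_X_mul, map_neg, negShift_shiftOp, hq, neg_neg]

/-- Polynomials with coefficients in a subspace. -/
def polyIn (S : Submodule ℂ V) : Submodule ℂ V[X] where
  carrier := {q | ∀ n, q.coeff n ∈ S}
  add_mem' hp hq n := by rw [coeff_add]; exact add_mem (hp n) (hq n)
  zero_mem' n := by rw [coeff_zero]; exact zero_mem S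
  smul_mem' c q hq n := by rw [coeff_smul]; exact S.smul_mem c (hq n)

theorem C_mem_polyIn {S : Submodule ℂ V} {v : V} (hv : v ∈ S) : C v ∈ polyIn S := fun n => by
  rw [coeff_C]
  split
  · exact hv
  · exact zero_mem S

theorem X_mul_mem_polyIn {S : Submodule ℂ V} {q : V[X]} (hq : q ∈ polyIn S) :
    X * q ∈ polyIn S := fun n => by
  cases n with
  | zero => rw [coeff_X_mul_zero]; exact zero_mem S
  | succ n => rw [coeff_X_mul]; exact hq n

theorem C_mul_mem_polyIn {S S' : Submodule ℂ V} {v : V} (h : ∀ w ∈ S, v * w ∈ S') {q : V[X]}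
    (hq : q ∈ polyIn S) : C v * q ∈ polyIn S' := fun n => by
  rw [coeff_C_mul]
  exact h _ (hq n)

theorem mul_C_mem_polyIn {S S' : Submodule ℂ V} {v : V} (h : ∀ w ∈ S, w * v ∈ S') {q : V[X]}
    (hq : q ∈ polyIn S) : q * C v ∈ polyIn S' := fun n => by
  rw [coeff_mul_C]
  exact h _ (hq n)

theorem coeffMap_mem_polyIn {S S' : Submodule ℂ V} {D : V →ₗ[ℂ] V} (h : ∀ v ∈ S, D v ∈ S')
    {q : V[X]} (hq : q ∈ polyIn S) : coeffMap D q ∈ polyIn S' := fun n => by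
  rw [coeffMap_coeff]
  exact h _ (hq n)

theorem shiftOp_mem_polyIn {S : Submodule ℂ V} {D : V →ₗ[ℂ] V} (h : ∀ v ∈ S, D v ∈ S)
    {q : V[X]} (hq : q ∈ polyIn S) : shiftOp D q ∈ polyIn S :=
  add_mem (X_mul_mem_polyIn hq) (coeffMap_mem_polyIn h hq)

theorem negShift_eq_sum (D : V →ₗ[ℂ] V) (q : V[X]) :
    negShift D q = q.sum fun n v => ((-shiftOp D) ^ n) (C v) := rfl

theorem negShift_mem_polyIn {S : Submodule ℂ V} {D : V →ₗ[ℂ] V} (h : ∀ v ∈ S, D v ∈ S)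
    {q : V[X]} (hq : q ∈ polyIn S) : negShift D q ∈ polyIn S := by
  rw [negShift_eq_sum, Polynomial.sum]
  refine Submodule.sum_mem _ fun n _ => ?_
  have h1 : ∀ m, ((-shiftOp D) ^ m) (C (q.coeff n)) ∈ polyIn S := fun m => by
    induction m with
    | zero => exact C_mem_polyIn (hq _)
    | succ m ih =>
      rw [pow_succ', Module.End.mul_apply, LinearMap.neg_apply]
      exact neg_mem (shiftOp_mem_polyIn h ih)
  exact h1 _

/-! #### Evaluation of the variable at a number -/

/-- Evaluation of polynomials in `λ` at a number. -/
def evalAt (z : ℂ) : V[X] →ₗ[ℂ] V := lsum fun n => z ^ n • LinearMap.id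

theorem evalAt_eq_sum (z : ℂ) (q : V[X]) : evalAt z q = q.sum fun n v => z ^ n • v := rfl

theorem evalAt_monomial (z : ℂ) (n : ℕ) (v : V) : evalAt z (monomial n v) = z ^ n • v := by
  rw [evalAt_eq_sum, sum_monomial_index _ _ (by simp)]

theorem evalAt_C (z : ℂ) (v : V) : evalAt z (C v) = v := by
  rw [← monomial_zero_left, evalAt_monomial, pow_zero, one_smul]

theorem evalAt_X_mul (z : ℂ) (q : V[X]) : evalAt z (X * q) = z • evalAt z q := by
  induction q using Polynomial.induction_on' with
  | add p q hp hq => simp only [mul_add, map_add, hp, hq, smul_add]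
  | monomial n v => rw [X_mul_monomial, evalAt_monomial, evalAt_monomial, pow_succ', mul_smul]

theorem evalAt_coeffMap (z : ℂ) (D : V →ₗ[ℂ] V) (q : V[X]) :
    evalAt z (coeffMap D q) = D (evalAt z q) := by
  induction q using poly_induction with
  | hC v => rw [coeffMap_C, evalAt_C, evalAt_C]
  | hadd q r hq hr => simp only [map_add, hq, hr]
  | hX q hq => rw [coeffMap_X_mul, evalAt_X_mul, evalAt_X_mul, hq, map_smul]

theorem evalAt_shiftOp (z : ℂ) (D : V →ₗ[ℂ] V) (q : V[X]) :
    evalAt z (shiftOp D q) = z • evalAt z q + D (evalAt z q) := by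
  rw [shiftOp_apply, map_add, evalAt_X_mul, evalAt_coeffMap]

theorem evalAt_C_mul (z : ℂ) (v : V) (q : V[X]) : evalAt z (C v * q) = v * evalAt z q := by
  induction q using Polynomial.induction_on' with
  | add p q hp hq => simp only [mul_add, map_add, hp, hq]
  | monomial n w => rw [C_mul_monomial, evalAt_monomial, evalAt_monomial, mul_smul_comm]

theorem evalAt_mul_C (z : ℂ) (v : V) (q : V[X]) : evalAt z (q * C v) = evalAt z q * v := by
  induction q using Polynomial.induction_on' with
  | add p q hp hq => simp only [add_mul, map_add, hp, hq]
  | monomial n w => rw [monomial_mul_C, evalAt_monomial, evalAt_monomial, smul_mul_assoc]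

theorem evalAt_zero_eq_coeff (q : V[X]) : evalAt 0 q = q.coeff 0 := by
  induction q using poly_induction with
  | hC v => rw [evalAt_C, coeff_C_zero]
  | hadd q r hq hr => rw [map_add, coeff_add, hq, hr]
  | hX q hq => rw [evalAt_X_mul, zero_smul, coeff_X_mul_zero]

/-- A polynomial is determined by its values at numbers. -/
theorem eq_zero_of_evalAt {q : V[X]} (h : ∀ z, evalAt z q = 0) : q = 0 := by
  ext n
  rw [coeff_zero]
  -- Linear functionals separate the points of a complex vector space. They reduce the claim to
  -- scalar polynomials, which are determined by their values over an infinite field.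
  refine (Module.forall_dual_apply_eq_zero_iff ℂ (q.coeff n)).1 fun f => ?_
  let r : ℂ[X] := q.sum fun n v => monomial n (f v)
  have hr : ∀ m, r.coeff m = f (q.coeff m) := fun m => by
    simp only [r, Polynomial.sum, finsetSum_coeff, coeff_monomial]
    rw [Finset.sum_eq_single m]
    · simp
    · intro b _ hb
      simp [hb]
    · intro hm
      simp [notMem_support_iff.1 hm]
  have hr0 : r = 0 := by
    refine Polynomial.funext fun z => ?_
    have h1 := congrArg f (h z)
    rw [evalAt_eq_sum, Polynomial.sum, map_sum, map_zero] at h1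
    rw [eval_zero, ← h1]
    simp only [r, Polynomial.sum, eval_finsetSum, eval_monomial, map_smul, smul_eq_mul]
    exact Finset.sum_congr rfl fun m _ => mul_comm _ _
  rw [← hr, hr0, coeff_zero]

theorem poly_ext_evalAt {q r : V[X]} (h : ∀ z, evalAt z q = evalAt z r) : q = r :=
  sub_eq_zero.1 (eq_zero_of_evalAt fun z => by rw [map_sub, h, sub_self])

/-- Evaluation of both variables of `V[λ][μ]` at numbers. -/
def evalAt₂ (z w : ℂ) (q : V[X][X]) : V := q.sum fun n r => w ^ n • evalAt z r

theorem evalAt₂_add (z w : ℂ) (q r : V[X][X]) :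
    evalAt₂ z w (q + r) = evalAt₂ z w q + evalAt₂ z w r :=
  Polynomial.sum_add_index q r _ (fun i => by simp) (fun i a b => by rw [map_add, smul_add])

theorem evalAt₂_monomial (z w : ℂ) (n : ℕ) (r : V[X]) :
    evalAt₂ z w (monomial n r) = w ^ n • evalAt z r := by
  rw [evalAt₂, sum_monomial_index _ _ (by simp)]

theorem evalAt₂_sum (z w : ℂ) {ι : Type} (s : Finset ι) (f : ι → V[X][X]) :
    evalAt₂ z w (∑ i ∈ s, f i) = ∑ i ∈ s, evalAt₂ z w (f i) :=
  map_sum (⟨⟨evalAt₂ z w, by simp [evalAt₂]⟩, evalAt₂_add z w⟩ : V[X][X] →+ V) f s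

theorem evalAt₂_smul (z w c : ℂ) (q : V[X][X]) : evalAt₂ z w (c • q) = c • evalAt₂ z w q := by
  induction q using Polynomial.induction_on' with
  | add p q hp hq => rw [smul_add, evalAt₂_add, evalAt₂_add, hp, hq, smul_add]
  | monomial n r => rw [smul_monomial, evalAt₂_monomial, evalAt₂_monomial, map_smul, smul_comm]

theorem evalAt₂_mul_lam (z w : ℂ) (q : V[X][X]) : evalAt₂ z w (q * lam) = z • evalAt₂ z w q := by
  induction q using Polynomial.induction_on' with
  | add p q hp hq => rw [add_mul, evalAt₂_add, evalAt₂_add, hp, hq, smul_add]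
  | monomial n r =>
    rw [lam, monomial_mul_C, evalAt₂_monomial, evalAt₂_monomial, ← X_mul, evalAt_X_mul, smul_comm]

theorem evalAt₂_mul_mu (z w : ℂ) (q : V[X][X]) : evalAt₂ z w (q * mu) = w • evalAt₂ z w q := by
  induction q using Polynomial.induction_on' with
  | add p q hp hq => rw [add_mul, evalAt₂_add, evalAt₂_add, hp, hq, smul_add]
  | monomial n r => rw [mu, monomial_mul_X, evalAt₂_monomial, evalAt₂_monomial, pow_succ', mul_smul]

theorem evalAt₂_mul_pow {z w c : ℂ} {s : V[X][X]}
    (h : ∀ q, evalAt₂ z w (q * s) = c • evalAt₂ z w q) (q : V[X][X]) (n : ℕ) :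
    evalAt₂ z w (q * s ^ n) = c ^ n • evalAt₂ z w q := by
  induction n with
  | zero => simp
  | succ n ih => rw [pow_succ, ← mul_assoc, h, ih, pow_succ', mul_smul]

theorem evalAt₂_substVar {z w c : ℂ} {s : V[X][X]}
    (h : ∀ q, evalAt₂ z w (q * s) = c • evalAt₂ z w q) (q : V[X]) :
    evalAt₂ z w (substVar s q) = evalAt c q := by
  rw [substVar, Polynomial.sum, evalAt₂_sum, evalAt_eq_sum, Polynomial.sum]
  refine Finset.sum_congr rfl fun n _ => ?_
  rw [evalAt₂_mul_pow h, ← monomial_zero_left, evalAt₂_monomial, pow_zero, one_smul, evalAt_C]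

theorem evalAt₂_mul_lam_add_mu (z w : ℂ) (q : V[X][X]) :
    evalAt₂ z w (q * (lam + mu)) = (z + w) • evalAt₂ z w q := by
  rw [mul_add, evalAt₂_add, evalAt₂_mul_lam, evalAt₂_mul_mu, add_smul]

/-- The one-variable criterion is applied first in `μ`, with `λ` fixed at a number, and then in `λ`,
coefficient by coefficient. -/
theorem poly_ext_evalAt₂ {q r : V[X][X]} (h : ∀ z w, evalAt₂ z w q = evalAt₂ z w r) : q = r := by
  have key : ∀ q : V[X][X], (∀ z w, evalAt₂ z w q = 0) → q = 0 := by
    intro q h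
    ext1 n
    refine eq_zero_of_evalAt fun z => ?_
    let q' : V[X] := q.sum fun n r => monomial n (evalAt z r)
    have hq' : q' = 0 := eq_zero_of_evalAt fun w => by
      rw [← h z w, evalAt₂]
      simp only [q', Polynomial.sum, map_sum, evalAt_monomial]
    have h1 : q'.coeff n = evalAt z (q.coeff n) := by
      simp only [q', Polynomial.sum, finsetSum_coeff, coeff_monomial]
      rw [Finset.sum_eq_single n]
      · simp
      · intro b _ hb
        simp [hb]
      · intro hm
        simp [notMem_support_iff.1 hm]
    rw [← h1, hq', coeff_zero]
  refine sub_eq_zero.1 (key _ fun z w => ?_)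
  rw [sub_eq_add_neg, evalAt₂_add, ← neg_one_smul ℂ r, evalAt₂_smul, h]
  simp

/-- At numbers the formal nested bracket becomes a composition of honest bilinear maps `V × V → V`.
In this form the Jacobi identity can be manipulated without formal variables. -/
theorem evalAt₂_jacobiLeft (B : LambdaBracket V) (a b c : V) (z w : ℂ) :
    evalAt₂ z w (jacobiLeft B a b c) = evalAt z (B a (evalAt w (B b c))) := by
  rw [jacobiLeft, Polynomial.sum, evalAt₂_sum, evalAt_eq_sum w, Polynomial.sum, map_sum, map_sum]
  refine Finset.sum_congr rfl fun n _ => ?_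
  rw [evalAt₂_mul_pow (evalAt₂_mul_mu z w), evalAt₂_substVar (evalAt₂_mul_lam z w), map_smul,
    map_smul]

theorem evalAt₂_jacobiMid (B : LambdaBracket V) (a b c : V) (z w : ℂ) :
    evalAt₂ z w (jacobiMid B a b c) = evalAt (z + w) (B (evalAt z (B a b)) c) := by
  rw [jacobiMid, Polynomial.sum, evalAt₂_sum, evalAt_eq_sum z, Polynomial.sum, map_sum,
    LinearMap.sum_apply, map_sum]
  refine Finset.sum_congr rfl fun n _ => ?_
  rw [evalAt₂_mul_pow (evalAt₂_mul_lam z w), evalAt₂_substVar (evalAt₂_mul_lam_add_mu z w),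
    map_smul, LinearMap.smul_apply, map_smul]

theorem evalAt₂_jacobiRight (B : LambdaBracket V) (a b c : V) (z w : ℂ) :
    evalAt₂ z w (jacobiRight B a b c) = evalAt w (B b (evalAt z (B a c))) := by
  rw [jacobiRight, Polynomial.sum, evalAt₂_sum, evalAt_eq_sum z, Polynomial.sum, map_sum, map_sum]
  refine Finset.sum_congr rfl fun n _ => ?_
  rw [evalAt₂_mul_pow (evalAt₂_mul_lam z w), evalAt₂_substVar (evalAt₂_mul_mu z w), map_smul,
    map_smul]

/-- The graded Jacobi identity `{a_λ {b_μ c}} = {{a_λ b}_{λ+μ} c} + s {b_μ {a_λ c}}`, checked at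
numbers. -/
theorem jacobi_iff (B : LambdaBracket V) (s : ℂ) (a b c : V) :
    jacobiLeft B a b c = jacobiMid B a b c + s • jacobiRight B a b c ↔
      ∀ z w, evalAt z (B a (evalAt w (B b c))) =
        evalAt (z + w) (B (evalAt z (B a b)) c) + s • evalAt w (B b (evalAt z (B a c))) := by
  constructor
  · intro h z w
    rw [← evalAt₂_jacobiLeft, h, evalAt₂_add, evalAt₂_smul, evalAt₂_jacobiMid,
      evalAt₂_jacobiRight]
  · intro h
    refine poly_ext_evalAt₂ fun z w => ?_
    rw [evalAt₂_jacobiLeft, h, evalAt₂_add, evalAt₂_smul, evalAt₂_jacobiMid, evalAt₂_jacobiRight]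

end LambdaCalculus

/-! ### Derivations, parity and degrees on exterior algebras. -/

section Super

variable {R M : Type} [CommRing R] [Algebra ℂ R] [AddCommGroup M] [Module R M] [Module ℂ M]
  [IsScalarTower ℂ R M]

theorem extAlg_smul_def (c : ℂ) (x : ExteriorAlgebra R M) :
    c • x = algebraMap R (ExteriorAlgebra R M) (algebraMap ℂ R c) * x := by
  rw [← Algebra.smul_def, algebraMap_smul]

/-- A ring homomorphism to the dual numbers that lifts the identity has a derivation as its second
component. This is the lifting property needed for `extDer_mul`. -/
theorem extDerHom_fst (δ : Derivation ℂ R R) (δM : M →ₗ[ℂ] M)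
    (h : ∀ (r : R) m, δM (r • m) = δ r • m + r • δM m) (x : ExteriorAlgebra R M) :
    (extDerHom δ δM h x).fst = x := by
  induction x using ExteriorAlgebra.induction with
  | algebraMap r => rw [extDerHom, extLift_algebraMap]; simp
  | ι m => rw [extDerHom, extLift_ι]; simp
  | mul a b ha hb => rw [map_mul, TrivSqZeroExt.fst_mul, ha, hb]
  | add a b ha hb => rw [map_add, TrivSqZeroExt.fst_add, ha, hb]

theorem extDer_mul (δ : Derivation ℂ R R) (δM : M →ₗ[ℂ] M)
    (h : ∀ (r : R) m, δM (r • m) = δ r • m + r • δM m) (x y : ExteriorAlgebra R M) :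
    extDer δ δM h (x * y) = extDer δ δM h x * y + x * extDer δ δM h y := by
  change (extDerHom δ δM h (x * y)).snd = (extDerHom δ δM h x).snd * y +
    x * (extDerHom δ δM h y).snd
  rw [map_mul, TrivSqZeroExt.snd_mul, extDerHom_fst, extDerHom_fst, add_comm]
  rfl

theorem extDer_algebraMap (δ : Derivation ℂ R R) (δM : M →ₗ[ℂ] M)
    (h : ∀ (r : R) m, δM (r • m) = δ r • m + r • δM m) (r : R) :
    extDer δ δM h (algebraMap R _ r) = algebraMap R _ (δ r) := by
  change (extDerHom δ δM h _).snd = _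
  rw [extDerHom, extLift_algebraMap]
  simp [Algebra.algebraMap_eq_smul_one]

theorem extDer_ι (δ : Derivation ℂ R R) (δM : M →ₗ[ℂ] M)
    (h : ∀ (r : R) m, δM (r • m) = δ r • m + r • δM m) (m : M) :
    extDer δ δM h (ExteriorAlgebra.ι R m) = ExteriorAlgebra.ι R (δM m) := by
  change (extDerHom δ δM h _).snd = _
  rw [extDerHom, extLift_ι]
  simp

/-- The grading automorphism `(-1)^deg`. -/
def sigma : ExteriorAlgebra R M →ₐ[R] ExteriorAlgebra R M := CliffordAlgebra.involute

theorem sigma_ι (m : M) : sigma (ExteriorAlgebra.ι R m) = -ExteriorAlgebra.ι R m :=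
  CliffordAlgebra.involute_ι m

theorem sigma_sigma (x : ExteriorAlgebra R M) : sigma (sigma x) = x :=
  CliffordAlgebra.involute_involute x

theorem sigma_csmul (c : ℂ) (x : ExteriorAlgebra R M) : sigma (c • x) = c • sigma x := by
  rw [extAlg_smul_def, map_mul, AlgHom.commutes, ← extAlg_smul_def]

theorem sigma_pow_succ (n : ℕ) (x : ExteriorAlgebra R M) :
    (sigma ^ (n + 1)) x = sigma ((sigma ^ n) x) := by
  rw [pow_succ']
  rfl

variable (R M) in
/-- Elements of parity `p`. -/
def parity (p : ℕ) : Submodule ℂ (ExteriorAlgebra R M) where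
  carrier := {x | sigma x = (-1 : ℂ) ^ p • x}
  add_mem' {x y} hx hy := by
    rw [Set.mem_ofPred_eq] at *
    rw [map_add, hx, hy, smul_add]
  zero_mem' := by simp
  smul_mem' c x hx := by
    rw [Set.mem_ofPred_eq] at *
    rw [sigma_csmul, hx, smul_comm]

theorem mem_parity {p : ℕ} {x : ExteriorAlgebra R M} :
    x ∈ parity R M p ↔ sigma x = (-1 : ℂ) ^ p • x := Iff.rfl

theorem parity_congr {p q : ℕ} (h : (-1 : ℂ) ^ p = (-1) ^ q) : parity R M p = parity R M q := by
  ext x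
  rw [mem_parity, mem_parity, h]

theorem sigma_pow_of_mem {p : ℕ} {x : ExteriorAlgebra R M} (hx : x ∈ parity R M p) (n : ℕ) :
    (sigma ^ n) x = (-1 : ℂ) ^ (n * p) • x := by
  induction n with
  | zero => simp
  | succ n ih =>
    rw [sigma_pow_succ, ih, sigma_csmul, mem_parity.1 hx, smul_smul, ← pow_add, Nat.succ_mul]

theorem algebraMap_mem_parity (r : R) : algebraMap R _ r ∈ parity R M 0 := by
  rw [mem_parity, AlgHom.commutes, pow_zero, one_smul]

theorem ι_mem_parity (m : M) : ExteriorAlgebra.ι R m ∈ parity R M 1 := by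
  rw [mem_parity, sigma_ι, pow_one, neg_one_smul]

theorem mul_mem_parity {p q : ℕ} {x y : ExteriorAlgebra R M} (hx : x ∈ parity R M p)
    (hy : y ∈ parity R M q) : x * y ∈ parity R M (p + q) := by
  rw [mem_parity] at *
  rw [map_mul, hx, hy, smul_mul_smul_comm, ← pow_add]

/-- Generators anticommute, and both sides are compatible with products in `x`. The full sign rule
follows from this case. -/
theorem ι_mul_eq (m : M) (x : ExteriorAlgebra R M) :
    ExteriorAlgebra.ι R m * x = sigma x * ExteriorAlgebra.ι R m := by
  induction x using ExteriorAlgebra.induction with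
  | algebraMap r => rw [AlgHom.commutes]; exact (Algebra.commutes r _).symm
  | ι m' =>
    rw [sigma_ι, neg_mul]
    exact eq_neg_of_add_eq_zero_left (ExteriorAlgebra.ι_add_mul_swap m m')
  | mul a b ha hb => rw [← mul_assoc, ha, mul_assoc, hb, map_mul, mul_assoc]
  | add a b ha hb => rw [mul_add, ha, hb, map_add, add_mul]

/-- Graded commutativity. -/
theorem mul_eq_sigma_pow_mul {p : ℕ} {x : ExteriorAlgebra R M} (hx : x ∈ parity R M p)
    (y : ExteriorAlgebra R M) : x * y = (sigma ^ p) y * x := by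
  induction y using ExteriorAlgebra.induction with
  | algebraMap r => rw [AlgHom.commutes]; exact (Algebra.commutes r _).symm
  | ι m =>
    rw [sigma_pow_of_mem (ι_mem_parity m), mul_one, smul_mul_assoc, ι_mul_eq, mem_parity.1 hx,
      smul_mul_assoc, smul_smul, ← mul_pow]
    simp
  | mul a b ha hb => rw [← mul_assoc, ha, mul_assoc, hb, map_mul, mul_assoc]
  | add a b ha hb => rw [mul_add, ha, hb, map_add, add_mul]

theorem mul_comm_of_mem {p q : ℕ} {x y : ExteriorAlgebra R M} (hx : x ∈ parity R M p)
    (hy : y ∈ parity R M q) : x * y = (-1 : ℂ) ^ (p * q) • (y * x) := by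
  rw [mul_eq_sigma_pow_mul hx, sigma_pow_of_mem hy, smul_mul_assoc]

/-- Graded commutativity of polynomials with constants. -/
theorem poly_mul_C_eq {p : ℕ} {f : (ExteriorAlgebra R M)[X]} (hf : f ∈ polyIn (parity R M p))
    (y : ExteriorAlgebra R M) : f * C y = C ((sigma ^ p) y) * f := by
  ext1 n
  rw [coeff_mul_C, coeff_C_mul, mul_eq_sigma_pow_mul (hf n)]

theorem poly_mul_C_of_mem {p q : ℕ} {f : (ExteriorAlgebra R M)[X]}
    (hf : f ∈ polyIn (parity R M p)) {y : ExteriorAlgebra R M} (hy : y ∈ parity R M q) :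
    f * C y = (-1 : ℂ) ^ (p * q) • (C y * f) := by
  ext1 n
  rw [coeff_mul_C, coeff_smul, coeff_C_mul, mul_comm_of_mem (hf n) hy]

/-- The even part of an element if `p = 0`, the odd part if `p = 1`. -/
def parityPart (p : ℕ) : ExteriorAlgebra R M →ₗ[ℂ] ExteriorAlgebra R M where
  toFun x := (1 / 2 : ℂ) • (x + (-1 : ℂ) ^ p • sigma x)
  map_add' x y := by simp only [map_add, smul_add]; abel
  map_smul' c x := by
    simp only [sigma_csmul, RingHom.id_apply]
    rw [smul_comm ((-1 : ℂ) ^ p) c, ← smul_add, smul_comm]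

theorem parityPart_apply (p : ℕ) (x : ExteriorAlgebra R M) :
    parityPart p x = (1 / 2 : ℂ) • (x + (-1 : ℂ) ^ p • sigma x) := rfl

theorem parityPart_mem (p : ℕ) (x : ExteriorAlgebra R M) : parityPart p x ∈ parity R M p := by
  rw [mem_parity, parityPart_apply, sigma_csmul, map_add, sigma_csmul, sigma_sigma, smul_comm,
    smul_add ((-1 : ℂ) ^ p), smul_smul ((-1 : ℂ) ^ p), ← mul_pow]
  simp [add_comm]

theorem parityPart_of_mem {p : ℕ} {x : ExteriorAlgebra R M} (hx : x ∈ parity R M p) :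
    parityPart p x = x := by
  rw [parityPart_apply, mem_parity.1 hx, smul_smul, ← mul_pow]
  simp only [mul_neg, mul_one, neg_neg, one_pow, one_smul]
  rw [← two_smul ℂ x, smul_smul]
  norm_num

theorem parityPart_of_mem_succ {p : ℕ} {x : ExteriorAlgebra R M} (hx : x ∈ parity R M (p + 1)) :
    parityPart p x = 0 := by
  rw [parityPart_apply, mem_parity.1 hx, smul_smul, pow_succ, ← mul_assoc, ← mul_pow]
  simp

/-! #### Homogeneous components -/

theorem algebraMap_mem_deg (r : R) : algebraMap R (ExteriorAlgebra R M) r ∈ ⋀[R]^0 M := by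
  rw [ExteriorAlgebra.exteriorPower, pow_zero]
  exact Submodule.algebraMap_mem r

theorem mem_deg_zero {x : ExteriorAlgebra R M} (hx : x ∈ ⋀[R]^0 M) :
    ∃ r, algebraMap R (ExteriorAlgebra R M) r = x := by
  rw [ExteriorAlgebra.exteriorPower, pow_zero] at hx
  exact Submodule.mem_one.1 hx

theorem ι_mem_deg (m : M) : ExteriorAlgebra.ι R m ∈ ⋀[R]^1 M := by
  rw [ExteriorAlgebra.exteriorPower, pow_one]
  exact LinearMap.mem_range_self _ m

theorem mul_mem_deg {p q : ℕ} {x y : ExteriorAlgebra R M} (hx : x ∈ ⋀[R]^p M)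
    (hy : y ∈ ⋀[R]^q M) : x * y ∈ ⋀[R]^(p + q) M := by
  rw [ExteriorAlgebra.exteriorPower, pow_add]
  exact Submodule.mul_mem_mul hx hy

/-- Induction on homogeneous elements. -/
theorem homogeneous_induction {P : ℕ → ExteriorAlgebra R M → Prop}
    (hadd : ∀ p x y, P p x → P p y → P p (x + y)) (h0 : ∀ r : R, P 0 (algebraMap R _ r))
    (hmul : ∀ p m x, x ∈ ⋀[R]^p M → P p x → P (p + 1) (ExteriorAlgebra.ι R m * x))
    {p : ℕ} {x : ExteriorAlgebra R M} (hx : x ∈ ⋀[R]^p M) : P p x := by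
  induction p generalizing x with
  | zero =>
    obtain ⟨r, rfl⟩ := mem_deg_zero hx
    exact h0 r
  | succ p ih =>
    rw [ExteriorAlgebra.exteriorPower, pow_succ'] at hx
    refine Submodule.mul_induction_on hx ?_ fun x y => hadd _ x y
    rintro _ ⟨m, rfl⟩ y hy
    exact hmul p m y hy (ih hy)

theorem deg_le_parity {p : ℕ} {x : ExteriorAlgebra R M} (hx : x ∈ ⋀[R]^p M) :
    x ∈ parity R M p := by
  refine homogeneous_induction (P := fun p x => x ∈ parity R M p) (fun p x y => add_mem)
    algebraMap_mem_parity (fun p m x _ hx => ?_) hx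
  rw [add_comm]
  exact mul_mem_parity (ι_mem_parity m) hx

/-- Every element is a sum of homogeneous ones. -/
theorem sum_homogeneous_induction {P : ExteriorAlgebra R M → Prop}
    (hadd : ∀ x y, P x → P y → P (x + y)) (h : ∀ p, ∀ x ∈ ⋀[R]^p M, P x)
    (x : ExteriorAlgebra R M) : P x := by
  classical
  rw [← DirectSum.sum_support_decompose (fun i : ℕ => ⋀[R]^i M) x]
  refine Finset.sum_induction _ P hadd ?_ fun i _ => h i _ (SetLike.coe_mem _)
  exact h 0 0 (zero_mem _)

theorem extDer_mem_deg (δ : Derivation ℂ R R) (δM : M →ₗ[ℂ] M)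
    (h : ∀ (r : R) m, δM (r • m) = δ r • m + r • δM m) {p : ℕ} {x : ExteriorAlgebra R M}
    (hx : x ∈ ⋀[R]^p M) : extDer δ δM h x ∈ ⋀[R]^p M := by
  refine homogeneous_induction (P := fun p x => extDer δ δM h x ∈ ⋀[R]^p M)
    (fun p x y hx hy => ?_) (fun r => ?_) (fun p m x hx' hx => ?_) hx
  · rw [map_add]
    exact add_mem hx hy
  · rw [extDer_algebraMap]
    exact algebraMap_mem_deg _
  · rw [extDer_mul, extDer_ι, add_comm p]
    exact add_mem (mul_mem_deg (ι_mem_deg _) hx') (mul_mem_deg (ι_mem_deg _) hx)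

theorem sigma_extDer (δ : Derivation ℂ R R) (δM : M →ₗ[ℂ] M)
    (h : ∀ (r : R) m, δM (r • m) = δ r • m + r • δM m) (x : ExteriorAlgebra R M) :
    sigma (extDer δ δM h x) = extDer δ δM h (sigma x) := by
  induction x using ExteriorAlgebra.induction with
  | algebraMap r => rw [extDer_algebraMap, AlgHom.commutes, AlgHom.commutes, extDer_algebraMap]
  | ι m => rw [extDer_ι, sigma_ι, sigma_ι, map_neg, extDer_ι]
  | mul a b ha hb => simp only [extDer_mul, map_add, map_mul, ha, hb]
  | add a b ha hb => simp only [map_add, ha, hb]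

theorem sigma_pow_extDer (δ : Derivation ℂ R R) (δM : M →ₗ[ℂ] M)
    (h : ∀ (r : R) m, δM (r • m) = δ r • m + r • δM m) (n : ℕ) (x : ExteriorAlgebra R M) :
    (sigma ^ n) (extDer δ δM h x) = extDer δ δM h ((sigma ^ n) x) := by
  induction n with
  | zero => rfl
  | succ n ih => rw [sigma_pow_succ, ih, sigma_extDer, ← sigma_pow_succ]

theorem extDer_mem_parity (δ : Derivation ℂ R R) (δM : M →ₗ[ℂ] M)
    (h : ∀ (r : R) m, δM (r • m) = δ r • m + r • δM m) {p : ℕ} {x : ExteriorAlgebra R M}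
    (hx : x ∈ parity R M p) : extDer δ δM h x ∈ parity R M p := by
  rw [mem_parity, sigma_extDer, mem_parity.1 hx, map_smul]

end Super

/-! ### Induction principles for arc algebras, arc modules and their exterior algebras. -/

section OddArcBasics

variable {A : Type} [CommRing A] [Algebra ℂ A] {M : Type} [AddCommGroup M] [Module A M]

theorem OddArc.d_mul (x y : OddArc A M) :
    OddArc.d A M (x * y) = OddArc.d A M x * y + x * OddArc.d A M y := extDer_mul _ _ _ x y

theorem OddArc.d_algebraMap (r : Arc A) :
    OddArc.d A M (algebraMap (Arc A) _ r) = algebraMap (Arc A) _ (Arc.d A r) :=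
  extDer_algebraMap _ _ _ r

theorem OddArc.d_ι (m : ArcMod A M) :
    OddArc.d A M (ExteriorAlgebra.ι _ m) = ExteriorAlgebra.ι _ (ArcMod.d A M m) :=
  extDer_ι _ _ _ m

theorem OddArc.d_mem_deg {p : ℕ} {x : OddArc A M} (hx : x ∈ OddArc.deg A M p) :
    OddArc.d A M x ∈ OddArc.deg A M p := extDer_mem_deg _ _ _ hx

theorem OddArc.d_mem_parity {p : ℕ} {x : OddArc A M} (hx : x ∈ parity (Arc A) (ArcMod A M) p) :
    OddArc.d A M x ∈ parity (Arc A) (ArcMod A M) p := extDer_mem_parity _ _ _ hx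

variable (A M) in
/-- The even generators. -/
def OddArc.fn (a : A) : OddArc A M := algebraMap (Arc A) _ (Arc.of A a)

variable (A M) in
/-- The odd generators. -/
def OddArc.odd (m : M) : OddArc A M := ExteriorAlgebra.ι (Arc A) (ArcMod.jet A M m 0)

theorem Arc.d_jet (a : A) (n : ℕ) : Arc.d A (Arc.jet A a n) = Arc.jet A a (n + 1) := by
  rw [Arc.jet, Arc.d_mk, freeD, MvPolynomial.mkDerivation_X]
  rfl

/-- The arc algebra is generated by `A` as a differential algebra. -/
theorem Arc.induction {P : Arc A → Prop} (hadd : ∀ x y, P x → P y → P (x + y))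
    (hmul : ∀ x y, P x → P y → P (x * y)) (hd : ∀ x, P x → P (Arc.d A x))
    (hof : ∀ a, P (Arc.of A a)) (x : Arc A) : P x := by
  obtain ⟨p, rfl⟩ := Arc.mk_surjective A x
  have hjet : ∀ a n, P (Arc.jet A a n) := fun a n => by
    induction n with
    | zero => exact hof a
    | succ n ih => rw [← Arc.d_jet]; exact hd _ ih
  induction p using MvPolynomial.induction_on with
  | C c =>
    rw [← MvPolynomial.algebraMap_eq, AlgHom.commutes, ← (Arc.of A).commutes]
    exact hof _
  | add p q hp hq => rw [map_add]; exact hadd _ _ hp hq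
  | mul_X p x hp => rw [map_mul]; exact hmul _ _ hp (hjet x.1 x.2)

/-- The arc module is generated by `M` as a differential module. -/
theorem ArcMod.induction {P : ArcMod A M → Prop} (hadd : ∀ x y, P x → P y → P (x + y))
    (hsmul : ∀ (r : Arc A) x, P x → P (r • x)) (hd : ∀ x, P x → P (ArcMod.d A M x))
    (hjet : ∀ m, P (ArcMod.jet A M m 0)) (x : ArcMod A M) : P x := by
  obtain ⟨p, rfl⟩ := ArcMod.mk_surjective A M x
  have hjet' : ∀ m n, P (ArcMod.jet A M m n) := fun m n => by
    induction n with
    | zero => exact hjet m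
    | succ n ih => rw [← ArcMod.d_jet]; exact hd _ ih
  induction p using Finsupp.induction_linear with
  | zero =>
    have := hsmul 0 _ (hjet 0)
    rwa [zero_smul, ← map_zero (ArcMod.mk A M)] at this
  | add p q hp hq => rw [map_add]; exact hadd _ _ hp hq
  | single x r =>
    have h : Finsupp.single x r = r • (Finsupp.single x 1 : (M × ℕ) →₀ Arc A) := by simp
    rw [h, map_smul]
    exact hsmul _ _ (hjet' x.1 x.2)

/-- Homogeneous elements are generated by `A` and `M`. -/
theorem OddArc.deg_induction {P : ℕ → OddArc A M → Prop}
    (hadd : ∀ p x y, P p x → P p y → P p (x + y))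
    (hmul : ∀ p q x y, x ∈ OddArc.deg A M p → y ∈ OddArc.deg A M q → P p x → P q y →
      P (p + q) (x * y))
    (hd : ∀ p x, x ∈ OddArc.deg A M p → P p x → P p (OddArc.d A M x))
    (hfn : ∀ a, P 0 (OddArc.fn A M a)) (hodd : ∀ m, P 1 (OddArc.odd A M m))
    {p : ℕ} {x : OddArc A M} (hx : x ∈ OddArc.deg A M p) : P p x := by
  have h0 : ∀ r : Arc A, P 0 (algebraMap _ (OddArc A M) r) := by
    refine Arc.induction (fun x y hx hy => ?_) (fun x y hx hy => ?_) (fun x hx => ?_) hfn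
    · rw [map_add]
      exact hadd _ _ _ hx hy
    · rw [map_mul]
      exact hmul 0 0 _ _ (algebraMap_mem_deg _) (algebraMap_mem_deg _) hx hy
    · rw [← OddArc.d_algebraMap]
      exact hd _ _ (algebraMap_mem_deg _) hx
  have h1 : ∀ m : ArcMod A M, P 1 (ExteriorAlgebra.ι (Arc A) m) := by
    refine ArcMod.induction (fun x y hx hy => ?_) (fun r x hx => ?_) (fun x hx => ?_) hodd
    · rw [map_add]
      exact hadd _ _ _ hx hy
    · rw [map_smul, Algebra.smul_def]
      have := hmul 0 1 _ _ (algebraMap_mem_deg r) (ι_mem_deg x) (h0 r) hx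
      rwa [zero_add] at this
    · rw [← OddArc.d_ι]
      exact hd _ _ (ι_mem_deg x) hx
  refine homogeneous_induction (P := P) hadd h0 (fun p m x hx hp => ?_) hx
  rw [add_comm]
  exact hmul _ _ _ _ (ι_mem_deg m) hx (h1 m) hp

theorem OddArc.fn_mem (a : A) : OddArc.fn A M a ∈ OddArc.deg A M 0 := algebraMap_mem_deg _

theorem OddArc.odd_mem (m : M) : OddArc.odd A M m ∈ OddArc.deg A M 1 := ι_mem_deg _

/-- The algebra is generated by `A` and `M`. -/
theorem OddArc.gen_induction {P : OddArc A M → Prop} (hadd : ∀ x y, P x → P y → P (x + y))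
    (hmul : ∀ x y, P x → P y → P (x * y)) (hd : ∀ x, P x → P (OddArc.d A M x))
    (hfn : ∀ a, P (OddArc.fn A M a)) (hodd : ∀ m, P (OddArc.odd A M m)) (x : OddArc A M) : P x :=
  sum_homogeneous_induction hadd (fun _ _ hx =>
    OddArc.deg_induction (P := fun _ x => P x) (fun _ => hadd) (fun _ _ _ _ _ _ => hmul _ _)
      (fun _ _ _ => hd _) hfn hodd hx) x

end OddArcBasics

/-! ### The operator `λ+∂` on products, and extension of derivations to the arc algebra. -/

section ShiftMul

variable {V : Type} [Ring V] [Algebra ℂ V] {D : V →ₗ[ℂ] V}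

theorem coeffMap_C_mul (hD : ∀ x y, D (x * y) = D x * y + x * D y) (v : V) (q : V[X]) :
    coeffMap D (C v * q) = C (D v) * q + C v * coeffMap D q := by
  ext n
  simp only [coeffMap_coeff, coeff_C_mul, coeff_add, hD]

theorem coeffMap_mul_C (hD : ∀ x y, D (x * y) = D x * y + x * D y) (v : V) (q : V[X]) :
    coeffMap D (q * C v) = coeffMap D q * C v + q * C (D v) := by
  ext n
  simp only [coeffMap_coeff, coeff_mul_C, coeff_add, hD]

theorem shiftOp_C_mul (hD : ∀ x y, D (x * y) = D x * y + x * D y) (v : V) (q : V[X]) :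
    shiftOp D (C v * q) = C (D v) * q + C v * shiftOp D q := by
  rw [shiftOp_apply, shiftOp_apply, coeffMap_C_mul hD, mul_add, ← mul_assoc, X_mul_C, mul_assoc]
  abel

theorem shiftOp_mul_C (hD : ∀ x y, D (x * y) = D x * y + x * D y) (v : V) (q : V[X]) :
    shiftOp D (q * C v) = shiftOp D q * C v + q * C (D v) := by
  rw [shiftOp_apply, shiftOp_apply, coeffMap_mul_C hD, add_mul, ← mul_assoc]
  abel

end ShiftMul

section ArcDerivation

variable {A : Type} [CommRing A] [Algebra ℂ A] {W : Type} [AddCommGroup W] [Module (Arc A) W]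
  [Module ℂ W] [IsScalarTower ℂ (Arc A) W]

/-- A derivation of `A` with values in a differential module over the arc algebra extends to the
arc algebra. -/
theorem Arc.exists_derivation (T : W →ₗ[ℂ] W)
    (hT : ∀ (r : Arc A) w, T (r • w) = Arc.d A r • w + r • T w) (δ₀ : A →ₗ[ℂ] W)
    (h₀ : ∀ a b, δ₀ (a * b) = Arc.of A a • δ₀ b + Arc.of A b • δ₀ a) :
    ∃ δ : Derivation ℂ (Arc A) W,
      (∀ a, δ (Arc.of A a) = δ₀ a) ∧ ∀ r, δ (Arc.d A r) = T (δ r) := by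
  let _ : Module (MvPolynomial (A × ℕ) ℂ) W := Module.compHom W (Arc.mk A : _ →+* Arc A)
  have hsmul : ∀ (p : MvPolynomial (A × ℕ) ℂ) (w : W), p • w = Arc.mk A p • w := fun _ _ => rfl
  have : IsScalarTower ℂ (MvPolynomial (A × ℕ) ℂ) W := ⟨fun c p w => by
    rw [hsmul, hsmul, map_smul, smul_assoc]⟩
  -- The value on `a⁽ⁿ⁾ = ∂ⁿa` is forced by compatibility with `∂` and `T`.
  let F : Derivation ℂ (MvPolynomial (A × ℕ) ℂ) W :=
    MvPolynomial.mkDerivation ℂ fun x => (T ^ x.2) (δ₀ x.1)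
  have hFX : ∀ x, F (MvPolynomial.X x) = (T ^ x.2) (δ₀ x.1) :=
    fun x => MvPolynomial.mkDerivation_X _ _ _
  have hFd : ∀ p, F (freeD A p) = T (F p) := fun p => by
    induction p using MvPolynomial.induction_on with
    | C c => rw [← MvPolynomial.algebraMap_eq, Derivation.map_algebraMap, map_zero,
        Derivation.map_algebraMap, map_zero]
    | add p q hp hq => simp only [map_add, hp, hq]
    | mul_X p x hp =>
      have hx : F (freeD A (MvPolynomial.X x)) = T (F (MvPolynomial.X x)) := by
        rw [freeD, MvPolynomial.mkDerivation_X, hFX, hFX, pow_succ', Module.End.mul_apply]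
      simp only [Derivation.leibniz, smul_eq_mul, map_add, hp, hx]
      simp only [hsmul, hT, Arc.d_mk]
      abel
  -- Since elements of the ideal act by zero on `W`, the Leibniz rule makes `F` linear along the
  -- ideal. Only the relations and their derivatives remain to be checked.
  have hF0 : ∀ p ∈ arcIdeal A, F p = 0 := fun p hp => by
    refine Submodule.span_induction ?_ ?_ ?_ ?_ hp
    · rintro _ ⟨n, g, hg, rfl⟩
      have key : ∀ a, F (MvPolynomial.X (a, 0)) = δ₀ a := fun a => hFX (a, 0)
      have hg0 : F g = 0 := by
        cases hg with
        | add a b => simp only [map_add, map_sub, key, sub_self]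
        | smul c a => rw [map_sub, key, map_smul, F.map_smul, key, sub_self]
        | one =>
          have h1 := h₀ 1 1
          rw [mul_one, map_one (Arc.of A), one_smul] at h1
          rw [map_sub, key, Derivation.map_one_eq_zero, sub_zero]
          exact left_eq_add.1 h1
        | mul a b =>
          rw [map_sub, key, Derivation.leibniz, key, key, h₀]
          exact sub_self _
      induction n with
      | zero => exact hg0
      | succ n ih => rw [Function.iterate_succ_apply', hFd, ih, map_zero]
    · exact map_zero F
    · intro x y _ _ hx hy
      rw [map_add, hx, hy, add_zero]
    · intro r x hx' hx
      rw [smul_eq_mul, Derivation.leibniz, hx, smul_zero, hsmul, (Arc.mk_eq_zero A).2 hx',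
        zero_smul, add_zero]
  let L : Arc A →ₗ[ℂ] W :=
    ((arcIdeal A).restrictScalars ℂ).liftQ (F : MvPolynomial (A × ℕ) ℂ →ₗ[ℂ] W) hF0
  have hL : ∀ p, L (Arc.mk A p) = F p := fun _ => rfl
  refine ⟨Derivation.mk' L fun x y => ?_, fun a => hFX (a, 0), fun r => ?_⟩
  · obtain ⟨p, rfl⟩ := Arc.mk_surjective A x
    obtain ⟨q, rfl⟩ := Arc.mk_surjective A y
    rw [← map_mul, hL, hL, hL, Derivation.leibniz]
    rfl
  · obtain ⟨p, rfl⟩ := Arc.mk_surjective A r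
    change L _ = T (L _)
    rw [Arc.d_mk, hL, hL, hFd]

end ArcDerivation

/-! ### Twisted derivations of exterior algebras. -/

section Twisted

variable (R M : Type) [CommRing R] [Algebra ℂ R] [AddCommGroup M] [Module R M] [Module ℂ M]
  [IsScalarTower ℂ R M]

/-- Polynomials over the exterior algebra as a bimodule, with the left action twisted by the `ε`-th
power of the grading automorphism. -/
def TwistedPoly (_ : ℕ) : Type := (ExteriorAlgebra R M)[X]

variable {R M} (ε : ℕ)

instance : AddCommGroup (TwistedPoly R M ε) :=
  inferInstanceAs (AddCommGroup (ExteriorAlgebra R M)[X])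

instance : Module (ExteriorAlgebra R M) (TwistedPoly R M ε) :=
  Module.compHom (ExteriorAlgebra R M)[X]
    ((C : ExteriorAlgebra R M →+* _).comp
      ((sigma ^ ε : ExteriorAlgebra R M →ₐ[R] ExteriorAlgebra R M) : _ →+* ExteriorAlgebra R M))

instance : Module (ExteriorAlgebra R M)ᵐᵒᵖ (TwistedPoly R M ε) :=
  Module.compHom (ExteriorAlgebra R M)[X]
    (RingHom.op (C : ExteriorAlgebra R M →+* (ExteriorAlgebra R M)[X]))

instance : SMulCommClass (ExteriorAlgebra R M) (ExteriorAlgebra R M)ᵐᵒᵖ (TwistedPoly R M ε) :=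
  ⟨fun x y q => (mul_assoc (C ((sigma ^ ε) x)) (q : (ExteriorAlgebra R M)[X])
    (C y.unop)).symm⟩

/-- Extension of a twisted derivation from the generators to the exterior algebra. -/
theorem exists_twistedDerivation (δ : R →+ (ExteriorAlgebra R M)[X])
    (hδ : ∀ r s, δ (r * s) = C (algebraMap R _ r) * δ s + C (algebraMap R _ s) * δ r)
    (hδp : ∀ r, δ r ∈ polyIn (parity R M ε)) (g : M →+ (ExteriorAlgebra R M)[X])
    (hg : ∀ (r : R) m, g (r • m) = δ r * C (ExteriorAlgebra.ι R m) + C (algebraMap R _ r) * g m)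
    (hgp : ∀ m, g m ∈ polyIn (parity R M (ε + 1))) :
    ∃ φ : ExteriorAlgebra R M →+ (ExteriorAlgebra R M)[X],
      (∀ x y, φ (x * y) = φ x * C y + C ((sigma ^ ε) x) * φ y) ∧
      (∀ r, φ (algebraMap R _ r) = δ r) ∧ ∀ m, φ (ExteriorAlgebra.ι R m) = g m := by
  -- In the square-zero extension by the twisted bimodule, ring homomorphisms `x ↦ (x, φ x)` are the
  -- same as derivations twisted by `σ^ε`. The universal property of the exterior algebra produces
  -- one of them.
  let S : Type := TrivSqZeroExt (ExteriorAlgebra R M) (TwistedPoly R M ε)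
  let pr : ExteriorAlgebra R M → (ExteriorAlgebra R M)[X] → S := fun x q => (x, q)
  have pr_mul : ∀ x q y r, pr x q * pr y r = pr (x * y) (C ((sigma ^ ε) x) * r + q * C y) :=
    fun _ _ _ _ => rfl
  have pr_add : ∀ x q y r, pr x q + pr y r = pr (x + y) (q + r) := fun _ _ _ _ => rfl
  let Φ : R →+* S :=
    { toFun := fun r => pr (algebraMap R _ r) (δ r)
      map_one' := by
        have h := hδ 1 1
        rw [mul_one, map_one (algebraMap R _), C_1, one_mul] at h
        rw [left_eq_add.1 h, map_one (algebraMap R _)]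
        rfl
      map_zero' := by
        rw [map_zero, map_zero]
        rfl
      map_add' := fun r s => by rw [map_add, map_add, pr_add]
      map_mul' := fun r s => by
        rw [map_mul, hδ, pr_mul, AlgHom.commutes, poly_mul_C_eq (hδp r), AlgHom.commutes] }
  -- The scalars become central because `δ r` has parity `ε`: moving an element across it costs
  -- `σ^ε`, which is the twist of the left action.
  have hΦ : ∀ r x, Φ r * x = x * Φ r := by
    intro r s
    obtain ⟨x, q, rfl⟩ : ∃ x q, s = pr x q := ⟨s.1, s.2, rfl⟩
    change pr _ _ * pr x q = pr x q * pr _ _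
    rw [pr_mul, pr_mul, AlgHom.commutes, poly_mul_C_eq (hδp r), Algebra.commutes r x, add_comm]
    congr 2
    ext1 n
    rw [coeff_C_mul, coeff_mul_C, Algebra.commutes]
  let G : M →+ S :=
    { toFun := fun m => pr (ExteriorAlgebra.ι R m) (g m)
      map_zero' := by
        rw [map_zero, map_zero]
        rfl
      map_add' := fun r s => by rw [map_add, map_add, pr_add] }
  have hG : ∀ (r : R) m, G (r • m) = Φ r * G m := fun r m => by
    change pr _ _ = pr _ _ * pr _ _
    rw [pr_mul, map_smul, hg, AlgHom.commutes, Algebra.smul_def, add_comm]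
  -- The two cross terms cancel: `g m` has parity `ε+1`, one more than the twist, so that
  -- interchanging it with `ι m` gives the opposite sign.
  have hG2 : ∀ m, G m * G m = 0 := fun m => by
    change pr _ _ * pr _ _ = pr 0 0
    rw [pr_mul, poly_mul_C_eq (hgp m), sigma_pow_succ, sigma_pow_of_mem (ι_mem_parity m),
      sigma_csmul, sigma_ι, smul_neg, C_neg, neg_mul, add_neg_cancel, ExteriorAlgebra.ι_sq_zero]
  let Ψ : ExteriorAlgebra R M →+* S := extLift Φ hΦ G hG hG2
  have hΨ1 : ∀ x, (Ψ x).1 = x := fun x => by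
    induction x using ExteriorAlgebra.induction with
    | algebraMap r => rw [extLift_algebraMap]; rfl
    | ι m => rw [extLift_ι]; rfl
    | mul a b ha hb => rw [map_mul]; exact congrArg₂ (· * ·) ha hb
    | add a b ha hb => rw [map_add]; exact congrArg₂ (· + ·) ha hb
  let sn : S → (ExteriorAlgebra R M)[X] := fun s => s.2
  refine ⟨{ toFun := fun x => sn (Ψ x), map_zero' := ?_, map_add' := fun x y => ?_ },
    fun x y => ?_, fun r => ?_, fun m => ?_⟩
  · rw [map_zero]
    rfl
  · rw [map_add]
    rfl
  · change sn (Ψ (x * y)) = sn (Ψ x) * C y + C ((sigma ^ ε) x) * sn (Ψ y)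
    have h : Ψ x * Ψ y = pr (Ψ x).1 (sn (Ψ x)) * pr (Ψ y).1 (sn (Ψ y)) := rfl
    rw [map_mul, h, pr_mul, hΨ1, hΨ1, add_comm]
  · change sn (Ψ _) = _
    rw [extLift_algebraMap]
    rfl
  · change sn (Ψ _) = _
    rw [extLift_ι]
    rfl

end Twisted

/-! ### `λ`-derivations: uniqueness and existence with given values on generators. -/

section LamDer

variable {A : Type} [CommRing A] [Algebra ℂ A] {M : Type} [AddCommGroup M] [Module A M]

/-- Derivations `φ_λ` of parity `ε` with values in polynomials in `λ` that satisfy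
`φ_λ ∂ = (λ + ∂) φ_λ`. -/
structure LamDer (ε : ℕ) (φ : OddArc A M →ₗ[ℂ] (OddArc A M)[X]) : Prop where
  map_d : ∀ x, φ (OddArc.d A M x) = shiftOp (OddArc.d A M) (φ x)
  map_mul : ∀ x y, φ (x * y) = φ x * C y + C ((sigma ^ ε) x) * φ y

/-- A derivation is determined by its values on the generators. -/
theorem LamDer.ext {ε : ℕ} {φ ψ : OddArc A M →ₗ[ℂ] (OddArc A M)[X]} (hφ : LamDer ε φ)
    (hψ : LamDer ε ψ) (hfn : ∀ a, φ (OddArc.fn A M a) = ψ (OddArc.fn A M a))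
    (hodd : ∀ m, φ (OddArc.odd A M m) = ψ (OddArc.odd A M m)) : φ = ψ := by
  ext1 x
  refine OddArc.gen_induction (P := fun x => φ x = ψ x) (fun x y hx hy => ?_)
    (fun x y hx hy => ?_) (fun x hx => ?_) hfn hodd x
  · rw [map_add, map_add, hx, hy]
  · rw [hφ.map_mul, hψ.map_mul, hx, hy]
  · rw [hφ.map_d, hψ.map_d, hx]

theorem poly_smul_eq (r : Arc A) (q : (OddArc A M)[X]) :
    r • q = C (algebraMap (Arc A) (OddArc A M) r) * q := by
  ext1 n
  rw [coeff_smul, coeff_C_mul, Algebra.smul_def]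

/-- Extension of the data of a derivation on the generators of the arc module. -/
theorem ArcMod.exists_extension (δ : Derivation ℂ (Arc A) (OddArc A M)[X])
    (hδd : ∀ r, δ (Arc.d A r) = shiftOp (OddArc.d A M) (δ r)) (g₀ : M →+ (OddArc A M)[X])
    (hg₀ : ∀ (a : A) m, g₀ (a • m) = δ (Arc.of A a) * C (OddArc.odd A M m) +
      C (OddArc.fn A M a) * g₀ m) :
    ∃ g : ArcMod A M →ₗ[ℂ] (OddArc A M)[X], (∀ m, g (ArcMod.jet A M m 0) = g₀ m) ∧
      (∀ (r : Arc A) x, g (r • x) = δ r * C (ExteriorAlgebra.ι (Arc A) x) + r • g x) ∧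
      ∀ x, g (ArcMod.d A M x) = shiftOp (OddArc.d A M) (g x) := by
  let T := shiftOp (OddArc.d A M)
  -- The Leibniz rule and compatibility with `∂` leave only one choice for the image of `r m⁽ⁿ⁾`,
  -- namely `δ(r) m⁽ⁿ⁾ + r (λ+∂)ⁿ g₀(m)`.
  let F : ((M × ℕ) →₀ Arc A) →ₗ[ℂ] (OddArc A M)[X] := Finsupp.lsum ℂ fun x =>
    { toFun := fun r => δ r * C (ExteriorAlgebra.ι (Arc A) (ArcMod.jet A M x.1 x.2)) +
        r • (T ^ x.2) (g₀ x.1)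
      map_add' := fun r s => by
        rw [map_add, add_mul, add_smul]
        abel
      map_smul' := fun c r => by
        rw [δ.map_smul, smul_mul_assoc, RingHom.id_apply, smul_add, smul_assoc] }
  have hF1 : ∀ m n r, F (Finsupp.single (m, n) r) =
      δ r * C (ExteriorAlgebra.ι (Arc A) (ArcMod.jet A M m n)) + r • (T ^ n) (g₀ m) :=
    fun m n r => by
      rw [Finsupp.lsum_single]
      rfl
  have hFs : ∀ (r : Arc A) p, F (r • p) =
      δ r * C (ExteriorAlgebra.ι (Arc A) (ArcMod.mk A M p)) + r • F p := fun r p => by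
    induction p using Finsupp.induction_linear with
    | zero => simp
    | add p q hp hq =>
      rw [smul_add, map_add, hp, hq, map_add, map_add, C_add, mul_add, map_add F, smul_add]
      abel
    | single x s =>
      obtain ⟨m, n⟩ := x
      have h : Finsupp.single (m, n) s = s • (Finsupp.single (m, n) 1 : (M × ℕ) →₀ Arc A) := by
        simp
      rw [Finsupp.smul_single, hF1, hF1, h, map_smul (ArcMod.mk A M),
        map_smul (ExteriorAlgebra.ι _), smul_eq_mul, δ.leibniz, smul_add,
        mul_smul, add_mul, ← smul_C, mul_smul_comm, smul_mul_assoc, smul_mul_assoc]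
      change _ = s • (δ r * C (ExteriorAlgebra.ι (Arc A) (ArcMod.jet A M m n))) + _
      abel
  have hFd : ∀ p, F (freeModD A M p) = T (F p) := fun p => by
    induction p using Finsupp.induction_linear with
    | zero => simp
    | add p q hp hq => simp only [map_add, hp, hq]
    | single x r =>
      obtain ⟨m, n⟩ := x
      have h : Finsupp.single (m, n) r = r • (Finsupp.single (m, n) 1 : (M × ℕ) →₀ Arc A) := by
        simp
      have h1 : F (Finsupp.single (m, n) 1) = (T ^ n) (g₀ m) := by
        rw [hF1, δ.map_one_eq_zero, zero_mul, zero_add, one_smul]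
      have h2 : F (Finsupp.single (m, n + 1) 1) = T ((T ^ n) (g₀ m)) := by
        rw [hF1, δ.map_one_eq_zero, zero_mul, zero_add, one_smul, pow_succ', Module.End.mul_apply]
      rw [h, freeModD_smul, freeModD_single, map_add, hFs, hFs, hFs, h1, h2, map_add, hδd]
      change _ = shiftOp _ _ + shiftOp _ _
      rw [shiftOp_mul_C OddArc.d_mul, poly_smul_eq, poly_smul_eq, poly_smul_eq,
        shiftOp_C_mul OddArc.d_mul, OddArc.d_algebraMap, OddArc.d_ι, ArcMod.d_mk, freeModD_single]
      abel
  have hF0 : ∀ p ∈ arcSubmodule A M, F p = 0 := fun p hp => by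
    refine Submodule.span_induction ?_ ?_ ?_ ?_ hp
    · rintro _ ⟨n, x, hx, rfl⟩
      have h1 : ∀ m, F (Finsupp.single (m, 0) 1) = g₀ m := fun m => by
        rw [hF1, δ.map_one_eq_zero, zero_mul, zero_add, one_smul, pow_zero]
        rfl
      have hx0 : F x = 0 := by
        cases hx with
        | add m m' => simp only [map_sub, map_add, h1, sub_self]
        | smul a m =>
          rw [map_sub, h1, hFs, h1, hg₀, poly_smul_eq]
          exact sub_self _
      induction n with
      | zero => exact hx0
      | succ n ih => rw [Function.iterate_succ_apply', hFd, ih, map_zero]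
    · exact map_zero F
    · intro x y _ _ hx hy
      rw [map_add, hx, hy, add_zero]
    · intro r x hx' hx
      rw [hFs, hx, smul_zero, (ArcMod.mk_eq_zero A M).2 hx', map_zero, C_0, mul_zero, add_zero]
  let g : ArcMod A M →ₗ[ℂ] (OddArc A M)[X] :=
    ((arcSubmodule A M).restrictScalars ℂ).liftQ F hF0
  have hg : ∀ p, g (ArcMod.mk A M p) = F p := fun _ => rfl
  refine ⟨g, fun m => ?_, fun r x => ?_, fun x => ?_⟩
  · rw [ArcMod.jet, hg, hF1, δ.map_one_eq_zero, zero_mul, zero_add, one_smul, pow_zero]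
    rfl
  · obtain ⟨p, rfl⟩ := ArcMod.mk_surjective A M x
    rw [← map_smul, hg, hFs, hg]
  · obtain ⟨p, rfl⟩ := ArcMod.mk_surjective A M x
    rw [ArcMod.d_mk, hg, hFd, hg]

/-- Derivations can be prescribed on the generators. -/
theorem exists_lamDer (ε : ℕ) (δ₀ : A →ₗ[ℂ] (OddArc A M)[X])
    (hδ : ∀ a b, δ₀ (a * b) = C (OddArc.fn A M a) * δ₀ b + C (OddArc.fn A M b) * δ₀ a)
    (hδp : ∀ a, δ₀ a ∈ polyIn (parity (Arc A) (ArcMod A M) ε)) (g₀ : M →+ (OddArc A M)[X])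
    (hg : ∀ (a : A) m, g₀ (a • m) = δ₀ a * C (OddArc.odd A M m) + C (OddArc.fn A M a) * g₀ m)
    (hgp : ∀ m, g₀ m ∈ polyIn (parity (Arc A) (ArcMod A M) (ε + 1))) :
    ∃ φ : OddArc A M →ₗ[ℂ] (OddArc A M)[X], LamDer ε φ ∧ (∀ a, φ (OddArc.fn A M a) = δ₀ a) ∧
      ∀ m, φ (OddArc.odd A M m) = g₀ m := by
  have hpar : ∀ {p} (r : Arc A) {x}, x ∈ parity (Arc A) (ArcMod A M) p →
      algebraMap _ (OddArc A M) r * x ∈ parity (Arc A) (ArcMod A M) p := fun {p} r x hx => by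
    have := mul_mem_parity (algebraMap_mem_parity r) hx
    rwa [zero_add] at this
  obtain ⟨δ, hδ1, hδ2⟩ := Arc.exists_derivation (shiftOp (OddArc.d A M)) (fun r w => by
    rw [poly_smul_eq, poly_smul_eq, poly_smul_eq, shiftOp_C_mul OddArc.d_mul,
      OddArc.d_algebraMap]) δ₀ (fun a b => by
    rw [poly_smul_eq, poly_smul_eq]
    exact hδ a b)
  have hδp' : ∀ r, δ r ∈ polyIn (parity (Arc A) (ArcMod A M) ε) := by
    refine Arc.induction (fun x y hx hy => ?_) (fun x y hx hy => ?_) (fun x hx => ?_) fun a => ?_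
    · rw [map_add]
      exact add_mem hx hy
    · rw [δ.leibniz, poly_smul_eq, poly_smul_eq]
      exact add_mem (C_mul_mem_polyIn (fun w => hpar x) hy) (C_mul_mem_polyIn (fun w => hpar y) hx)
    · rw [hδ2]
      exact shiftOp_mem_polyIn (fun _ => OddArc.d_mem_parity) hx
    · rw [hδ1]
      exact hδp a
  obtain ⟨g, hg1, hg2, hg3⟩ := ArcMod.exists_extension δ hδ2 g₀ (fun a m => by rw [hδ1, hg])
  have hgp' : ∀ x, g x ∈ polyIn (parity (Arc A) (ArcMod A M) (ε + 1)) := by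
    refine ArcMod.induction (fun x y hx hy => ?_) (fun r x hx => ?_) (fun x hx => ?_) fun a => ?_
    · rw [map_add]
      exact add_mem hx hy
    · rw [hg2, poly_smul_eq]
      exact add_mem (mul_C_mem_polyIn (fun w hw => mul_mem_parity hw (ι_mem_parity x)) (hδp' r))
        (C_mul_mem_polyIn (fun w => hpar r) hx)
    · rw [hg3]
      exact shiftOp_mem_polyIn (fun _ => OddArc.d_mem_parity) hx
    · rw [hg1]
      exact hgp a
  obtain ⟨φ, hφ1, hφ2, hφ3⟩ := exists_twistedDerivation ε (δ : Arc A →+ (OddArc A M)[X])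
    (fun r s => by
      change δ (r * s) = _ * δ s + _ * δ r
      rw [δ.leibniz, poly_smul_eq, poly_smul_eq]) hδp' (g : ArcMod A M →+ (OddArc A M)[X])
    (fun r m => by
      change g (r • m) = δ r * _ + _ * g m
      rw [hg2, poly_smul_eq]) hgp'
  have hφ2' : ∀ r, φ (algebraMap _ _ r) = δ r := hφ2
  have hφ3' : ∀ m, φ (ExteriorAlgebra.ι _ m) = g m := hφ3
  have hφd : ∀ x, φ (OddArc.d A M x) = shiftOp (OddArc.d A M) (φ x) := fun x => by
    induction x using ExteriorAlgebra.induction with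
    | algebraMap r => rw [OddArc.d_algebraMap, hφ2', hφ2', hδ2]
    | ι m => rw [OddArc.d_ι, hφ3', hφ3', hg3]
    | mul a b ha hb =>
      have hs : (sigma ^ ε) (OddArc.d A M a) = OddArc.d A M ((sigma ^ ε) a) :=
        sigma_pow_extDer _ _ _ ε a
      rw [OddArc.d_mul, map_add, hφ1, hφ1, hφ1, map_add, shiftOp_mul_C OddArc.d_mul,
        shiftOp_C_mul OddArc.d_mul, ha, hb, hs]
      abel
    | add a b ha hb => rw [map_add, map_add, map_add, map_add, ha, hb]
  refine ⟨{ toFun := φ, map_add' := map_add φ, map_smul' := fun c x => ?_ }, ⟨hφd, hφ1⟩,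
    fun a => ?_, fun m => ?_⟩
  · rw [extAlg_smul_def, hφ1, hφ2', δ.map_algebraMap, zero_mul, zero_add, AlgHom.commutes,
      RingHom.id_apply]
    ext1 n
    rw [coeff_C_mul, coeff_smul, extAlg_smul_def]
  · exact (hφ2' _).trans (hδ1 a)
  · exact (hφ3' _).trans (hg1 m)

end LamDer

/-! ### The arrow substitution `λ ↦ λ+∂` of the Leibniz rule in the first argument. -/

section Arrow

variable {V : Type} [Ring V] [Algebra ℂ V] (D : V →ₗ[ℂ] V)

/-- `∑ λⁿ qₙ ↦ ∑ ((λ + ∂)ⁿ w) qₙ`. -/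
def arrow (w : V[X]) : V[X] →ₗ[ℂ] V[X] :=
  lsum fun n => (LinearMap.mulLeft ℂ ((shiftOp D ^ n) w)) ∘ₗ
    ((monomial 0 : V →ₗ[V] V[X]).restrictScalars ℂ)

theorem arrow_eq_sum (w q : V[X]) :
    arrow D w q = q.sum fun n v => (shiftOp D ^ n) w * C v := rfl

theorem arrow_C (w : V[X]) (v : V) : arrow D w (C v) = w * C v := by
  rw [arrow_eq_sum, sum_C_index (by simp)]
  simp

theorem arrow_X_mul (w q : V[X]) : arrow D w (X * q) = arrow D (shiftOp D w) q := by
  induction q using Polynomial.induction_on' with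
  | add p q hp hq => simp only [mul_add, map_add, hp, hq]
  | monomial n v =>
    rw [X_mul_monomial, arrow_eq_sum, arrow_eq_sum, sum_monomial_index _ _ (by simp),
      sum_monomial_index _ _ (by simp), pow_succ, Module.End.mul_apply]

theorem arrow_mul_C (w q : V[X]) (v : V) : arrow D w (q * C v) = arrow D w q * C v := by
  induction q using poly_induction generalizing w with
  | hC u => rw [← C_mul, arrow_C, arrow_C, C_mul, mul_assoc]
  | hadd q r hq hr => simp only [add_mul, map_add, hq, hr]
  | hX q hq => rw [mul_assoc, arrow_X_mul, arrow_X_mul, hq]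

variable {D}

theorem shiftOp_arrow (hD : ∀ x y, D (x * y) = D x * y + x * D y) (w q : V[X]) :
    shiftOp D (arrow D w q) = arrow D w (shiftOp D q) := by
  induction q using poly_induction generalizing w with
  | hC v =>
    rw [arrow_C, shiftOp_mul_C hD, shiftOp_apply D (C v), map_add, arrow_X_mul, coeffMap_C,
      arrow_C, arrow_C]
  | hadd q r hq hr => simp only [map_add, hq, hr]
  | hX q hq => rw [arrow_X_mul, hq, shiftOp_X_mul, arrow_X_mul]

/-- In `-λ-∂` the derivation acts on the whole product `z q`, so the powers of `λ+∂` also hit `z`.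
Via skew-symmetry, this lemma and its converse `negShift_arrow` exchange the Leibniz rules in the
two arguments. -/
theorem negShift_C_mul (hD : ∀ x y, D (x * y) = D x * y + x * D y) (z : V) (q : V[X]) :
    negShift D (C z * q) = arrow D (C z) (negShift D q) := by
  induction q using poly_induction with
  | hC v => rw [← C_mul, negShift_C, negShift_C, arrow_C, C_mul]
  | hadd q r hq hr => simp only [mul_add, map_add, hq, hr]
  | hX q hq =>
    rw [← mul_assoc, ← X_mul_C, mul_assoc, negShift_X_mul, negShift_X_mul, hq, shiftOp_arrow hD,
      map_neg]

theorem negShift_arrow (hD : ∀ x y, D (x * y) = D x * y + x * D y) (z : V) (q : V[X]) :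
    negShift D (arrow D (C z) q) = C z * negShift D q := by
  rw [← negShift_negShift D (C z * negShift D q), negShift_C_mul hD, negShift_negShift]

end Arrow

/-! ### Signs depend only on residues modulo 2. -/

section Parity

theorem neg_one_pow_congr {p q : ℕ} (h : p % 2 = q % 2) : (-1 : ℂ) ^ p = (-1) ^ q := by
  rw [neg_one_pow_eq_pow_mod_two, h, ← neg_one_pow_eq_pow_mod_two]

variable {R M : Type} [CommRing R] [Algebra ℂ R] [AddCommGroup M] [Module R M] [Module ℂ M]
  [IsScalarTower ℂ R M]

theorem mem_parity_congr {p q : ℕ} (h : p % 2 = q % 2) {x : ExteriorAlgebra R M}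
    (hx : x ∈ parity R M p) : x ∈ parity R M q := by
  rwa [← parity_congr (neg_one_pow_congr h)]

theorem mem_polyIn_parity_congr {p q : ℕ} (h : p % 2 = q % 2) {f : (ExteriorAlgebra R M)[X]}
    (hf : f ∈ polyIn (parity R M p)) : f ∈ polyIn (parity R M q) := by
  rwa [← parity_congr (neg_one_pow_congr h)]

theorem sigma_pow_congr {p q : ℕ} (h : p % 2 = q % 2) :
    (sigma ^ p : ExteriorAlgebra R M →ₐ[R] ExteriorAlgebra R M) = sigma ^ q := by
  have h2 : (sigma ^ 2 : ExteriorAlgebra R M →ₐ[R] ExteriorAlgebra R M) = 1 := by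
    refine AlgHom.ext fun x => ?_
    rw [pow_two]
    exact sigma_sigma x
  rw [← Nat.div_add_mod p 2, ← Nat.div_add_mod q 2, pow_add, pow_add, pow_mul, pow_mul, h2,
    one_pow, one_pow, h]

end Parity

/-! ### Operations on `λ`-derivations and their parity. -/

section LamDerOps

variable {A : Type} [CommRing A] [Algebra ℂ A] {M : Type} [AddCommGroup M] [Module A M]
  {ε : ℕ} {φ ψ : OddArc A M →ₗ[ℂ] (OddArc A M)[X]}

theorem LamDer.congr (hφ : LamDer ε φ) {ε' : ℕ} (h : ε % 2 = ε' % 2) : LamDer ε' φ :=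
  ⟨hφ.map_d, fun x y => by rw [hφ.map_mul, sigma_pow_congr h]⟩

theorem LamDer.zero : LamDer ε (0 : OddArc A M →ₗ[ℂ] (OddArc A M)[X]) :=
  ⟨fun x => by simp, fun x y => by simp⟩

theorem LamDer.add (hφ : LamDer ε φ) (hψ : LamDer ε ψ) : LamDer ε (φ + ψ) :=
  ⟨fun x => by simp only [LinearMap.add_apply, hφ.map_d, hψ.map_d, map_add], fun x y => by
    simp only [LinearMap.add_apply, hφ.map_mul, hψ.map_mul, add_mul, mul_add]
    abel⟩

theorem LamDer.smul (hφ : LamDer ε φ) (c : ℂ) : LamDer ε (c • φ) :=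
  ⟨fun x => by simp only [LinearMap.smul_apply, hφ.map_d, map_smul], fun x y => by
    simp only [LinearMap.smul_apply, hφ.map_mul, smul_mul_assoc, mul_smul_comm, smul_add]⟩

theorem LamDer.X_mul (hφ : LamDer ε φ) :
    LamDer ε (LinearMap.mulLeft ℂ (X : (OddArc A M)[X]) ∘ₗ φ) :=
  ⟨fun x => by
    simp only [LinearMap.comp_apply, LinearMap.mulLeft_apply, hφ.map_d, shiftOp_X_mul],
  fun x y => by
    simp only [LinearMap.comp_apply, LinearMap.mulLeft_apply, hφ.map_mul, mul_add, ← mul_assoc,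
      X_mul_C]⟩

theorem arrow_C_mul {p : ℕ} {w : (OddArc A M)[X]} (hw : w ∈ polyIn (parity (Arc A) (ArcMod A M) p))
    (y : OddArc A M) (q : (OddArc A M)[X]) :
    arrow (OddArc.d A M) w (C y * q) = C ((sigma ^ p) y) * arrow (OddArc.d A M) w q := by
  induction q using poly_induction generalizing w with
  | hC v => rw [← C_mul, arrow_C, arrow_C, C_mul, ← mul_assoc, poly_mul_C_eq hw, mul_assoc]
  | hadd q r hq hr => simp only [mul_add, map_add, hq hw, hr hw]
  | hX q hq =>
    rw [← mul_assoc, ← X_mul_C, mul_assoc, arrow_X_mul, arrow_X_mul,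
      hq (shiftOp_mem_polyIn (fun _ => OddArc.d_mem_parity) hw)]

/-- This supplies the summands of the Leibniz rule in the first argument: they are again
`λ`-derivations, so the rule can be checked on generators. -/
theorem LamDer.arrow (hφ : LamDer ε φ) {p : ℕ} {z : OddArc A M}
    (hz : z ∈ parity (Arc A) (ArcMod A M) p) :
    LamDer (p + ε) (arrow (OddArc.d A M) (C z) ∘ₗ φ) :=
  ⟨fun x => by simp only [LinearMap.comp_apply, hφ.map_d, shiftOp_arrow OddArc.d_mul],
  fun x y => by
    simp only [LinearMap.comp_apply, hφ.map_mul, map_add, arrow_mul_C,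
      arrow_C_mul (C_mem_polyIn hz)]
    rw [pow_add]
    rfl⟩

/-- The behaviour under the grading automorphism is determined by the values on the generators. -/
theorem LamDer.sigma_coeff (hφ : LamDer ε φ)
    (hfn : ∀ a, φ (OddArc.fn A M a) ∈ polyIn (parity (Arc A) (ArcMod A M) ε))
    (hodd : ∀ m, φ (OddArc.odd A M m) ∈ polyIn (parity (Arc A) (ArcMod A M) (ε + 1)))
    (x : OddArc A M) (n : ℕ) :
    sigma ((φ x).coeff n) = (-1 : ℂ) ^ ε • (φ (sigma x)).coeff n := by
  revert x n
  refine OddArc.gen_induction (fun x y hx hy n => ?_) (fun x y hx hy n => ?_) (fun x hx n => ?_)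
    (fun a n => ?_) (fun m n => ?_)
  · simp only [map_add, coeff_add, hx, hy, smul_add]
  · simp only [_root_.map_mul, hφ.map_mul, coeff_add, coeff_mul_C, coeff_C_mul, map_add, hx, hy,
      smul_add, smul_mul_assoc, mul_smul_comm]
    rw [← sigma_pow_succ, pow_succ]
    rfl
  · have hs : sigma (OddArc.d A M x) = OddArc.d A M (sigma x) := sigma_extDer _ _ _ x
    have hs' : ∀ x, sigma (OddArc.d A M x) = OddArc.d A M (sigma x) := sigma_extDer _ _ _
    rw [hs, hφ.map_d, hφ.map_d, shiftOp_apply, shiftOp_apply, coeff_add, coeff_add, map_add,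
      coeffMap_coeff, coeffMap_coeff, hs', hx, smul_add, map_smul]
    congr 1
    cases n with
    | zero => simp
    | succ n => rw [coeff_X_mul, coeff_X_mul, hx]
  · have h0 : sigma (OddArc.fn A M a) = OddArc.fn A M a := AlgHom.commutes _ _
    rw [h0]
    exact hfn a n
  · have h0 : sigma (OddArc.odd A M m) = -OddArc.odd A M m := sigma_ι _
    rw [h0, map_neg, coeff_neg, ArcPVA.mem_parity.1 (hodd m n), pow_succ]
    simp

theorem LamDer.mem_parity (hφ : LamDer ε φ)
    (hfn : ∀ a, φ (OddArc.fn A M a) ∈ polyIn (parity (Arc A) (ArcMod A M) ε))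
    (hodd : ∀ m, φ (OddArc.odd A M m) ∈ polyIn (parity (Arc A) (ArcMod A M) (ε + 1)))
    {p : ℕ} {x : OddArc A M} (hx : x ∈ parity (Arc A) (ArcMod A M) p) :
    φ x ∈ polyIn (parity (Arc A) (ArcMod A M) (p + ε)) := by
  intro n
  rw [ArcPVA.mem_parity, hφ.sigma_coeff hfn hodd, ArcPVA.mem_parity.1 hx, map_smul, coeff_smul,
    smul_smul, pow_add,
    mul_comm]

end LamDerOps

/-! ### Construction of the Schouten `λ`-bracket. -/

section Generators

variable {A : Type} [CommRing A] [Algebra ℂ A]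

theorem OddArc.fn_add {M : Type} [AddCommGroup M] [Module A M] (a b : A) :
    OddArc.fn A M (a + b) = OddArc.fn A M a + OddArc.fn A M b := by
  simp only [OddArc.fn, map_add]

theorem OddArc.fn_mul {M : Type} [AddCommGroup M] [Module A M] (a b : A) :
    OddArc.fn A M (a * b) = OddArc.fn A M a * OddArc.fn A M b := by
  simp only [OddArc.fn, map_mul]

theorem OddArc.fn_smul {M : Type} [AddCommGroup M] [Module A M] (c : ℂ) (a : A) :
    OddArc.fn A M (c • a) = c • OddArc.fn A M a := by
  rw [OddArc.fn, map_smul, OddArc.fn, Algebra.smul_def c (Arc.of A a), map_mul, extAlg_smul_def]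

theorem OddArc.odd_add {M : Type} [AddCommGroup M] [Module A M] (m m' : M) :
    OddArc.odd A M (m + m') = OddArc.odd A M m + OddArc.odd A M m' := by
  rw [OddArc.odd, ArcMod.jet_add, map_add]
  rfl

theorem OddArc.odd_smul {M : Type} [AddCommGroup M] [Module A M] (a : A) (m : M) :
    OddArc.odd A M (a • m) = OddArc.fn A M a * OddArc.odd A M m := by
  rw [OddArc.odd, ArcMod.jet_smul, map_smul, Algebra.smul_def]
  rfl

theorem OddArc.fn_mem_parity {M : Type} [AddCommGroup M] [Module A M] (a : A) :
    OddArc.fn A M a ∈ parity (Arc A) (ArcMod A M) 0 := algebraMap_mem_parity _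

theorem OddArc.odd_mem_parity {M : Type} [AddCommGroup M] [Module A M] (m : M) :
    OddArc.odd A M m ∈ parity (Arc A) (ArcMod A M) 1 := ι_mem_parity _

theorem OddArc.fn_commutes {M : Type} [AddCommGroup M] [Module A M] (a : A) (x : OddArc A M) :
    OddArc.fn A M a * x = x * OddArc.fn A M a := Algebra.commutes _ _

/-- The bracket has degree -1, so the bracket with an element of degree `p` is a derivation of
parity `p+1`. For a function it is odd, namely contraction with `da`. -/
theorem exists_fnBracket (a : A) : ∃ φ : ShiftedArc A →ₗ[ℂ] (ShiftedArc A)[X], LamDer 1 φ ∧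
    (∀ b, φ (OddArc.fn A _ b) = 0) ∧
    ∀ E : Derivation ℂ A A, φ (OddArc.odd A _ E) = C (OddArc.fn A _ (E a)) := by
  let δ : A →ₗ[ℂ] (ShiftedArc A)[X] := 0
  let g : Derivation ℂ A A →+ (ShiftedArc A)[X] :=
    AddMonoidHom.mk' (fun E => C (OddArc.fn A _ (E a))) fun E F => by
      rw [Derivation.add_apply, OddArc.fn_add, C_add]
  have hδ : ∀ b, δ b = 0 := fun _ => rfl
  have hg : ∀ E, g E = C (OddArc.fn A _ (E a)) := fun _ => rfl
  obtain ⟨φ, h1, h2, h3⟩ := exists_lamDer 1 δ (fun b c => by simp only [hδ, mul_zero, add_zero])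
    (fun b => by rw [hδ]; exact zero_mem _) g
    (fun b E => by
      rw [hg, hg, hδ, Derivation.smul_apply, smul_eq_mul, OddArc.fn_mul, C_mul, zero_mul, zero_add])
    (fun E => by
      rw [hg]
      exact C_mem_polyIn (mem_parity_congr (by norm_num) (OddArc.fn_mem_parity _)))
  exact ⟨φ, h1, fun b => by rw [h2, hδ], fun E => by rw [h3, hg]⟩

/-- Up to sign this is the Lie derivative. The sign on functions is forced by skew-symmetry and the
normalization `{a_λ θ_D} = D(a)`; consistency with the module structure is `[D, bE] = D(b)E +
b[D,E]`. -/
theorem exists_thetaBracket (D : Derivation ℂ A A) :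
    ∃ φ : ShiftedArc A →ₗ[ℂ] (ShiftedArc A)[X], LamDer 0 φ ∧
    (∀ b, φ (OddArc.fn A _ b) = -C (OddArc.fn A _ (D b))) ∧
    ∀ E : Derivation ℂ A A, φ (OddArc.odd A _ E) = -C (OddArc.odd A _ ⁅D, E⁆) := by
  refine exists_lamDer 0
    { toFun := fun b => -C (OddArc.fn A _ (D b))
      map_add' := fun b c => by rw [map_add, OddArc.fn_add, C_add, neg_add]
      map_smul' := fun b c => by
        rw [D.map_smul, OddArc.fn_smul, RingHom.id_apply, smul_neg, smul_C] }
    (fun b c => ?_) (fun b => ?_)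
    { toFun := fun E => -C (OddArc.odd A _ ⁅D, E⁆)
      map_zero' := by
        have h := OddArc.odd_add (A := A) (0 : Derivation ℂ A A) 0
        rw [add_zero] at h
        rw [lie_zero, left_eq_add.1 h, C_0, neg_zero]
      map_add' := fun E F => by rw [lie_add, OddArc.odd_add, C_add, neg_add] }
    (fun b E => ?_) (fun E => ?_)
  · change -C (OddArc.fn A _ (D (b * c))) = _ * -C (OddArc.fn A _ (D c)) +
      _ * -C (OddArc.fn A _ (D b))
    rw [D.leibniz, OddArc.fn_add, smul_eq_mul, smul_eq_mul, OddArc.fn_mul, OddArc.fn_mul, C_add,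
      C_mul, C_mul]
    noncomm_ring
  · exact neg_mem (C_mem_polyIn (OddArc.fn_mem_parity _))
  · change -C (OddArc.odd A _ ⁅D, b • E⁆) = -C (OddArc.fn A _ (D b)) * C (OddArc.odd A _ E) +
      _ * -C (OddArc.odd A _ ⁅D, E⁆)
    have h : ⁅D, b • E⁆ = D b • E + b • ⁅D, E⁆ := by
      ext x
      simp only [Derivation.commutator_apply, Derivation.add_apply, Derivation.smul_apply,
        smul_eq_mul, D.leibniz, mul_sub]
      ring
    rw [h, OddArc.odd_add, OddArc.odd_smul, OddArc.odd_smul, C_add, C_mul, C_mul]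
    noncomm_ring
  · exact neg_mem (C_mem_polyIn (OddArc.odd_mem_parity _))

variable (A) in
/-- The operators `{a_λ ·}` for functions `a` of order zero. -/
def fnBracket : A →ₗ[ℂ] ShiftedArc A →ₗ[ℂ] (ShiftedArc A)[X] where
  toFun a := (exists_fnBracket a).choose
  map_add' a b := by
    obtain ⟨h1, h2, h3⟩ := (exists_fnBracket (a + b)).choose_spec
    obtain ⟨ha1, ha2, ha3⟩ := (exists_fnBracket a).choose_spec
    obtain ⟨hb1, hb2, hb3⟩ := (exists_fnBracket b).choose_spec
    refine h1.ext (ha1.add hb1) (fun c => ?_) fun E => ?_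
    · rw [h2, LinearMap.add_apply, ha2, hb2, add_zero]
    · rw [h3, LinearMap.add_apply, ha3, hb3, map_add, OddArc.fn_add, C_add]
  map_smul' c a := by
    obtain ⟨h1, h2, h3⟩ := (exists_fnBracket (c • a)).choose_spec
    obtain ⟨ha1, ha2, ha3⟩ := (exists_fnBracket a).choose_spec
    refine h1.ext (ha1.smul c) (fun c => ?_) fun E => ?_
    · rw [h2, LinearMap.smul_apply, ha2, smul_zero]
    · rw [h3, LinearMap.smul_apply, ha3, E.map_smul, OddArc.fn_smul, smul_C, RingHom.id_apply]

theorem fnBracket_lamDer (a : A) : LamDer 1 (fnBracket A a) := (exists_fnBracket a).choose_spec.1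

theorem fnBracket_fn (a b : A) : fnBracket A a (OddArc.fn A _ b) = 0 :=
  (exists_fnBracket a).choose_spec.2.1 b

theorem fnBracket_odd (a : A) (E : Derivation ℂ A A) :
    fnBracket A a (OddArc.odd A _ E) = C (OddArc.fn A _ (E a)) :=
  (exists_fnBracket a).choose_spec.2.2 E

variable (A) in
/-- The operators `{θ_D λ ·}` for vector fields `D`. -/
def thetaBracket : Derivation ℂ A A →+ (ShiftedArc A →ₗ[ℂ] (ShiftedArc A)[X]) :=
  AddMonoidHom.mk' (fun D => (exists_thetaBracket D).choose) fun D E => by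
    obtain ⟨h1, h2, h3⟩ := (exists_thetaBracket (D + E)).choose_spec
    obtain ⟨ha1, ha2, ha3⟩ := (exists_thetaBracket D).choose_spec
    obtain ⟨hb1, hb2, hb3⟩ := (exists_thetaBracket E).choose_spec
    refine h1.ext (ha1.add hb1) (fun c => ?_) fun F => ?_
    · rw [h2, LinearMap.add_apply, ha2, hb2, Derivation.add_apply, OddArc.fn_add, C_add, neg_add]
    · rw [h3, LinearMap.add_apply, ha3, hb3, add_lie, OddArc.odd_add, C_add, neg_add]

theorem thetaBracket_lamDer (D : Derivation ℂ A A) : LamDer 0 (thetaBracket A D) :=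
  (exists_thetaBracket D).choose_spec.1

theorem thetaBracket_fn (D : Derivation ℂ A A) (b : A) :
    thetaBracket A D (OddArc.fn A _ b) = -C (OddArc.fn A _ (D b)) :=
  (exists_thetaBracket D).choose_spec.2.1 b

theorem thetaBracket_odd (D E : Derivation ℂ A A) :
    thetaBracket A D (OddArc.odd A _ E) = -C (OddArc.odd A _ ⁅D, E⁆) :=
  (exists_thetaBracket D).choose_spec.2.2 E

theorem fnBracket_mem_parity (a : A) {p : ℕ} {x : ShiftedArc A} (hx : x ∈ parity (Arc A) _ p) :
    fnBracket A a x ∈ polyIn (parity (Arc A) _ (p + 1)) :=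
  (fnBracket_lamDer a).mem_parity (fun b => by rw [fnBracket_fn]; exact zero_mem _)
    (fun E => by
      rw [fnBracket_odd]
      exact C_mem_polyIn (mem_parity_congr (by norm_num) (OddArc.fn_mem_parity _))) hx

theorem thetaBracket_mem_parity (D : Derivation ℂ A A) {p : ℕ} {x : ShiftedArc A}
    (hx : x ∈ parity (Arc A) _ p) : thetaBracket A D x ∈ polyIn (parity (Arc A) _ p) :=
  (thetaBracket_lamDer D).mem_parity
    (fun b => by
      rw [thetaBracket_fn]
      exact neg_mem (C_mem_polyIn (OddArc.fn_mem_parity _)))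
    (fun E => by
      rw [thetaBracket_odd]
      exact neg_mem (C_mem_polyIn (OddArc.odd_mem_parity _))) hx

/-- Both sides are `λ`-derivations in `x`, so comparing them on generators suffices. This is the
Leibniz rule in the first slot, read later as a condition on the second slot of `{y_λ ·}`. -/
theorem fnBracket_mul (a b : A) (x : ShiftedArc A) :
    fnBracket A (a * b) x =
      arrow (ShiftedArc.d A) (C (OddArc.fn A _ a)) (fnBracket A b x) +
        arrow (ShiftedArc.d A) (C (OddArc.fn A _ b)) (fnBracket A a x) := by
  refine LinearMap.congr_fun ((fnBracket_lamDer (a * b)).ext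
    ((((fnBracket_lamDer b).arrow (OddArc.fn_mem_parity a)).add
      ((fnBracket_lamDer a).arrow (OddArc.fn_mem_parity b))).congr rfl) (fun c => ?_)
    fun E => ?_) x
  · simp only [LinearMap.add_apply, LinearMap.comp_apply, fnBracket_fn, map_zero, add_zero]
  · simp only [LinearMap.add_apply, LinearMap.comp_apply, fnBracket_odd, arrow_C, E.leibniz,
      smul_eq_mul, OddArc.fn_add, OddArc.fn_mul, C_add, C_mul]

theorem thetaBracket_smul (a : A) (D : Derivation ℂ A A) (x : ShiftedArc A) :
    thetaBracket A (a • D) x =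
      arrow (ShiftedArc.d A) (C (OddArc.fn A _ a)) (thetaBracket A D x) +
        arrow (ShiftedArc.d A) (C (OddArc.odd A _ D)) (fnBracket A a x) := by
  refine LinearMap.congr_fun ((thetaBracket_lamDer (a • D)).ext
    (((thetaBracket_lamDer D).arrow (OddArc.fn_mem_parity a)).add
      (((fnBracket_lamDer a).arrow (OddArc.odd_mem_parity D)).congr rfl)) (fun c => ?_)
    fun E => ?_) x
  · simp only [LinearMap.add_apply, LinearMap.comp_apply, fnBracket_fn, thetaBracket_fn, map_zero,
      add_zero, map_neg, arrow_C, Derivation.smul_apply, smul_eq_mul, OddArc.fn_mul, C_mul]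
  · have h : ⁅a • D, E⁆ = a • ⁅D, E⁆ - E a • D := by
      ext x
      simp only [Derivation.commutator_apply, Derivation.sub_apply, Derivation.smul_apply,
        smul_eq_mul, E.leibniz, mul_sub]
      ring
    have h' : OddArc.odd A (Derivation ℂ A A) (a • ⁅D, E⁆ - E a • D) =
        OddArc.fn A _ a * OddArc.odd A _ ⁅D, E⁆ - OddArc.odd A _ D * OddArc.fn A _ (E a) := by
      rw [eq_sub_iff_add_eq, ← OddArc.fn_commutes, ← OddArc.odd_smul, ← OddArc.odd_smul,
        ← OddArc.odd_add, sub_add_cancel]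
    simp only [LinearMap.add_apply, LinearMap.comp_apply, fnBracket_odd, thetaBracket_odd, map_neg,
      arrow_C, h, h', C_sub, C_mul]
    abel

/-- The values are those dictated by skew-symmetry: the general sign `-(-1)^((p+1)(q+1))` is
`(-1)^p` for `q = 0` and `-1` for `q = 1`. They satisfy the Leibniz conditions because `negShift`
turns the arrows in `fnBracket_mul` and `thetaBracket_smul` into left multiplications. -/
theorem exists_hamiltonian (p : ℕ) (y : ShiftedArc A) (hy : y ∈ parity (Arc A) _ p) :
    ∃ φ : ShiftedArc A →ₗ[ℂ] (ShiftedArc A)[X], LamDer (p + 1) φ ∧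
    (∀ a, φ (OddArc.fn A _ a) = (-1 : ℂ) ^ p • negShift (ShiftedArc.d A) (fnBracket A a y)) ∧
    ∀ E : Derivation ℂ A A,
      φ (OddArc.odd A _ E) = -negShift (ShiftedArc.d A) (thetaBracket A E y) := by
  refine exists_lamDer (p + 1)
    { toFun := fun a => (-1 : ℂ) ^ p • negShift (ShiftedArc.d A) (fnBracket A a y)
      map_add' := fun a b => by rw [map_add, LinearMap.add_apply, map_add, smul_add]
      map_smul' := fun c a => by
        rw [map_smul, LinearMap.smul_apply, map_smul, RingHom.id_apply, smul_comm] }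
    (fun a b => ?_) (fun a => ?_)
    (AddMonoidHom.mk' (fun E => -negShift (ShiftedArc.d A) (thetaBracket A E y)) fun E F => by
      rw [map_add, LinearMap.add_apply, map_add, neg_add])
    (fun a E => ?_) (fun E => ?_)
  · change (-1 : ℂ) ^ p • negShift (ShiftedArc.d A) (fnBracket A (a * b) y) =
      _ * ((-1 : ℂ) ^ p • negShift (ShiftedArc.d A) (fnBracket A b y)) +
      _ * ((-1 : ℂ) ^ p • negShift (ShiftedArc.d A) (fnBracket A a y))
    rw [fnBracket_mul, map_add, negShift_arrow OddArc.d_mul, negShift_arrow OddArc.d_mul, smul_add,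
      mul_smul_comm, mul_smul_comm]
  · exact Submodule.smul_mem _ _
      (negShift_mem_polyIn (fun _ => OddArc.d_mem_parity) (fnBracket_mem_parity a hy))
  · change -negShift (ShiftedArc.d A) (thetaBracket A (a • E) y) =
      ((-1 : ℂ) ^ p • negShift (ShiftedArc.d A) (fnBracket A a y)) * C (OddArc.odd A _ E) +
      _ * -negShift (ShiftedArc.d A) (thetaBracket A E y)
    rw [thetaBracket_smul, map_add, negShift_arrow OddArc.d_mul, negShift_arrow OddArc.d_mul,
      smul_mul_assoc, poly_mul_C_of_mem (negShift_mem_polyIn (fun _ => OddArc.d_mem_parity)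
        (fnBracket_mem_parity a hy)) (OddArc.odd_mem_parity E), smul_smul, mul_one, pow_succ,
      ← mul_assoc, ← mul_pow]
    simp
  · exact neg_mem (negShift_mem_polyIn (fun _ => OddArc.d_mem_parity)
      (mem_polyIn_parity_congr (by omega) (thetaBracket_mem_parity E hy)))

/-- The operator `{y_λ ·}` for `y` of parity `p`. -/
def hamiltonianOf (p : ℕ) (y : ShiftedArc A) (hy : y ∈ parity (Arc A) _ p) :
    ShiftedArc A →ₗ[ℂ] (ShiftedArc A)[X] := (exists_hamiltonian p y hy).choose

theorem hamiltonianOf_lamDer {p : ℕ} {y : ShiftedArc A} (hy : y ∈ parity (Arc A) _ p) :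
    LamDer (p + 1) (hamiltonianOf p y hy) := (exists_hamiltonian p y hy).choose_spec.1

theorem hamiltonianOf_fn {p : ℕ} {y : ShiftedArc A} (hy : y ∈ parity (Arc A) _ p) (a : A) :
    hamiltonianOf p y hy (OddArc.fn A _ a) =
      (-1 : ℂ) ^ p • negShift (ShiftedArc.d A) (fnBracket A a y) :=
  (exists_hamiltonian p y hy).choose_spec.2.1 a

theorem hamiltonianOf_odd {p : ℕ} {y : ShiftedArc A} (hy : y ∈ parity (Arc A) _ p)
    (E : Derivation ℂ A A) : hamiltonianOf p y hy (OddArc.odd A _ E) =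
      -negShift (ShiftedArc.d A) (thetaBracket A E y) :=
  (exists_hamiltonian p y hy).choose_spec.2.2 E

theorem hamiltonianOf_add {p : ℕ} {x y z : ShiftedArc A} (hx : x ∈ parity (Arc A) _ p)
    (hy : y ∈ parity (Arc A) _ p) (hz : z ∈ parity (Arc A) _ p) (h : z = x + y) :
    hamiltonianOf p z hz = hamiltonianOf p x hx + hamiltonianOf p y hy := by
  refine (hamiltonianOf_lamDer hz).ext ((hamiltonianOf_lamDer hx).add (hamiltonianOf_lamDer hy))
    (fun a => ?_) fun E => ?_
  · rw [LinearMap.add_apply, hamiltonianOf_fn, hamiltonianOf_fn, hamiltonianOf_fn, h, map_add,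
      map_add, smul_add]
  · rw [LinearMap.add_apply, hamiltonianOf_odd, hamiltonianOf_odd, hamiltonianOf_odd, h, map_add,
      map_add, neg_add]

theorem hamiltonianOf_smul {p : ℕ} {c : ℂ} {y z : ShiftedArc A}
    (hy : y ∈ parity (Arc A) _ p) (hz : z ∈ parity (Arc A) _ p) (h : z = c • y) :
    hamiltonianOf p z hz = c • hamiltonianOf p y hy := by
  refine (hamiltonianOf_lamDer hz).ext ((hamiltonianOf_lamDer hy).smul c)
    (fun a => ?_) fun E => ?_
  · rw [LinearMap.smul_apply, hamiltonianOf_fn, hamiltonianOf_fn, h, map_smul, map_smul, smul_comm]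
  · rw [LinearMap.smul_apply, hamiltonianOf_odd, hamiltonianOf_odd, h, map_smul, map_smul, smul_neg]

variable (A) in
/-- The operators `{y_λ ·}` for the part of `y` of parity `p`. -/
def hamiltonian (p : ℕ) : ShiftedArc A →ₗ[ℂ] ShiftedArc A →ₗ[ℂ] (ShiftedArc A)[X] where
  -- The signs involve the parity of `y` only, so a bilinear map is obtained by splitting `y` into
  -- its even and odd parts.
  toFun y := hamiltonianOf p (parityPart p y) (parityPart_mem p y)
  map_add' x y := hamiltonianOf_add _ _ _ (map_add _ x y)
  map_smul' c y := hamiltonianOf_smul _ _ (map_smul _ c y)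

theorem hamiltonian_apply {p : ℕ} {y z : ShiftedArc A} (h : parityPart p y = z)
    (hz : z ∈ parity (Arc A) _ p) : hamiltonian A p y = hamiltonianOf p z hz := by
  subst h
  rfl

theorem hamiltonian_of_mem_succ {p : ℕ} {y : ShiftedArc A} (hy : y ∈ parity (Arc A) _ (p + 1)) :
    hamiltonian A p y = 0 := by
  rw [hamiltonian_apply (parityPart_of_mem_succ hy) (zero_mem _),
    hamiltonianOf_smul (c := 0) (zero_mem _) (zero_mem _) (smul_zero 0).symm, zero_smul]

variable (A) in
/-- The `λ`-bracket of functions on the arc space of the shifted cotangent bundle. -/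
def schoutenBracket : LambdaBracket (ShiftedArc A) := hamiltonian A 0 + hamiltonian A 1

theorem schoutenBracket_of_mem {p : ℕ} {y : ShiftedArc A} (hy : y ∈ parity (Arc A) _ p) :
    LamDer (p + 1) (schoutenBracket A y) ∧
    (∀ a, schoutenBracket A y (OddArc.fn A _ a) =
      (-1 : ℂ) ^ p • negShift (ShiftedArc.d A) (fnBracket A a y)) ∧
    ∀ E : Derivation ℂ A A,
      schoutenBracket A y (OddArc.odd A _ E) =
        -negShift (ShiftedArc.d A) (thetaBracket A E y) := by
  have key : ∀ q (hq : p % 2 = q % 2), schoutenBracket A y = hamiltonian A q y →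
      LamDer (p + 1) (schoutenBracket A y) ∧
      (∀ a, schoutenBracket A y (OddArc.fn A _ a) =
        (-1 : ℂ) ^ p • negShift (ShiftedArc.d A) (fnBracket A a y)) ∧
      ∀ E : Derivation ℂ A A, schoutenBracket A y (OddArc.odd A _ E) =
        -negShift (ShiftedArc.d A) (thetaBracket A E y) := fun q hq h => by
    have hy' := mem_parity_congr hq hy
    rw [h, hamiltonian_apply (parityPart_of_mem hy') hy', neg_one_pow_congr hq]
    exact ⟨(hamiltonianOf_lamDer hy').congr (by omega), hamiltonianOf_fn hy',
      hamiltonianOf_odd hy'⟩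
  obtain hp | hp := Nat.mod_two_eq_zero_or_one p
  · refine key 0 hp ?_
    rw [schoutenBracket, LinearMap.add_apply,
      hamiltonian_of_mem_succ (p := 1) (mem_parity_congr (by omega) hy), add_zero]
  · refine key 1 hp ?_
    rw [schoutenBracket, LinearMap.add_apply,
      hamiltonian_of_mem_succ (p := 0) (mem_parity_congr (by omega) hy), zero_add]

end Generators

/-! ### Signs, translations and the substitution `-λ-∂` at numbers. -/

section Signs

theorem sign_eq {m n : ℕ} (k : ℕ) (h : m + n = 2 * k) : (-1 : ℂ) ^ m = (-1) ^ n :=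
  neg_one_pow_congr (by omega)

theorem sign_mul_self (n : ℕ) : (-1 : ℂ) ^ n * (-1) ^ n = 1 := by
  rw [← mul_pow]
  simp

end Signs

section Translate

variable {V : Type} [Ring V] [Algebra ℂ V]

/-- `q(λ) ↦ q(λ + z)`. -/
def translate (z : ℂ) : V[X] →ₗ[ℂ] V[X] :=
  lsum fun n => ((LinearMap.mulLeft ℂ (X : V[X]) + z • LinearMap.id) ^ n) ∘ₗ
    ((monomial 0 : V →ₗ[V] V[X]).restrictScalars ℂ)

theorem translate_C (z : ℂ) (v : V) : translate z (C v) = C v := by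
  rw [translate, lsum_apply, sum_C_index (by simp)]
  simp

theorem translate_X_mul (z : ℂ) (q : V[X]) :
    translate z (X * q) = X * translate z q + z • translate z q := by
  induction q using Polynomial.induction_on' with
  | add p q hp hq => simp only [mul_add, map_add, hp, hq, smul_add]; abel
  | monomial n v =>
    rw [X_mul_monomial, translate, lsum_apply, lsum_apply, sum_monomial_index _ _ (by simp),
      sum_monomial_index _ _ (by simp), LinearMap.comp_apply, LinearMap.comp_apply, pow_succ']
    rfl

theorem evalAt_translate (z w : ℂ) (q : V[X]) : evalAt w (translate z q) = evalAt (z + w) q := by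
  induction q using poly_induction with
  | hC v => rw [translate_C, evalAt_C, evalAt_C]
  | hadd q r hq hr => simp only [map_add, hq, hr]
  | hX q hq =>
    rw [translate_X_mul, map_add, evalAt_X_mul, map_smul, evalAt_X_mul, hq, add_smul, add_comm]

theorem evalAt_negShift_X_mul (D : V →ₗ[ℂ] V) (w : ℂ) (q : V[X]) :
    evalAt w (negShift D (X * q)) =
      -(w • evalAt w (negShift D q) + D (evalAt w (negShift D q))) := by
  rw [negShift_X_mul, map_neg, evalAt_shiftOp]

/-- The shift by `z` cancels: `-(z+w)-∂+z = -w-∂`. -/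
theorem evalAt_negShift_translate (D : V →ₗ[ℂ] V) (z w : ℂ) (q : V[X]) :
    evalAt (z + w) (negShift D (translate z q)) = evalAt w (negShift D q) := by
  induction q using poly_induction with
  | hC v => rw [translate_C, negShift_C, evalAt_C, evalAt_C]
  | hadd q r hq hr => simp only [map_add, hq, hr]
  | hX q hq =>
    rw [translate_X_mul, map_add, map_smul, map_add, map_smul, evalAt_negShift_X_mul, hq,
      evalAt_negShift_X_mul, add_smul]
    abel

/-- Moving `f` across `-w-∂` replaces it by `-(z+w)-∂`. The intended case is `f = {a_z ·}`. -/
theorem map_evalAt_negShift {D f : V →ₗ[ℂ] V} {z : ℂ} (hf : ∀ x, f (D x) = z • f x + D (f x))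
    (w : ℂ) (q : V[X]) :
    f (evalAt w (negShift D q)) = evalAt (z + w) (negShift D (coeffMap f q)) := by
  induction q using poly_induction with
  | hC v => rw [coeffMap_C, negShift_C, negShift_C, evalAt_C, evalAt_C]
  | hadd q r hq hr => simp only [map_add, hq, hr]
  | hX q hq =>
    rw [coeffMap_X_mul, evalAt_negShift_X_mul, evalAt_negShift_X_mul, ← hq, map_neg, map_add, hf,
      map_smul, add_smul]
    abel

/-- In the first argument of a bracket at `z+w`, the derivation acts as `-(z+w)`, hence `-z-∂` acts
as `w`. -/
theorem bracket_evalAt_negShift {D : V →ₗ[ℂ] V} {B : LambdaBracket V}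
    (hB : ∀ a b, B (D a) b = -(X * B a b)) (z w : ℂ) (q : V[X]) (c : V) :
    evalAt (z + w) (B (evalAt z (negShift D q)) c) = evalAt (z + w) (B (evalAt w q) c) := by
  induction q using poly_induction with
  | hC v => rw [negShift_C, evalAt_C, evalAt_C]
  | hadd q r hq hr => simp only [map_add, LinearMap.add_apply, hq, hr]
  | hX q hq =>
    rw [evalAt_negShift_X_mul, evalAt_X_mul, map_neg, map_add, map_smul, map_smul,
      LinearMap.neg_apply, LinearMap.add_apply, hB, LinearMap.smul_apply, LinearMap.smul_apply,
      map_neg, map_add, map_neg, evalAt_X_mul, map_smul, map_smul, hq, add_smul]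
    abel

end Translate

/-! ### Sesquilinearity, left Leibniz rule, skew-symmetry and degree of the bracket. -/

section Schouten

variable {A : Type} [CommRing A] [Algebra ℂ A]

theorem schoutenBracket_lamDer {p : ℕ} {y : ShiftedArc A} (hy : y ∈ parity (Arc A) _ p) :
    LamDer (p + 1) (schoutenBracket A y) := (schoutenBracket_of_mem hy).1

theorem schoutenBracket_apply_fn {p : ℕ} {y : ShiftedArc A} (hy : y ∈ parity (Arc A) _ p) (a : A) :
    schoutenBracket A y (OddArc.fn A _ a) =
      (-1 : ℂ) ^ p • negShift (ShiftedArc.d A) (fnBracket A a y) :=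
  (schoutenBracket_of_mem hy).2.1 a

theorem schoutenBracket_apply_odd {p : ℕ} {y : ShiftedArc A} (hy : y ∈ parity (Arc A) _ p)
    (E : Derivation ℂ A A) : schoutenBracket A y (OddArc.odd A _ E) =
      -negShift (ShiftedArc.d A) (thetaBracket A E y) :=
  (schoutenBracket_of_mem hy).2.2 E

/-- The general construction applied to a generator has to return the operator it started from. On
generators this is the skew-symmetry of the prescribed values. -/
theorem schoutenBracket_fn (a : A) : schoutenBracket A (OddArc.fn A _ a) = fnBracket A a := by
  refine (schoutenBracket_lamDer (OddArc.fn_mem_parity a)).ext (fnBracket_lamDer a) (fun b => ?_)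
    fun E => ?_
  · rw [schoutenBracket_apply_fn (OddArc.fn_mem_parity a), fnBracket_fn, fnBracket_fn, map_zero,
      smul_zero]
  · rw [schoutenBracket_apply_odd (OddArc.fn_mem_parity a), thetaBracket_fn, fnBracket_odd,
      map_neg, negShift_C, neg_neg]

theorem schoutenBracket_odd (D : Derivation ℂ A A) :
    schoutenBracket A (OddArc.odd A _ D) = thetaBracket A D := by
  refine ((schoutenBracket_lamDer (OddArc.odd_mem_parity D)).congr (ε' := 0) (by norm_num)).ext
    (thetaBracket_lamDer D) (fun b => ?_) fun E => ?_
  · rw [schoutenBracket_apply_fn (OddArc.odd_mem_parity D), fnBracket_odd, thetaBracket_fn,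
      negShift_C, pow_one, neg_one_smul]
  · have h : OddArc.odd A _ ⁅E, D⁆ + OddArc.odd A _ ⁅D, E⁆ = 0 := by
      rw [← OddArc.odd_add, ← lie_skew E D, neg_add_cancel]
      have h := OddArc.odd_add (A := A) (0 : Derivation ℂ A A) 0
      rw [add_zero] at h
      exact left_eq_add.1 h
    rw [schoutenBracket_apply_odd (OddArc.odd_mem_parity D), thetaBracket_odd, thetaBracket_odd,
      map_neg, negShift_C, neg_neg, eq_neg_iff_add_eq_zero, ← C_add, h, C_0]

theorem schoutenBracket_apply_fn_mem {p : ℕ} {y : ShiftedArc A} (hy : y ∈ parity (Arc A) _ p)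
    (a : A) : schoutenBracket A y (OddArc.fn A _ a) ∈ polyIn (parity (Arc A) _ (p + 1)) := by
  rw [schoutenBracket_apply_fn hy]
  exact Submodule.smul_mem _ _
    (negShift_mem_polyIn (fun _ => OddArc.d_mem_parity) (fnBracket_mem_parity a hy))

theorem schoutenBracket_apply_odd_mem {p : ℕ} {y : ShiftedArc A} (hy : y ∈ parity (Arc A) _ p)
    (E : Derivation ℂ A A) :
    schoutenBracket A y (OddArc.odd A _ E) ∈ polyIn (parity (Arc A) _ (p + 1 + 1)) := by
  rw [schoutenBracket_apply_odd hy]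
  exact neg_mem (negShift_mem_polyIn (fun _ => OddArc.d_mem_parity)
    (mem_polyIn_parity_congr (by omega) (thetaBracket_mem_parity E hy)))

theorem schoutenBracket_mem_parity {p q : ℕ} {y z : ShiftedArc A} (hy : y ∈ parity (Arc A) _ p)
    (hz : z ∈ parity (Arc A) _ q) :
    schoutenBracket A y z ∈ polyIn (parity (Arc A) _ (q + (p + 1))) :=
  (schoutenBracket_lamDer hy).mem_parity (schoutenBracket_apply_fn_mem hy)
    (schoutenBracket_apply_odd_mem hy) hz

theorem evalAt_mem {V : Type} [Ring V] [Algebra ℂ V] {S : Submodule ℂ V} {q : V[X]}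
    (hq : q ∈ polyIn S) (z : ℂ) : evalAt z q ∈ S := by
  rw [evalAt_eq_sum, Polynomial.sum]
  exact Submodule.sum_mem _ fun n _ => S.smul_mem _ (hq n)

theorem sigma_pow_evalAt_schoutenBracket {p : ℕ} {y : ShiftedArc A}
    (hy : y ∈ parity (Arc A) _ p) (n : ℕ) (z : ℂ) (x : ShiftedArc A) :
    (sigma ^ n) (evalAt z (schoutenBracket A y x)) =
      (-1 : ℂ) ^ (n * (p + 1)) • evalAt z (schoutenBracket A y ((sigma ^ n) x)) := by
  refine sum_homogeneous_induction (P := fun x =>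
    (sigma ^ n) (evalAt z (schoutenBracket A y x)) =
      (-1 : ℂ) ^ (n * (p + 1)) • evalAt z (schoutenBracket A y ((sigma ^ n) x)))
    (fun x x' hx hx' => by simp only [map_add, hx, hx', smul_add]) (fun q x hx => ?_) x
  have hx' := deg_le_parity hx
  rw [sigma_pow_of_mem (evalAt_mem (schoutenBracket_mem_parity hy hx') z), sigma_pow_of_mem hx',
    map_smul, map_smul, smul_smul, ← pow_add, 
    sign_eq (m := n * (q + (p + 1))) (n := n * (p + 1) + n * q) (n * (q + (p + 1))) (by ring)]

/-- Both sides are `λ`-derivations in `z`. On generators the claim is that `λ ↦ -λ-∂` sends `λ+∂` to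
`-λ`. -/
theorem schoutenBracket_d (y z : ShiftedArc A) :
    schoutenBracket A (ShiftedArc.d A y) z = -(X * schoutenBracket A y z) := by
  refine sum_homogeneous_induction (P := fun y => schoutenBracket A (ShiftedArc.d A y) z =
    -(X * schoutenBracket A y z)) (fun x y hx hy => ?_) (fun p y hy => ?_) y
  · rw [map_add, map_add, LinearMap.add_apply, hx, hy, map_add, LinearMap.add_apply, mul_add,
      neg_add]
  · have hy0 := deg_le_parity hy
    have hy1 : ShiftedArc.d A y ∈ parity (Arc A) _ p := OddArc.d_mem_parity hy0
    have h := (schoutenBracket_lamDer hy1).ext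
      ((schoutenBracket_lamDer hy0).X_mul.smul (-1)) (fun a => ?_) fun E => ?_
    · rw [h, LinearMap.smul_apply, neg_one_smul]
      rfl
    · rw [LinearMap.smul_apply, neg_one_smul, LinearMap.comp_apply, LinearMap.mulLeft_apply,
        schoutenBracket_apply_fn hy1, schoutenBracket_apply_fn hy0, (fnBracket_lamDer a).map_d,
        negShift_shiftOp, mul_smul_comm, smul_neg]
    · rw [LinearMap.smul_apply, neg_one_smul, LinearMap.comp_apply, LinearMap.mulLeft_apply,
        schoutenBracket_apply_odd hy1, schoutenBracket_apply_odd hy0, (thetaBracket_lamDer E).map_d,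
        negShift_shiftOp, mul_neg]

/-- The Leibniz rule after `λ ↦ -λ-∂`, with the constant factors moved to the left at the cost of
signs. It drives both the left Leibniz rule and skew-symmetry. -/
theorem negShift_mul_rule {p₁ p₂ ε : ℕ} {z₁ z₂ : ShiftedArc A} (h₁ : z₁ ∈ parity (Arc A) _ p₁)
    (h₂ : z₂ ∈ parity (Arc A) _ p₂) {φ : ShiftedArc A →ₗ[ℂ] (ShiftedArc A)[X]} (hφ : LamDer ε φ)
    (hz : φ z₁ ∈ polyIn (parity (Arc A) _ (p₁ + ε))) :
    negShift (ShiftedArc.d A) (φ (z₁ * z₂)) =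
      (-1 : ℂ) ^ ((p₁ + ε) * p₂) •
        arrow (ShiftedArc.d A) (C z₂) (negShift (ShiftedArc.d A) (φ z₁)) +
      (-1 : ℂ) ^ (ε * p₁) •
        arrow (ShiftedArc.d A) (C z₁) (negShift (ShiftedArc.d A) (φ z₂)) := by
  rw [hφ.map_mul, poly_mul_C_of_mem hz h₂, sigma_pow_of_mem h₁, ← smul_C, smul_mul_assoc, map_add,
    map_smul, map_smul, negShift_C_mul OddArc.d_mul, negShift_C_mul OddArc.d_mul]

theorem schoutenBracket_mul_left {p₁ p₂ : ℕ} {z₁ z₂ : ShiftedArc A}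
    (h₁ : z₁ ∈ parity (Arc A) _ p₁) (h₂ : z₂ ∈ parity (Arc A) _ p₂) (y : ShiftedArc A) :
    schoutenBracket A (z₁ * z₂) y =
      arrow (ShiftedArc.d A) (C z₁) (schoutenBracket A z₂ y) +
      (-1 : ℂ) ^ (p₁ * p₂) • arrow (ShiftedArc.d A) (C z₂) (schoutenBracket A z₁ y) := by
  have h₁₂ := mul_mem_parity h₁ h₂
  refine LinearMap.congr_fun ((schoutenBracket_lamDer h₁₂).ext
    ((((schoutenBracket_lamDer h₂).arrow h₁).congr (by omega)).add
      ((((schoutenBracket_lamDer h₁).arrow h₂).congr (by omega)).smul ((-1 : ℂ) ^ (p₁ * p₂))))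
    (fun a => ?_) fun E => ?_) y
  · refine (schoutenBracket_apply_fn h₁₂ a).trans ?_
    change _ = arrow (ShiftedArc.d A) (C z₁) (schoutenBracket A z₂ (OddArc.fn A _ a)) +
      (-1 : ℂ) ^ (p₁ * p₂) •
        arrow (ShiftedArc.d A) (C z₂) (schoutenBracket A z₁ (OddArc.fn A _ a))
    rw [schoutenBracket_apply_fn h₁, schoutenBracket_apply_fn h₂,
      negShift_mul_rule h₁ h₂ (fnBracket_lamDer a) (fnBracket_mem_parity a h₁), map_smul, map_smul,
      smul_add, smul_smul, smul_smul, smul_smul, ← pow_add, ← pow_add, ← pow_add, add_comm,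
      sign_eq (p₁ * p₂ + p₁ + p₂) (m := p₁ + p₂ + (p₁ + 1) * p₂) (n := p₁ * p₂ + p₁) (by ring),
      sign_eq (p₁ + p₂) (m := p₁ + p₂ + 1 * p₁) (n := p₂) (by ring)]
  · refine (schoutenBracket_apply_odd h₁₂ E).trans ?_
    change _ = arrow (ShiftedArc.d A) (C z₁) (schoutenBracket A z₂ (OddArc.odd A _ E)) +
      (-1 : ℂ) ^ (p₁ * p₂) •
        arrow (ShiftedArc.d A) (C z₂) (schoutenBracket A z₁ (OddArc.odd A _ E))
    rw [schoutenBracket_apply_odd h₁, schoutenBracket_apply_odd h₂,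
      negShift_mul_rule h₁ h₂ (thetaBracket_lamDer E) (thetaBracket_mem_parity E h₁), map_neg,
      map_neg, zero_mul, pow_zero, one_smul, add_zero, smul_neg]
    abel

/-- Induction on `z`. For generators it is the definition of the bracket together with involutivity
of `negShift`; products and `∂` are handled by the matching Leibniz and sesquilinearity rules in the
two slots. -/
theorem schoutenBracket_skew {p q : ℕ} {y z : ShiftedArc A} (hy : y ∈ ShiftedArc.deg A q)
    (hz : z ∈ ShiftedArc.deg A p) :
    schoutenBracket A z y =
      -((-1 : ℂ) ^ ((p + 1) * (q + 1)) • negShift (ShiftedArc.d A) (schoutenBracket A y z)) := by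
  have hy' := deg_le_parity hy
  refine OddArc.deg_induction (P := fun p z => schoutenBracket A z y =
      -((-1 : ℂ) ^ ((p + 1) * (q + 1)) • negShift (ShiftedArc.d A) (schoutenBracket A y z)))
    (fun p z₁ z₂ h₁ h₂ => ?_) (fun p₁ p₂ z₁ z₂ hz₁ hz₂ h₁ h₂ => ?_) (fun p z _ h => ?_)
    (fun a => ?_) (fun E => ?_) hz
  · rw [map_add, LinearMap.add_apply, h₁, h₂, map_add, map_add, smul_add, neg_add]
  · have hz₁' := deg_le_parity hz₁
    have hz₂' := deg_le_parity hz₂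
    rw [schoutenBracket_mul_left hz₁' hz₂', h₁, h₂,
      negShift_mul_rule hz₁' hz₂' (schoutenBracket_lamDer hy')
        (schoutenBracket_mem_parity hy' hz₁'), map_neg, map_neg, map_smul, map_smul, smul_add,
      smul_neg, smul_smul, smul_smul, smul_smul, ← pow_add, ← pow_add, ← pow_add,
      sign_eq (p₁ * p₂ + (p₁ + 1) * (q + 1) + p₂ * (q + 1))
        (m := p₁ * p₂ + (p₁ + 1) * (q + 1))
        (n := (p₁ + p₂ + 1) * (q + 1) + (p₁ + (q + 1)) * p₂) (by ring),
      sign_eq ((p₂ + 1) * (q + 1) + p₁ * (q + 1)) (m := (p₂ + 1) * (q + 1))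
        (n := (p₁ + p₂ + 1) * (q + 1) + (q + 1) * p₁) (by ring)]
    abel
  · rw [schoutenBracket_d, h, (schoutenBracket_lamDer hy').map_d, negShift_shiftOp, mul_neg,
      mul_smul_comm, smul_neg]
  · rw [schoutenBracket_fn, schoutenBracket_apply_fn hy', map_smul, negShift_negShift, smul_smul,
      ← pow_add, ← neg_smul, sign_eq (n := 1) (q + 1) (by ring), pow_one, neg_neg, one_smul]
  · rw [schoutenBracket_odd, schoutenBracket_apply_odd hy', map_neg, negShift_negShift,
      smul_neg, neg_neg, sign_eq (n := 0) (q + 1) (by ring), pow_zero, one_smul]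

/-! #### Degrees -/

variable (A) in
/-- The component of degree `k - 1`. -/
def predDeg : ℕ → Submodule ℂ (ShiftedArc A)
  | 0 => ⊥
  | k + 1 => ShiftedArc.deg A k

theorem d_mem_predDeg {k : ℕ} {x : ShiftedArc A} (hx : x ∈ predDeg A k) :
    ShiftedArc.d A x ∈ predDeg A k := by
  cases k with
  | zero => rw [(Submodule.mem_bot ℂ).1 hx, map_zero]; exact zero_mem _
  | succ k => exact OddArc.d_mem_deg hx

theorem predDeg_mul {k q l : ℕ} (hl : k + q = l) {x y : ShiftedArc A} (hx : x ∈ predDeg A k)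
    (hy : y ∈ ShiftedArc.deg A q) : x * y ∈ predDeg A l := by
  subst hl
  cases k with
  | zero => rw [(Submodule.mem_bot ℂ).1 hx, zero_mul]; exact zero_mem _
  | succ k =>
    rw [Nat.succ_add]
    exact mul_mem_deg hx hy

theorem mul_predDeg {k q l : ℕ} (hl : k + q = l) {x y : ShiftedArc A}
    (hx : x ∈ ShiftedArc.deg A q) (hy : y ∈ predDeg A k) : x * y ∈ predDeg A l := by
  subst hl
  cases k with
  | zero => rw [(Submodule.mem_bot ℂ).1 hy, mul_zero]; exact zero_mem _
  | succ k =>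
    rw [Nat.succ_add, add_comm k]
    exact mul_mem_deg hx hy

/-- The operator `φ` raises degrees by `p-1`. Indexing by degree plus one avoids subtraction, and
index zero encodes that the bracket of two functions vanishes. -/
theorem LamDer.mem_predDeg {ε p : ℕ} {φ : ShiftedArc A →ₗ[ℂ] (ShiftedArc A)[X]} (hφ : LamDer ε φ)
    (hfn : ∀ a, φ (OddArc.fn A _ a) ∈ polyIn (predDeg A p))
    (hodd : ∀ E, φ (OddArc.odd A _ E) ∈ polyIn (predDeg A (p + 1))) {q : ℕ} {z : ShiftedArc A}
    (hz : z ∈ ShiftedArc.deg A q) : φ z ∈ polyIn (predDeg A (p + q)) := by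
  refine OddArc.deg_induction (P := fun q z => φ z ∈ polyIn (predDeg A (p + q)))
    (fun q x y hx hy => ?_) (fun q₁ q₂ x y hx' hy' hx hy => ?_) (fun q x _ hx => ?_) hfn hodd hz
  · rw [map_add]
    exact add_mem hx hy
  · rw [hφ.map_mul, sigma_pow_of_mem (deg_le_parity hx'), ← smul_C, smul_mul_assoc]
    exact add_mem (mul_C_mem_polyIn (fun w hw => predDeg_mul (by omega) hw hy') hx)
      (Submodule.smul_mem _ _ (C_mul_mem_polyIn (fun w hw => mul_predDeg (by omega) hx' hw) hy))
  · rw [hφ.map_d]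
    exact shiftOp_mem_polyIn (fun _ => d_mem_predDeg) hx

theorem fnBracket_mem_predDeg (a : A) {q : ℕ} {z : ShiftedArc A} (hz : z ∈ ShiftedArc.deg A q) :
    fnBracket A a z ∈ polyIn (predDeg A q) := by
  have h := (fnBracket_lamDer a).mem_predDeg (p := 0)
    (fun b => by rw [fnBracket_fn]; exact zero_mem _)
    (fun E => by rw [fnBracket_odd]; exact C_mem_polyIn (OddArc.fn_mem _)) hz
  rwa [zero_add] at h

theorem thetaBracket_mem_predDeg (D : Derivation ℂ A A) {q : ℕ} {z : ShiftedArc A}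
    (hz : z ∈ ShiftedArc.deg A q) : thetaBracket A D z ∈ polyIn (predDeg A (1 + q)) :=
  (thetaBracket_lamDer D).mem_predDeg (p := 1)
    (fun b => by rw [thetaBracket_fn]; exact neg_mem (C_mem_polyIn (OddArc.fn_mem _)))
    (fun E => by rw [thetaBracket_odd]; exact neg_mem (C_mem_polyIn (OddArc.odd_mem _))) hz

theorem schoutenBracket_mem_predDeg {p q : ℕ} {y z : ShiftedArc A} (hy : y ∈ ShiftedArc.deg A p)
    (hz : z ∈ ShiftedArc.deg A q) : schoutenBracket A y z ∈ polyIn (predDeg A (p + q)) := by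
  have hy' := deg_le_parity hy
  refine (schoutenBracket_lamDer hy').mem_predDeg (fun a => ?_) (fun E => ?_) hz
  · rw [schoutenBracket_apply_fn hy']
    exact Submodule.smul_mem _ _
      (negShift_mem_polyIn (fun _ => d_mem_predDeg) (fnBracket_mem_predDeg a hy))
  · rw [schoutenBracket_apply_odd hy', add_comm p]
    exact neg_mem (negShift_mem_polyIn (fun _ => d_mem_predDeg) (thetaBracket_mem_predDeg E hy))

end Schouten

/-! ### The Jacobi identity and existence of the chiral Gerstenhaber structure. -/

section Jacobi

variable {A : Type} [CommRing A] [Algebra ℂ A]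

theorem schoutenBracket_d_right (y z : ShiftedArc A) :
    schoutenBracket A y (ShiftedArc.d A z) = shiftOp (ShiftedArc.d A) (schoutenBracket A y z) := by
  refine sum_homogeneous_induction (P := fun y => schoutenBracket A y (ShiftedArc.d A z) =
    shiftOp (ShiftedArc.d A) (schoutenBracket A y z)) (fun x y hx hy => ?_) (fun p y hy => ?_) y
  · rw [map_add, LinearMap.add_apply, hx, hy, LinearMap.add_apply, map_add]
  · exact (schoutenBracket_lamDer (deg_le_parity hy)).map_d z

variable (A) in
/-- The bracket `{y_λ x}` at a complex number `λ = z`. -/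
def brAt (z : ℂ) : ShiftedArc A →ₗ[ℂ] ShiftedArc A →ₗ[ℂ] ShiftedArc A :=
  (schoutenBracket A).compr₂ (evalAt z)

theorem brAt_apply (z : ℂ) (y x : ShiftedArc A) :
    brAt A z y x = evalAt z (schoutenBracket A y x) := rfl

theorem brAt_d_left (z : ℂ) (y x : ShiftedArc A) :
    brAt A z (ShiftedArc.d A y) x = -(z • brAt A z y x) := by
  rw [brAt_apply, schoutenBracket_d, map_neg, evalAt_X_mul, brAt_apply]

theorem brAt_d_right (z : ℂ) (y x : ShiftedArc A) :
    brAt A z y (ShiftedArc.d A x) = z • brAt A z y x + ShiftedArc.d A (brAt A z y x) := by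
  rw [brAt_apply, schoutenBracket_d_right, evalAt_shiftOp, brAt_apply]

theorem brAt_mul {p : ℕ} {y : ShiftedArc A} (hy : y ∈ parity (Arc A) _ p) (z : ℂ)
    (x x' : ShiftedArc A) :
    brAt A z y (x * x') = brAt A z y x * x' + (sigma ^ (p + 1)) x * brAt A z y x' := by
  rw [brAt_apply, (schoutenBracket_lamDer hy).map_mul, map_add, evalAt_mul_C, evalAt_C_mul]
  rfl

theorem sigma_pow_brAt {p : ℕ} {y : ShiftedArc A} (hy : y ∈ parity (Arc A) _ p) (n : ℕ) (z : ℂ)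
    (x : ShiftedArc A) :
    (sigma ^ n) (brAt A z y x) = (-1 : ℂ) ^ (n * (p + 1)) • brAt A z y ((sigma ^ n) x) :=
  sigma_pow_evalAt_schoutenBracket hy n z x

theorem brAt_mem_predDeg {p q : ℕ} {y x : ShiftedArc A} (hy : y ∈ ShiftedArc.deg A p)
    (hx : x ∈ ShiftedArc.deg A q) (z : ℂ) : brAt A z y x ∈ predDeg A (p + q) :=
  evalAt_mem (schoutenBracket_mem_predDeg hy hx) z

theorem schoutenBracket_skew_predDeg {k q : ℕ} {y z : ShiftedArc A} (hy : y ∈ ShiftedArc.deg A q)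
    (hz : z ∈ predDeg A k) :
    schoutenBracket A z y =
      -((-1 : ℂ) ^ (k * (q + 1)) • negShift (ShiftedArc.d A) (schoutenBracket A y z)) := by
  cases k with
  | zero =>
    rw [(Submodule.mem_bot ℂ).1 hz]
    simp
  | succ k => exact schoutenBracket_skew hy hz

theorem negShift_schoutenBracket {k q : ℕ} {y z : ShiftedArc A} (hy : y ∈ ShiftedArc.deg A q)
    (hz : z ∈ predDeg A k) :
    negShift (ShiftedArc.d A) (schoutenBracket A z y) =
      -((-1 : ℂ) ^ (k * (q + 1)) • schoutenBracket A y z) := by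
  rw [schoutenBracket_skew_predDeg hy hz, map_neg, map_smul, negShift_negShift]

theorem negShift_schoutenBracket_right {k q : ℕ} {y z : ShiftedArc A}
    (hy : y ∈ ShiftedArc.deg A q) (hz : z ∈ predDeg A k) :
    negShift (ShiftedArc.d A) (schoutenBracket A y z) =
      -((-1 : ℂ) ^ (k * (q + 1)) • schoutenBracket A z y) := by
  rw [schoutenBracket_skew_predDeg hy hz, smul_neg, neg_neg, smul_smul, sign_mul_self, one_smul]

/-- The Jacobi identity for three elements. -/
def JacobiAt (p q : ℕ) (a b c : ShiftedArc A) : Prop :=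
  ∀ z w : ℂ, brAt A z a (brAt A w b c) =
    brAt A (z + w) (brAt A z a b) c + (-1 : ℂ) ^ ((p + 1) * (q + 1)) • brAt A w b (brAt A z a c)

/-- The Jacobi identity equates the graded commutator of `{a_z ·}` and `{b_w ·}` with `{{a_z
b}_{z+w} ·}`. Both are twisted derivations with the same behaviour under `∂`, so generators suffice.
-/
theorem JacobiAt.of_generators {p q : ℕ} {a b : ShiftedArc A} (ha : a ∈ ShiftedArc.deg A p)
    (hb : b ∈ ShiftedArc.deg A q) (hfn : ∀ c, JacobiAt p q a b (OddArc.fn A _ c))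
    (hodd : ∀ E, JacobiAt p q a b (OddArc.odd A _ E)) (c : ShiftedArc A) : JacobiAt p q a b c := by
  have ha' := deg_le_parity ha
  have hb' := deg_le_parity hb
  refine OddArc.gen_induction (P := JacobiAt p q a b) (fun x y hx hy z w => ?_)
    (fun x y hx hy z w => ?_) (fun x hx z w => ?_) hfn hodd c
  · simp only [map_add, hx z w, hy z w, smul_add]
    abel
  · have hab : brAt A z a b ∈ parity (Arc A) _ (q + (p + 1)) :=
      evalAt_mem (schoutenBracket_mem_parity ha' hb') z
    have e₁ : ∀ x : ShiftedArc A, (sigma ^ (p + 1)) ((sigma ^ (q + 1)) x) =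
        (sigma ^ (q + (p + 1) + 1)) x := fun x => by
      rw [show q + (p + 1) + 1 = (p + 1) + (q + 1) by omega, pow_add _ (p + 1) (q + 1)]
      rfl
    have e₂ : ∀ x : ShiftedArc A, (sigma ^ (q + 1)) ((sigma ^ (p + 1)) x) =
        (sigma ^ (q + (p + 1) + 1)) x := fun x => by
      rw [show q + (p + 1) + 1 = (q + 1) + (p + 1) by omega, pow_add _ (q + 1) (p + 1)]
      rfl
    -- The mixed products of a bracket with `a` and a bracket with `b` occur in both iterated
    -- brackets; they match once the grading automorphism is moved across the brackets.
    simp only [brAt_mul hb', brAt_mul ha', brAt_mul hab, map_add, e₁, e₂, sigma_pow_brAt ha',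
      sigma_pow_brAt hb', hx z w, hy z w, smul_add, smul_mul_assoc, mul_smul_comm, mul_add,
      add_mul, smul_smul, mul_comm (q + 1) (p + 1), sign_mul_self, one_smul]
    abel
  · have h := hx z w
    rw [brAt_d_right, map_add, map_smul, brAt_d_right, h, brAt_d_right, brAt_d_right,
      map_add (brAt A w b), map_smul (brAt A w b), brAt_d_right]
    generalize brAt A (z + w) (brAt A z a b) x = M
    generalize brAt A w b (brAt A z a x) = R
    rw [map_add, map_smul]
    generalize ShiftedArc.d A M = M'
    generalize ShiftedArc.d A R = R'
    module

/-- The two iterated brackets trade places, and the remaining term changes by skew-symmetry of the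
inner bracket, where `-z-∂` acts as `w`. -/
theorem JacobiAt.swap_left {p q : ℕ} {a b c : ShiftedArc A} (ha : a ∈ ShiftedArc.deg A p)
    (hb : b ∈ ShiftedArc.deg A q) (h : JacobiAt p q a b c) : JacobiAt q p b a c := by
  intro z w
  have h₁ : brAt A (z + w) (brAt A z b a) c =
      -((-1 : ℂ) ^ ((p + 1) * (q + 1)) • brAt A (z + w) (brAt A w a b) c) := by
    have e : brAt A z b a = (-(-1 : ℂ) ^ ((p + 1) * (q + 1))) •
        evalAt z (negShift (ShiftedArc.d A) (schoutenBracket A a b)) := by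
      rw [brAt_apply, schoutenBracket_skew ha hb, map_neg, map_smul, mul_comm (q + 1), neg_smul]
    have e' : brAt A (z + w) (evalAt z (negShift (ShiftedArc.d A) (schoutenBracket A a b))) c =
        brAt A (z + w) (brAt A w a b) c := bracket_evalAt_negShift schoutenBracket_d z w _ c
    rw [e, LinearMap.map_smul₂, e', neg_smul]
  have h₂ := h w z
  rw [add_comm w z] at h₂
  rw [h₁, h₂, mul_comm (q + 1)]
  generalize brAt A (z + w) (brAt A w a b) c = M
  generalize brAt A z b (brAt A w a c) = R
  rw [smul_add, smul_smul, sign_mul_self, one_smul, neg_add_cancel_left]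

-- Skew-symmetry is applied to each bracket in which `b` and `c` trade sides. The inner bracket
-- `{b_w c}` requires the substitution `-w-∂` to be carried through `{a_z ·}`.
set_option maxHeartbeats 800000 in
theorem JacobiAt.swap_right {p q r : ℕ} {a b c : ShiftedArc A} (ha : a ∈ ShiftedArc.deg A p)
    (hb : b ∈ ShiftedArc.deg A q) (hc : c ∈ ShiftedArc.deg A r) (h : JacobiAt p q a b c) :
    JacobiAt p r a c b := by
  intro z w
  -- The hypothesis for fixed `z` and all `w`, as an identity of polynomials; only in this form can
  -- `λ ↦ -λ-∂` be applied to it.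
  have h₁ : coeffMap (brAt A z a) (schoutenBracket A b c) =
      translate z (schoutenBracket A (brAt A z a b) c) +
        (-1 : ℂ) ^ ((p + 1) * (q + 1)) • schoutenBracket A b (brAt A z a c) := by
    refine poly_ext_evalAt fun w => ?_
    rw [evalAt_coeffMap, map_add, evalAt_translate, map_smul]
    exact h z w
  rw [brAt_apply w c b, schoutenBracket_skew hb hc, map_neg, map_smul, map_neg, map_smul,
    map_evalAt_negShift (fun x => brAt_d_right z a x), h₁, map_add, map_add,
    evalAt_negShift_translate, negShift_schoutenBracket hc (brAt_mem_predDeg ha hb z), map_smul,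
    map_smul, negShift_schoutenBracket_right hb (brAt_mem_predDeg ha hc z), map_neg, map_neg,
    map_smul, map_smul, smul_neg, smul_add, smul_neg, smul_neg, smul_smul, smul_smul, smul_smul,
    ← pow_add, ← pow_add, ← pow_add,
    sign_eq (m := (r + 1) * (q + 1) + (p + q) * (r + 1)) (n := (p + 1) * (r + 1))
      ((r + 1) * (q + p + 1)) (by ring),
    sign_eq (m := (r + 1) * (q + 1) + (p + 1) * (q + 1) + (p + r) * (q + 1)) (n := 0)
      ((q + 1) * (p + r + 1)) (by ring), pow_zero, one_smul, ← brAt_apply w c,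
    ← brAt_apply (z + w) (brAt A z a c)]
  generalize brAt A w c (brAt A z a b) = M
  generalize brAt A (z + w) (brAt A z a c) b = R
  rw [← neg_add, neg_neg, add_comm]

variable (A) in
/-- The generators: functions and vector fields. -/
inductive IsGenerator : ℕ → ShiftedArc A → Prop
  | fn (a : A) : IsGenerator 0 (OddArc.fn A _ a)
  | odd (D : Derivation ℂ A A) : IsGenerator 1 (OddArc.odd A _ D)

theorem IsGenerator.mem {p : ℕ} {a : ShiftedArc A} (h : IsGenerator A p a) :
    a ∈ ShiftedArc.deg A p := by
  cases h
  · exact OddArc.fn_mem _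
  · exact OddArc.odd_mem _

theorem brAt_fn_fn (z : ℂ) (a b : A) : brAt A z (OddArc.fn A _ a) (OddArc.fn A _ b) = 0 := by
  rw [brAt_apply, schoutenBracket_fn, fnBracket_fn, map_zero]

theorem brAt_fn_odd (z : ℂ) (a : A) (E : Derivation ℂ A A) :
    brAt A z (OddArc.fn A _ a) (OddArc.odd A _ E) = OddArc.fn A _ (E a) := by
  rw [brAt_apply, schoutenBracket_fn, fnBracket_odd, evalAt_C]

theorem brAt_odd_fn (z : ℂ) (D : Derivation ℂ A A) (b : A) :
    brAt A z (OddArc.odd A _ D) (OddArc.fn A _ b) = -OddArc.fn A _ (D b) := by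
  rw [brAt_apply, schoutenBracket_odd, thetaBracket_fn, map_neg, evalAt_C]

theorem brAt_odd_odd (z : ℂ) (D E : Derivation ℂ A A) :
    brAt A z (OddArc.odd A _ D) (OddArc.odd A _ E) = -OddArc.odd A _ ⁅D, E⁆ := by
  rw [brAt_apply, schoutenBracket_odd, thetaBracket_odd, map_neg, evalAt_C]

theorem jacobiAt_generators {p q r : ℕ} {a b c : ShiftedArc A} (ha : IsGenerator A p a)
    (hb : IsGenerator A q b) (hc : IsGenerator A r c) : JacobiAt p q a b c := by
  intro z w
  cases ha with
  | fn a =>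
    cases hb with
    | fn b =>
      cases hc <;> simp [brAt_fn_fn, brAt_fn_odd]
    | odd D =>
      cases hc with
      | fn c => simp [brAt_fn_fn, brAt_fn_odd, brAt_odd_fn]
      | odd E =>
        simp only [brAt_fn_odd, brAt_odd_fn, brAt_odd_odd, map_neg, Derivation.commutator_apply]
        norm_num
        rw [eq_comm, ← sub_eq_add_neg, sub_eq_iff_eq_add, neg_add_eq_sub, eq_sub_iff_add_eq,
          ← OddArc.fn_add]
        congr 1
        ring
  | odd D =>
    cases hb with
    | fn b =>
      cases hc with
      | fn c => simp [brAt_fn_fn, brAt_odd_fn]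
      | odd E =>
        simp only [brAt_fn_odd, brAt_odd_fn, brAt_odd_odd, map_neg, Derivation.commutator_apply,
          LinearMap.neg_apply]
        norm_num
        rw [neg_add_eq_sub, eq_sub_iff_add_eq, neg_add_eq_sub, sub_eq_iff_eq_add, eq_comm,
          neg_add_eq_sub, sub_eq_iff_eq_add, ← OddArc.fn_add]
        congr 1
        ring
    | odd E =>
      cases hc with
      | fn c =>
        simp only [brAt_odd_fn, brAt_odd_odd, map_neg, Derivation.commutator_apply,
          LinearMap.neg_apply, neg_neg]
        norm_num
        rw [← OddArc.fn_add]
        congr 1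
        ring
      | odd F =>
        simp only [brAt_odd_odd, map_neg, LinearMap.neg_apply, neg_neg]
        norm_num
        rw [← OddArc.odd_add, sub_add_cancel]

/-- Only the third argument can be freed directly, by `JacobiAt.of_generators`. The swaps bring each
argument there in turn: `h₁` frees the last slot, `h₂` the middle one, `h₃` both, and `h₄` moves the
remaining generator to the last slot. -/
theorem jacobiAt {p q : ℕ} {a b : ShiftedArc A} (ha : a ∈ ShiftedArc.deg A p)
    (hb : b ∈ ShiftedArc.deg A q) (c : ShiftedArc A) : JacobiAt p q a b c := by
  have h₁ : ∀ {p q a b}, IsGenerator A p a → IsGenerator A q b → ∀ c, JacobiAt p q a b c :=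
    fun ha hb => .of_generators ha.mem hb.mem (fun c => jacobiAt_generators ha hb (.fn c))
      fun E => jacobiAt_generators ha hb (.odd E)
  have h₂ : ∀ {p q r a b c}, IsGenerator A p a → b ∈ ShiftedArc.deg A q → IsGenerator A r c →
      JacobiAt p q a b c := fun ha hb hc => (h₁ ha hc _).swap_right ha.mem hc.mem hb
  have h₃ : ∀ {p q a b}, IsGenerator A p a → b ∈ ShiftedArc.deg A q → ∀ c, JacobiAt p q a b c :=
    fun ha hb => .of_generators ha.mem hb (fun c => h₂ ha hb (.fn c)) fun E => h₂ ha hb (.odd E)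
  have h₄ : ∀ {p q r a b c}, a ∈ ShiftedArc.deg A p → b ∈ ShiftedArc.deg A q →
      IsGenerator A r c → JacobiAt p q a b c :=
    fun ha hb hc => ((h₃ hc ha _).swap_left hc.mem ha).swap_right ha hc.mem hb
  exact .of_generators ha hb (fun c => h₄ ha hb (.fn c)) (fun E => h₄ ha hb (.odd E)) c

variable (A) in
/-- The chiral Gerstenhaber structure that extends the Schouten bracket. -/
def schouten : ChiralGerstenhaber (ShiftedArc.deg A) (ShiftedArc.d A) where
  br := schoutenBracket A
  degree p q r h a ha b hb n := by
    have h' := schoutenBracket_mem_predDeg ha hb n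
    rw [h] at h'
    exact h'
  degree_zero a ha b hb := by
    ext n
    have h := schoutenBracket_mem_predDeg ha hb n
    rw [coeff_zero]
    exact (Submodule.mem_bot ℂ).1 h
  sesquilinear := ⟨schoutenBracket_d, fun a b => by rw [schoutenBracket_d_right, shiftOp_apply]⟩
  skew p q a ha b hb := by
    rw [schoutenBracket_skew ha hb, mul_comm]
  jacobi p q a ha b hb c := (jacobi_iff _ _ _ _ _).2 (jacobiAt ha hb c)
  leibniz p q a ha b hb c := by
    rw [(schoutenBracket_lamDer (deg_le_parity ha)).map_mul, sigma_pow_of_mem (deg_le_parity hb),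
      ← smul_C, smul_mul_assoc]

theorem schouten_extends : ExtendsSchouten (schouten A) where
  fn_fn a b := by
    change schoutenBracket A (OddArc.fn A _ a) (OddArc.fn A _ b) = 0
    rw [schoutenBracket_fn, fnBracket_fn]
  fn_theta a D := by
    change schoutenBracket A (OddArc.fn A _ a) (OddArc.odd A _ D) = C (OddArc.fn A _ (D a))
    rw [schoutenBracket_fn, fnBracket_odd]
  theta_theta D E := by
    change schoutenBracket A (OddArc.odd A _ D) (OddArc.odd A _ E) = -C (OddArc.odd A _ ⁅D, E⁆)
    rw [schoutenBracket_odd, thetaBracket_odd]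

end Jacobi

/-! ### Compatibility with homomorphisms, and uniqueness. -/

section Naturality

theorem coeffMap_map {V W : Type} [Ring V] [Algebra ℂ V] [Ring W] [Algebra ℂ W] {D : V →ₗ[ℂ] V}
    {D' : W →ₗ[ℂ] W} {F : V →+* W} (hF : ∀ x, F (D x) = D' (F x)) (q : V[X]) :
    (coeffMap D q).map F = coeffMap D' (q.map F) := by
  ext n
  rw [coeff_map, coeffMap_coeff, coeffMap_coeff, coeff_map, hF]

theorem shiftOp_map {V W : Type} [Ring V] [Algebra ℂ V] [Ring W] [Algebra ℂ W] {D : V →ₗ[ℂ] V}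
    {D' : W →ₗ[ℂ] W} {F : V →+* W} (hF : ∀ x, F (D x) = D' (F x)) (q : V[X]) :
    (shiftOp D q).map F = shiftOp D' (q.map F) := by
  rw [shiftOp_apply, shiftOp_apply, Polynomial.map_add, Polynomial.map_mul, map_X, coeffMap_map hF]

theorem negShift_map {V W : Type} [Ring V] [Algebra ℂ V] [Ring W] [Algebra ℂ W] {D : V →ₗ[ℂ] V}
    {D' : W →ₗ[ℂ] W} {F : V →+* W} (hF : ∀ x, F (D x) = D' (F x)) (q : V[X]) :
    (negShift D q).map F = negShift D' (q.map F) := by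
  induction q using poly_induction with
  | hC v => rw [negShift_C, map_C, negShift_C]
  | hadd q r hq hr => rw [map_add, Polynomial.map_add, hq, hr, Polynomial.map_add, map_add]
  | hX q hq =>
    rw [negShift_X_mul, Polynomial.map_neg, shiftOp_map hF, hq, Polynomial.map_mul, map_X,
      negShift_X_mul]

theorem smul_map {V W : Type} [Ring V] [Algebra ℂ V] [Ring W] [Algebra ℂ W] {F : V →+* W}
    (hF : ∀ (c : ℂ) x, F (c • x) = c • F x) (c : ℂ) (q : V[X]) :
    (c • q).map F = c • q.map F := by
  ext n
  rw [coeff_map, coeff_smul, coeff_smul, coeff_map, hF]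

variable {A B : Type} [CommRing A] [Algebra ℂ A] [CommRing B] [Algebra ℂ B]
  {G : ChiralGerstenhaber (ShiftedArc.deg A) (ShiftedArc.d A)}
  {G' : ChiralGerstenhaber (ShiftedArc.deg B) (ShiftedArc.d B)}
  {F : ShiftedArc A →+* ShiftedArc B}

/-- Homomorphisms of graded differential algebras. -/
structure IsDifferential (F : ShiftedArc A →+* ShiftedArc B) : Prop where
  map_smul : ∀ (c : ℂ) x, F (c • x) = c • F x
  map_d : ∀ x, F (ShiftedArc.d A x) = ShiftedArc.d B (F x)
  map_mem : ∀ {p x}, x ∈ ShiftedArc.deg A p → F x ∈ ShiftedArc.deg B p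

/-- The Leibniz rule and sesquilinearity in the second slot, which hold in both structures,
propagate the compatibility from generators. Skew-symmetry then frees the first slot. -/
theorem IsDifferential.map_br_of_generators (hF : IsDifferential F) {p : ℕ} {y : ShiftedArc A}
    (hy : y ∈ ShiftedArc.deg A p)
    (hfn : ∀ a, G'.br (F y) (F (OddArc.fn A _ a)) = (G.br y (OddArc.fn A _ a)).map F)
    (hodd : ∀ E, G'.br (F y) (F (OddArc.odd A _ E)) = (G.br y (OddArc.odd A _ E)).map F)
    (z : ShiftedArc A) : G'.br (F y) (F z) = (G.br y z).map F := by
  refine sum_homogeneous_induction (P := fun z => G'.br (F y) (F z) = (G.br y z).map F)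
    (fun x z hx hz => ?_) (fun q z hz => ?_) z
  · rw [map_add, map_add, hx, hz, map_add, Polynomial.map_add]
  · refine OddArc.deg_induction (P := fun q z => G'.br (F y) (F z) = (G.br y z).map F)
      (fun q x z hx hz => ?_) (fun q r x z hx hz hx' hz' => ?_) (fun q x hx hx' => ?_) hfn hodd hz
    · rw [map_add, map_add, hx, hz, map_add, Polynomial.map_add]
    · rw [map_mul, G'.leibniz p q _ (hF.map_mem hy) _ (hF.map_mem hx), G.leibniz p q _ hy _ hx,
        Polynomial.map_add, Polynomial.map_mul, smul_map hF.map_smul, Polynomial.map_mul, map_C,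
        map_C, hx', hz']
    · rw [hF.map_d, G'.sesquilinear.right, G.sesquilinear.right, ← shiftOp_apply, ← shiftOp_apply,
        shiftOp_map hF.map_d, hx']

theorem IsDifferential.map_br_swap (hF : IsDifferential F) {p q : ℕ} {y z : ShiftedArc A}
    (hy : y ∈ ShiftedArc.deg A p) (hz : z ∈ ShiftedArc.deg A q)
    (h : G'.br (F y) (F z) = (G.br y z).map F) : G'.br (F z) (F y) = (G.br z y).map F := by
  rw [G'.skew p q _ (hF.map_mem hy) _ (hF.map_mem hz), h, G.skew p q _ hy _ hz,
    Polynomial.map_neg, smul_map hF.map_smul, negShift_map hF.map_d]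

/-- A homomorphism that is compatible with the brackets of functions and vector fields is
compatible with the brackets. -/
theorem IsDifferential.map_br (hF : IsDifferential F)
    (hff : ∀ a b, G'.br (F (OddArc.fn A _ a)) (F (OddArc.fn A _ b)) =
      (G.br (OddArc.fn A _ a) (OddArc.fn A _ b)).map F)
    (hft : ∀ a E, G'.br (F (OddArc.fn A _ a)) (F (OddArc.odd A _ E)) =
      (G.br (OddArc.fn A _ a) (OddArc.odd A _ E)).map F)
    (htt : ∀ D E, G'.br (F (OddArc.odd A _ D)) (F (OddArc.odd A _ E)) =
      (G.br (OddArc.odd A _ D) (OddArc.odd A _ E)).map F)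
    (y z : ShiftedArc A) : G'.br (F y) (F z) = (G.br y z).map F := by
  have h₁ : ∀ a z, G'.br (F (OddArc.fn A _ a)) (F z) = (G.br (OddArc.fn A _ a) z).map F :=
    fun a => hF.map_br_of_generators (OddArc.fn_mem a) (hff a) (hft a)
  have h₂ : ∀ D z, G'.br (F (OddArc.odd A _ D)) (F z) = (G.br (OddArc.odd A _ D) z).map F :=
    fun D => hF.map_br_of_generators (OddArc.odd_mem D)
      (fun a => hF.map_br_swap (OddArc.fn_mem a) (OddArc.odd_mem D) (hft a D)) (htt D)
  refine sum_homogeneous_induction (P := fun y => G'.br (F y) (F z) = (G.br y z).map F)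
    (fun x y hx hy => ?_) (fun p y hy => ?_) y
  · rw [map_add, map_add, LinearMap.add_apply, hx, hy, map_add, LinearMap.add_apply,
      Polynomial.map_add]
  · exact hF.map_br_of_generators hy
      (fun a => hF.map_br_swap (OddArc.fn_mem a) hy (h₁ a y))
      (fun E => hF.map_br_swap (OddArc.odd_mem E) hy (h₂ E y)) z

theorem isDifferential_id : IsDifferential (RingHom.id (ShiftedArc A)) :=
  ⟨fun _ _ => rfl, fun _ => rfl, fun hx => hx⟩

/-- There is only one chiral Gerstenhaber structure that extends the Schouten bracket. -/
theorem ExtendsSchouten.eq_schouten (hG : ExtendsSchouten G) : G = schouten A := by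
  have hS := schouten_extends (A := A)
  refine ChiralGerstenhaber.ext ?_
  ext1 y
  ext1 z
  -- The identity is a differential homomorphism between two structures with the same brackets on
  -- generators.
  have h := isDifferential_id.map_br (G := schouten A) (G' := G)
    (fun a b => by
      rw [Polynomial.map_id]
      exact (hG.fn_fn a b).trans (hS.fn_fn a b).symm)
    (fun a E => by
      rw [Polynomial.map_id]
      exact (hG.fn_theta a E).trans (hS.fn_theta a E).symm)
    (fun D E => by
      rw [Polynomial.map_id]
      exact (hG.theta_theta D E).trans (hS.theta_theta D E).symm) y z
  rwa [Polynomial.map_id] at h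

theorem existsUnique_extendsSchouten :
    ∃! G : ChiralGerstenhaber (ShiftedArc.deg A) (ShiftedArc.d A), ExtendsSchouten G :=
  ⟨schouten A, schouten_extends, fun _ hG => hG.eq_schouten⟩

end Naturality

/-! ### Restriction of the bracket along étale homomorphisms. -/

section Restriction

variable {A B : Type} [CommRing A] [Algebra ℂ A] [CommRing B] [Algebra ℂ B]

theorem ArcMod.map_d {M N : Type} [AddCommGroup M] [Module A M] [AddCommGroup N] [Module B N]
    (f : A →ₐ[ℂ] B) (g : M →ₛₗ[(f : A →+* B)] N) (x : ArcMod A M) :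
    ArcMod.map f g (ArcMod.d A M x) = ArcMod.d B N (ArcMod.map f g x) := by
  obtain ⟨p, rfl⟩ := ArcMod.mk_surjective A M x
  exact ArcMod.preMap_d f g p

theorem ArcMod.map_jet {M N : Type} [AddCommGroup M] [Module A M] [AddCommGroup N] [Module B N]
    (f : A →ₐ[ℂ] B) (g : M →ₛₗ[(f : A →+* B)] N) (m : M) (n : ℕ) :
    ArcMod.map f g (ArcMod.jet A M m n) = ArcMod.jet B N (g m) n := by
  refine (ArcMod.preMap_single f g m n 1).trans ?_
  rw [map_one, one_smul]

variable (f : A →ₐ[ℂ] B) (hf : (f : A →+* B).Etale)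

theorem ShiftedArc.map_algebraMap (r : Arc A) :
    ShiftedArc.map f hf (algebraMap (Arc A) (ShiftedArc A) r) =
      algebraMap (Arc B) (ShiftedArc B) (Arc.map f r) :=
  extLift_algebraMap (OddArc.mapFn f _) (OddArc.mapFn_comm f) (OddArc.mapGen f (restrictDer f hf))
    (OddArc.mapGen_smul f _) (OddArc.mapGen_sq f _) r

theorem ShiftedArc.map_ι (m : ArcMod A (Derivation ℂ A A)) :
    ShiftedArc.map f hf (ExteriorAlgebra.ι (Arc A) m) =
      ExteriorAlgebra.ι (Arc B) (ArcMod.map f (restrictDer f hf) m) :=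
  extLift_ι (OddArc.mapFn f _) (OddArc.mapFn_comm f) (OddArc.mapGen f (restrictDer f hf))
    (OddArc.mapGen_smul f _) (OddArc.mapGen_sq f _) m

theorem ShiftedArc.map_fn (a : A) :
    ShiftedArc.map f hf (OddArc.fn A _ a) = OddArc.fn B _ (f a) := by
  rw [OddArc.fn, ShiftedArc.map_algebraMap, Arc.map_of]
  rfl

theorem ShiftedArc.map_odd (D : Derivation ℂ A A) :
    ShiftedArc.map f hf (OddArc.odd A _ D) = OddArc.odd B _ (extendDer f hf D) := by
  refine (ShiftedArc.map_ι f hf _).trans ?_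
  rw [ArcMod.map_jet]
  rfl

theorem ShiftedArc.map_isDifferential : IsDifferential (ShiftedArc.map f hf) where
  map_smul c x := by
    rw [extAlg_smul_def, map_mul, ShiftedArc.map_algebraMap, AlgHom.commutes, ← extAlg_smul_def]
  map_d x := by
    induction x using ExteriorAlgebra.induction with
    | algebraMap r =>
      rw [OddArc.d_algebraMap, ShiftedArc.map_algebraMap, ShiftedArc.map_algebraMap, Arc.map_d,
        OddArc.d_algebraMap]
    | ι m =>
      rw [OddArc.d_ι, ShiftedArc.map_ι, ShiftedArc.map_ι, OddArc.d_ι, ArcMod.map_d]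
    | mul x y hx hy => rw [OddArc.d_mul, map_add, map_mul, map_mul, hx, hy, map_mul, OddArc.d_mul]
    | add x y hx hy => rw [map_add, map_add, hx, hy, map_add, map_add]
  map_mem {p x} hx := by
    refine homogeneous_induction (P := fun p x => ShiftedArc.map f hf x ∈ ShiftedArc.deg B p)
      (fun p x y hx hy => ?_) (fun r => ?_) (fun p m x _ hx => ?_) hx
    · rw [map_add]
      exact add_mem hx hy
    · rw [ShiftedArc.map_algebraMap]
      exact algebraMap_mem_deg _
    · rw [map_mul, ShiftedArc.map_ι, add_comm p 1]
      exact mul_mem_deg (ι_mem_deg _) hx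

theorem extendDer_lie (D E : Derivation ℂ A A) :
    extendDer f hf ⁅D, E⁆ = ⁅extendDer f hf D, extendDer f hf E⁆ :=
  der_ext f hf fun a => by
    simp only [Derivation.commutator_apply, extendDer_apply, map_sub]

/-- The bracket is compatible with restriction. -/
theorem ShiftedArc.map_schoutenBracket (y z : ShiftedArc A) :
    schoutenBracket B (ShiftedArc.map f hf y) (ShiftedArc.map f hf z) =
      (schoutenBracket A y z).map (ShiftedArc.map f hf) := by
  refine (ShiftedArc.map_isDifferential f hf).map_br (G := schouten A) (G' := schouten B)
    (fun a b => ?_) (fun a E => ?_) (fun D E => ?_) y z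
  · rw [ShiftedArc.map_fn, ShiftedArc.map_fn]
    refine ((schouten_extends (A := B)).fn_fn (f a) (f b)).trans ?_
    rw [show (schouten A).br (OddArc.fn A _ a) (OddArc.fn A _ b) = 0 from
      schouten_extends.fn_fn a b, Polynomial.map_zero]
  · rw [ShiftedArc.map_fn, ShiftedArc.map_odd]
    refine ((schouten_extends (A := B)).fn_theta (f a) (extendDer f hf E)).trans ?_
    rw [show (schouten A).br (OddArc.fn A _ a) (OddArc.odd A _ E) = C (OddArc.fn A _ (E a)) from
      schouten_extends.fn_theta a E, Polynomial.map_C, ShiftedArc.map_fn, extendDer_apply]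
    rfl
  · rw [ShiftedArc.map_odd, ShiftedArc.map_odd]
    refine ((schouten_extends (A := B)).theta_theta (extendDer f hf D) (extendDer f hf E)).trans ?_
    rw [show (schouten A).br (OddArc.odd A _ D) (OddArc.odd A _ E) = -C (OddArc.odd A _ ⁅D, E⁆)
      from schouten_extends.theta_theta D E, Polynomial.map_neg, Polynomial.map_C,
      ShiftedArc.map_odd, extendDer_lie]
    rfl

end Restriction

/-! ### Quasi-coordinates on smooth algebras. -/

section QuasiCoordinates

variable {A : Type} [CommRing A] [Algebra ℂ A]

variable (A) in
/-- Functions `u^i` and vector fields `D_i` with `da = ∑ D_i(a) du^i` for all functions `a`. -/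
structure QuasiCoordinates where
  /-- the number of functions -/
  n : ℕ
  /-- the functions -/
  u : Fin n → A
  /-- the vector fields -/
  D : Fin n → Derivation ℂ A A
  d_eq : ∀ a, KaehlerDifferential.D ℂ A a = ∑ i, D i a • KaehlerDifferential.D ℂ A (u i)

theorem QuasiCoordinates.derivation_eq (c : QuasiCoordinates A) {N : Type} [AddCommGroup N]
    [Module A N] [Module ℂ N] [IsScalarTower ℂ A N] (δ : Derivation ℂ A N) (a : A) :
    δ a = ∑ i, c.D i a • δ (c.u i) := by
  have h := congrArg δ.liftKaehlerDifferential (c.d_eq a)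
  simpa only [map_sum, map_smul, Derivation.liftKaehlerDifferential_comp_D] using h

theorem derivation_sum_apply {ι : Type} (s : Finset ι) (E : ι → Derivation ℂ A A) (a : A) :
    (∑ i ∈ s, E i) a = ∑ i ∈ s, E i a := by
  classical
  induction s using Finset.induction_on with
  | empty => rfl
  | insert i s hi ih => rw [Finset.sum_insert hi, Finset.sum_insert hi, Derivation.add_apply, ih]

theorem QuasiCoordinates.vectorField_eq (c : QuasiCoordinates A) (E : Derivation ℂ A A) :
    E = ∑ i, E (c.u i) • c.D i := by
  ext a
  rw [c.derivation_eq E a, derivation_sum_apply]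
  exact Finset.sum_congr rfl fun i _ => mul_comm _ _

/-- Quasi-coordinates exist on smooth algebras. -/
theorem QuasiCoordinates.nonempty [Algebra.FiniteType ℂ A] [Algebra.FormallySmooth ℂ A] :
    Nonempty (QuasiCoordinates A) := by
  obtain ⟨t, ht, hspan⟩ := (Submodule.fg_span_iff_fg_span_finset_subset
    (Set.range (KaehlerDifferential.D ℂ A))).1 (by
      rw [KaehlerDifferential.span_range_derivation]
      exact Module.Finite.fg_top)
  have ht' : ∀ x : Fin t.card, ∃ a, KaehlerDifferential.D ℂ A a = t.equivFin.symm x :=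
    fun x => ht (t.equivFin.symm x).2
  choose u hu using ht'
  let π : (Fin t.card → A) →ₗ[A] Ω[A⁄ℂ] :=
    Fintype.linearCombination A fun i => KaehlerDifferential.D ℂ A (u i)
  have hπ : Function.Surjective π := by
    rw [← LinearMap.range_eq_top, Fintype.range_linearCombination,
      ← KaehlerDifferential.span_range_derivation, hspan]
    congr 1
    ext x
    constructor
    · rintro ⟨i, rfl⟩
      simp only [hu]
      exact (t.equivFin.symm i).2
    · intro hx
      exact ⟨t.equivFin ⟨x, hx⟩, by simp [hu]⟩
  -- Differentials of a smooth algebra form a projective module, so the surjection from the free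
  -- module splits. The components of the splitting are the vector fields `D_i`.
  obtain ⟨s, hs⟩ := Module.projective_lifting_property π LinearMap.id hπ
  refine ⟨⟨t.card, u, fun i => ((LinearMap.proj i).comp s).compDer (KaehlerDifferential.D ℂ A),
    fun a => ?_⟩⟩
  have h := LinearMap.congr_fun hs (KaehlerDifferential.D ℂ A a)
  rw [LinearMap.comp_apply, LinearMap.id_apply] at h
  exact h.symm

/-- Coordinates are quasi-coordinates. -/
def Coordinates.toQuasi [Algebra.FormallySmooth ℂ A] (c : Coordinates A) : QuasiCoordinates A where
  n := c.n
  u := c.u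
  D := c.frame
  d_eq a := by
    -- On the projective module of differentials, elements are detected by linear functionals, that
    -- is, by vector fields. A vector field has components `E(u^i)` in the frame.
    rw [← sub_eq_zero, ← Module.forall_dual_apply_eq_zero_iff A]
    intro φ
    set E : Derivation ℂ A A := φ.compDer (KaehlerDifferential.D ℂ A)
    have hE : ∀ a, φ (KaehlerDifferential.D ℂ A a) = E a := fun a => rfl
    have hr : ∀ a, E a = ∑ i, c.frame.repr E i * c.frame i a := fun a => by
      conv_lhs => rw [← c.frame.sum_repr E]
      rw [derivation_sum_apply]
      rfl
    have hu : ∀ i, E (c.u i) = c.frame.repr E i := fun i => by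
      rw [hr, Finset.sum_eq_single i]
      · rw [c.dual, if_pos rfl, mul_one]
      · intro j _ hj
        rw [c.dual, if_neg hj, mul_zero]
      · intro h
        exact absurd (Finset.mem_univ i) h
    simp only [map_sub, map_sum, map_smul, hE, smul_eq_mul, hu]
    rw [hr, sub_eq_zero]
    exact Finset.sum_congr rfl fun i _ => mul_comm _ _

variable {B : Type} [CommRing B] [Algebra ℂ B]

/-- A derivation that vanishes on the image of an étale homomorphism vanishes. -/
theorem derivation_eq_zero_of_etale (f : A →ₐ[ℂ] B) (hf : (f : A →+* B).Etale) {N : Type}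
    [AddCommGroup N] [Module B N] [Module ℂ N] [IsScalarTower ℂ B N] {δ : Derivation ℂ B N}
    (h : ∀ a, δ (f a) = 0) : δ = 0 := by
  let _ : Algebra A B := (f : A →+* B).toAlgebra
  have : IsScalarTower ℂ A B := IsScalarTower.of_algebraMap_eq fun c => (f.commutes c).symm
  have : Algebra.Etale A B := hf
  let _ : Module A N := Module.compHom N (f : A →+* B)
  have hsm : ∀ (a : A) (x : N), a • x = f a • x := fun _ _ => rfl
  have : IsScalarTower A B N := ⟨fun a b x => by
    rw [hsm, ← mul_smul]
    rfl⟩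
  -- Vanishing on the image of `A` makes `δ` linear over `A`, and étale homomorphisms have no
  -- relative differentials.
  let F : Derivation A B N := Derivation.mk' (R := A)
    { toFun := δ
      map_add' := fun x y => map_add _ x y
      map_smul' := fun a b => by
        rw [Algebra.smul_def a b, Derivation.leibniz, show algebraMap A B a = f a from rfl, h,
          smul_zero, add_zero, RingHom.id_apply, hsm] }
    (fun x y => δ.leibniz x y)
  have hF : F = 0 := by
    rw [← F.liftKaehlerDifferential_comp, Subsingleton.elim F.liftKaehlerDifferential 0]
    ext
    rfl
  ext b
  exact congrArg (fun G : Derivation A B N => G b) hF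

/-- Restriction of quasi-coordinates along an étale homomorphism. -/
def QuasiCoordinates.restrict (c : QuasiCoordinates A) (f : A →ₐ[ℂ] B)
    (hf : (f : A →+* B).Etale) : QuasiCoordinates B where
  n := c.n
  u i := f (c.u i)
  D i := extendDer f hf (c.D i)
  d_eq b := by
    let _ : Algebra A B := (f : A →+* B).toAlgebra
    have : IsScalarTower ℂ A B := IsScalarTower.of_algebraMap_eq fun c => (f.commutes c).symm
    -- The claim is that `L` fixes every exact differential `db`. The derivation `b ↦ db - L(db)`
    -- vanishes on the image of `A`, hence everywhere.
    let L : Ω[B⁄ℂ] →ₗ[B] Ω[B⁄ℂ] := ∑ i, (extendDer f hf (c.D i)).liftKaehlerDifferential.smulRight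
      (KaehlerDifferential.D ℂ B (f (c.u i)))
    have hL : ∀ b, L (KaehlerDifferential.D ℂ B b) =
        ∑ i, extendDer f hf (c.D i) b • KaehlerDifferential.D ℂ B (f (c.u i)) := fun b => by
      simp only [L, LinearMap.sum_apply, LinearMap.smulRight_apply,
        Derivation.liftKaehlerDifferential_comp_D]
    have h0 : (LinearMap.id - L).compDer (KaehlerDifferential.D ℂ B) = 0 := by
      refine derivation_eq_zero_of_etale f hf fun a => ?_
      have h := congrArg (KaehlerDifferential.map ℂ ℂ A B) (c.d_eq a)
      simp only [map_sum, map_smul, KaehlerDifferential.map_D] at h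
      change KaehlerDifferential.D ℂ B (f a) - L (KaehlerDifferential.D ℂ B (f a)) = 0
      rw [hL, sub_eq_zero]
      refine Eq.trans h (Finset.sum_congr rfl fun i _ => ?_)
      rw [extendDer_apply]
      rfl
    have h := congrArg (fun δ : Derivation ℂ B Ω[B⁄ℂ] => δ b) h0
    rw [← hL, ← sub_eq_zero]
    exact h

end QuasiCoordinates

/-! ### The Euler field and nondegeneracy of the bracket. -/

section Euler

variable {A : Type} [CommRing A] [Algebra ℂ A]

theorem evalAt_zero_shiftOp_pow {V : Type} [Ring V] [Algebra ℂ V] (D : V →ₗ[ℂ] V) (n : ℕ)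
    (w : V[X]) : evalAt 0 ((shiftOp D ^ n) w) = D^[n] (evalAt 0 w) := by
  induction n with
  | zero => rw [pow_zero, Module.End.one_apply, Function.iterate_zero_apply]
  | succ n ih =>
    rw [pow_succ', Module.End.mul_apply, evalAt_shiftOp, zero_smul, zero_add, ih,
      Function.iterate_succ_apply']

theorem evalAt_zero_arrow {V : Type} [Ring V] [Algebra ℂ V] (D : V →ₗ[ℂ] V) (w q : V[X]) :
    evalAt 0 (arrow D w q) = q.sum fun n v => D^[n] (evalAt 0 w) * v := by
  rw [arrow_eq_sum, Polynomial.sum, map_sum, Polynomial.sum]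
  exact Finset.sum_congr rfl fun n _ => by rw [evalAt_mul_C, evalAt_zero_shiftOp_pow]

/-- Integration by parts. -/
theorem evalAt_zero_arrow_sub_mem {V : Type} [Ring V] [Algebra ℂ V] {D : V →ₗ[ℂ] V}
    (hD : ∀ x y, D (x * y) = D x * y + x * D y) (z : V) (q : V[X]) :
    evalAt 0 (arrow D (C z) q) - z * evalAt 0 (negShift D q) ∈ LinearMap.range D := by
  induction q using poly_induction generalizing z with
  | hC v =>
    rw [arrow_C, evalAt_mul_C, evalAt_C, negShift_C, evalAt_C, sub_self]
    exact zero_mem _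
  | hadd q r hq hr =>
    rw [map_add, map_add, map_add, map_add, mul_add, add_sub_add_comm]
    exact add_mem (hq z) (hr z)
  | hX q hq =>
    have h : evalAt 0 (arrow D (shiftOp D (C z)) q) = evalAt 0 (arrow D (C (D z)) q) := by
      rw [evalAt_zero_arrow, evalAt_zero_arrow, evalAt_shiftOp, evalAt_C, evalAt_C, zero_smul,
        zero_add]
    rw [arrow_X_mul, h, evalAt_negShift_X_mul, zero_smul, zero_add, mul_neg, sub_neg_eq_add]
    -- The error for `λ q` and `z` is the error for `q` and `∂z` plus the total derivative of `z`
    -- times the value of `q` at `-∂`.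
    have h' := add_mem (hq (D z)) (LinearMap.mem_range_self D (z * evalAt 0 (negShift D q)))
    rw [hD] at h'
    convert h' using 1
    abel

theorem OddArc.odd_sum {M ι : Type} [AddCommGroup M] [Module A M] (s : Finset ι) (m : ι → M) :
    OddArc.odd A M (∑ i ∈ s, m i) = ∑ i ∈ s, OddArc.odd A M (m i) :=
  map_sum (AddMonoidHom.mk' (OddArc.odd A M) OddArc.odd_add) m s

theorem LamDer.sum {M ι : Type} [AddCommGroup M] [Module A M] {ε : ℕ} (s : Finset ι)
    {φ : ι → OddArc A M →ₗ[ℂ] (OddArc A M)[X]} (h : ∀ i, LamDer ε (φ i)) :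
    LamDer ε (∑ i ∈ s, φ i) := by
  classical
  induction s using Finset.induction_on with
  | empty => exact .zero
  | insert i s hi ih =>
    rw [Finset.sum_insert hi]
    exact (h i).add ih

/-- The vector fields of quasi-coordinates as odd functions. -/
def QuasiCoordinates.theta (c : QuasiCoordinates A) (i : Fin c.n) : ShiftedArc A :=
  OddArc.odd A _ (c.D i)

theorem QuasiCoordinates.odd_eq (c : QuasiCoordinates A) (E : Derivation ℂ A A) :
    OddArc.odd A _ E = ∑ i, OddArc.fn A _ (E (c.u i)) * c.theta i := by
  conv_lhs => rw [c.vectorField_eq E, OddArc.odd_sum]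
  exact Finset.sum_congr rfl fun i _ => OddArc.odd_smul _ _

/-- The Euler field counts degrees. -/
theorem QuasiCoordinates.euler (c : QuasiCoordinates A) {p : ℕ} {y : ShiftedArc A}
    (hy : y ∈ ShiftedArc.deg A p) :
    (p : ℂ) • y =
      ∑ i, evalAt 0 (arrow (ShiftedArc.d A) (C (c.theta i)) (fnBracket A (c.u i) y)) := by
  -- This is `∑ θ_i ∂/∂θ_i` on the arc space. At `λ = 0` it is an even derivation that commutes with
  -- `∂`, kills functions and fixes each `θ_E`, so it multiplies by the degree.
  set φ : ShiftedArc A →ₗ[ℂ] (ShiftedArc A)[X] :=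
    ∑ i, arrow (ShiftedArc.d A) (C (c.theta i)) ∘ₗ fnBracket A (c.u i) with hφ
  have hl : LamDer 0 φ := LamDer.sum _ fun i =>
    ((fnBracket_lamDer (c.u i)).arrow (OddArc.odd_mem_parity (c.D i))).congr (by norm_num)
  have hs : ∑ i, evalAt 0 (arrow (ShiftedArc.d A) (C (c.theta i)) (fnBracket A (c.u i) y)) =
      evalAt 0 (φ y) := by
    rw [hφ, LinearMap.sum_apply, map_sum]
    rfl
  rw [hs]
  refine OddArc.deg_induction (P := fun p y => (p : ℂ) • y = evalAt 0 (φ y))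
    (fun p x y hx hy => ?_) (fun p q x y _ _ hx hy => ?_) (fun p x _ hx => ?_) (fun a => ?_)
    (fun E => ?_) hy
  · rw [smul_add, hx, hy, map_add, map_add]
  · rw [hl.map_mul, map_add, evalAt_mul_C, evalAt_C_mul, ← hx, ← hy, pow_zero, AlgHom.one_apply,
      Nat.cast_add, add_smul, smul_mul_assoc, mul_smul_comm]
  · rw [hl.map_d, evalAt_shiftOp, zero_smul, zero_add, ← hx, map_smul]
  · rw [Nat.cast_zero, zero_smul, hφ, LinearMap.sum_apply, map_sum]
    refine (Finset.sum_eq_zero fun i _ => ?_).symm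
    rw [LinearMap.comp_apply, fnBracket_fn, map_zero, map_zero]
  · rw [Nat.cast_one, one_smul, hφ, LinearMap.sum_apply, map_sum]
    refine (c.odd_eq E).trans (Finset.sum_congr rfl fun i _ => ?_)
    rw [LinearMap.comp_apply, fnBracket_odd, arrow_C, evalAt_mul_C, evalAt_C, OddArc.fn_commutes]

/-- The Euler formula rebuilds `p y` from the brackets of `y` with the `u^i`, and `p` is invertible.
-/
theorem QuasiCoordinates.eq_zero (c : QuasiCoordinates A) {p : ℕ} (hp : p ≠ 0) {y : ShiftedArc A}
    (hy : y ∈ ShiftedArc.deg A p) (h : ∀ a, fnBracket A a y = 0) : y = 0 := by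
  have h' := c.euler hy
  rw [Finset.sum_eq_zero fun i _ => by rw [h, map_zero, map_zero]] at h'
  exact (smul_eq_zero.1 h').resolve_left (Nat.cast_ne_zero.2 hp)

/-- `∂` is injective in positive degrees. -/
theorem QuasiCoordinates.eq_zero_of_d (c : QuasiCoordinates A) {p : ℕ} (hp : p ≠ 0)
    {y : ShiftedArc A} (hy : y ∈ ShiftedArc.deg A p) (h : ShiftedArc.d A y = 0) : y = 0 := by
  -- `{a_λ ∂y} = (λ+∂){a_λ y}`, and `λ+∂` is injective on polynomials.
  refine c.eq_zero hp hy fun a => eq_zero_of_shiftOp_eq_zero (ShiftedArc.d A) ?_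
  rw [← (fnBracket_lamDer a).map_d, h, map_zero]

/-- The Euler formula in terms of variational derivatives. -/
theorem QuasiCoordinates.euler_functional (c : QuasiCoordinates A) {p : ℕ} {y : ShiftedArc A}
    (hy : y ∈ ShiftedArc.deg A p) :
    (p : ℂ) • y - (-1 : ℂ) ^ p • ∑ i, c.theta i * brAt A 0 y (OddArc.fn A _ (c.u i)) ∈
      LinearMap.range (ShiftedArc.d A) := by
  rw [c.euler hy, Finset.smul_sum, ← Finset.sum_sub_distrib]
  refine Submodule.sum_mem _ fun i _ => ?_
  rw [brAt_apply, schoutenBracket_apply_fn (deg_le_parity hy), map_smul, mul_smul_comm, smul_smul,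
    sign_mul_self, one_smul]
  exact evalAt_zero_arrow_sub_mem OddArc.d_mul _ _

/-- The component of degree `p`. -/
def degPart (p : ℕ) (y : ShiftedArc A) : ShiftedArc A :=
  GradedRing.proj (fun i : ℕ => ⋀[Arc A]^i (ArcMod A (Derivation ℂ A A))) p y

theorem degPart_mem (p : ℕ) (y : ShiftedArc A) : degPart p y ∈ ShiftedArc.deg A p :=
  SetLike.coe_mem _

theorem degPart_of_mem {p : ℕ} {y : ShiftedArc A} (hy : y ∈ ShiftedArc.deg A p) :
    degPart p y = y :=
  DirectSum.decompose_of_mem_same (fun i : ℕ => ⋀[Arc A]^i (ArcMod A (Derivation ℂ A A))) hy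

theorem degPart_of_mem_ne {p q : ℕ} (h : q ≠ p) {y : ShiftedArc A} (hy : y ∈ ShiftedArc.deg A q) :
    degPart p y = 0 :=
  DirectSum.decompose_of_mem_ne (fun i : ℕ => ⋀[Arc A]^i (ArcMod A (Derivation ℂ A A))) hy h

theorem degPart_add (p : ℕ) (x y : ShiftedArc A) :
    degPart p (x + y) = degPart p x + degPart p y := map_add _ x y

theorem degPart_d (p : ℕ) (y : ShiftedArc A) :
    degPart p (ShiftedArc.d A y) = ShiftedArc.d A (degPart p y) := by
  refine sum_homogeneous_induction
    (P := fun y => degPart p (ShiftedArc.d A y) = ShiftedArc.d A (degPart p y))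
    (fun x y hx hy => ?_) (fun q y hy => ?_) y
  · rw [map_add, degPart_add, degPart_add, hx, hy, map_add]
  · by_cases hpq : q = p
    · subst hpq
      rw [degPart_of_mem (OddArc.d_mem_deg hy), degPart_of_mem hy]
    · rw [degPart_of_mem_ne hpq (OddArc.d_mem_deg hy), degPart_of_mem_ne hpq hy, map_zero]

/-- Since `∂` preserves degrees, a primitive may be replaced by its component of degree `p`. -/
theorem exists_mem_deg_of_mem_range_d {p : ℕ} {x : ShiftedArc A} (hx : x ∈ ShiftedArc.deg A p)
    (h : x ∈ LinearMap.range (ShiftedArc.d A)) :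
    ∃ y ∈ ShiftedArc.deg A p, ShiftedArc.d A y = x := by
  obtain ⟨y, rfl⟩ := h
  exact ⟨degPart p y, degPart_mem p y, by rw [← degPart_d, degPart_of_mem hx]⟩

end Euler

/-! ### The derived bracket of an element of degree two. -/

section Derived

variable {A : Type} [CommRing A] [Algebra ℂ A]

theorem evalAt_map {V W : Type} [Ring V] [Algebra ℂ V] [Ring W] [Algebra ℂ W] {F : V →+* W}
    (hF : ∀ (c : ℂ) x, F (c • x) = c • F x) (z : ℂ) (q : V[X]) :
    evalAt z (q.map F) = F (evalAt z q) := by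
  induction q using poly_induction with
  | hC v => rw [map_C, evalAt_C, evalAt_C]
  | hadd q r hq hr => rw [Polynomial.map_add, map_add, hq, hr, map_add, map_add]
  | hX q hq => rw [Polynomial.map_mul, map_X, evalAt_X_mul, evalAt_X_mul, hq, hF]

theorem arrow_map {V W : Type} [Ring V] [Algebra ℂ V] [Ring W] [Algebra ℂ W] {D : V →ₗ[ℂ] V}
    {D' : W →ₗ[ℂ] W} {F : V →+* W} (hF : ∀ x, F (D x) = D' (F x)) (w q : V[X]) :
    (arrow D w q).map F = arrow D' (w.map F) (q.map F) := by
  induction q using poly_induction generalizing w with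
  | hC v => rw [arrow_C, Polynomial.map_mul, map_C, arrow_C]
  | hadd q r hq hr => rw [map_add, Polynomial.map_add, hq, hr, Polynomial.map_add, map_add]
  | hX q hq => rw [arrow_X_mul, hq, Polynomial.map_mul, map_X, arrow_X_mul, shiftOp_map hF]

variable (A) in
/-- The inclusion of functions on the arc space, as a linear map. -/
def fnLin : Arc A →ₗ[ℂ] ShiftedArc A where
  toFun := ShiftedArc.fn A
  map_add' := map_add _
  map_smul' c x := by
    rw [RingHom.id_apply, extAlg_smul_def, Algebra.smul_def, map_mul]

theorem fn_csmul (c : ℂ) (x : Arc A) : ShiftedArc.fn A (c • x) = c • ShiftedArc.fn A x :=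
  map_smul (fnLin A) c x

theorem fn_d (x : Arc A) :
    ShiftedArc.fn A ((Arc.d A : Arc A →ₗ[ℂ] Arc A) x) = ShiftedArc.d A (ShiftedArc.fn A x) :=
  (OddArc.d_algebraMap x).symm

theorem arcFn_mem (x : Arc A) : ShiftedArc.fn A x ∈ ShiftedArc.deg A 0 := algebraMap_mem_deg x

theorem fn_injective : Function.Injective (ShiftedArc.fn A) :=
  (ExteriorAlgebra.algebraMap_leftInverse (ArcMod A (Derivation ℂ A A))).injective

theorem map_fn_injective : Function.Injective (Polynomial.map (ShiftedArc.fn A)) :=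
  Polynomial.map_injective _ fn_injective

variable (A) in
/-- The projection to degree zero, coefficientwise. -/
def toArcPoly : (ShiftedArc A)[X] →ₗ[ℂ] (Arc A)[X] where
  toFun q := q.map
    (ExteriorAlgebra.algebraMapInv : ShiftedArc A →ₐ[Arc A] Arc A).toRingHom
  map_add' _ _ := Polynomial.map_add _
  map_smul' c q := smul_map (fun c x => by
    rw [extAlg_smul_def, map_mul, AlgHom.toRingHom_eq_coe, RingHom.coe_coe, AlgHom.commutes,
      Algebra.smul_def]
    rfl) c q

theorem map_fn_toArcPoly {q : (ShiftedArc A)[X]} (hq : q ∈ polyIn (ShiftedArc.deg A 0)) :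
    (toArcPoly A q).map (ShiftedArc.fn A) = q := by
  ext n
  obtain ⟨r, hr⟩ := mem_deg_zero (hq n)
  change ((q.map _).map _).coeff n = _
  rw [coeff_map, coeff_map, ← hr]
  change algebraMap _ _ (ExteriorAlgebra.algebraMapInv (algebraMap _ _ r)) = _
  rw [ExteriorAlgebra.algebraMap_leftInverse]

/-- The derived bracket `{a_λ {P_0 b}}`. -/
def derivedBracket (P : ShiftedArc A) : LambdaBracket (Arc A) :=
  (((schoutenBracket A).compl₁₂ (fnLin A) (brAt A 0 P ∘ₗ fnLin A))).compr₂ (toArcPoly A)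

theorem derivedBracket_apply (P : ShiftedArc A) (a b : Arc A) :
    derivedBracket P a b = toArcPoly A
      (schoutenBracket A (ShiftedArc.fn A a) (brAt A 0 P (ShiftedArc.fn A b))) := rfl

theorem brAt_zero_mem {P : ShiftedArc A} (hP : P ∈ ShiftedArc.deg A 2)
    {x : ShiftedArc A} {p : ℕ} (hx : x ∈ ShiftedArc.deg A p) :
    brAt A 0 P x ∈ ShiftedArc.deg A (p + 1) := by
  have h := brAt_mem_predDeg hP hx 0
  rw [show 2 + p = p + 1 + 1 by omega] at h
  exact h

theorem brAt_fn_mem (z : ℂ) (a : Arc A) {x : ShiftedArc A} {p : ℕ}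
    (hx : x ∈ ShiftedArc.deg A (p + 1)) :
    brAt A z (ShiftedArc.fn A a) x ∈ ShiftedArc.deg A p := by
  have h := brAt_mem_predDeg (arcFn_mem a) hx z
  rw [zero_add] at h
  exact h

theorem schoutenBracket_deg_zero {x y : ShiftedArc A} (hx : x ∈ ShiftedArc.deg A 0)
    (hy : y ∈ ShiftedArc.deg A 0) : schoutenBracket A x y = 0 := (schouten A).degree_zero x hx y hy

/-- `{P_0 b}` has degree 1, so its bracket with a function has degree 0 and the projection loses
nothing. As functions embed in the larger algebra, identities for the derived bracket can be
verified there. -/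
theorem map_fn_derivedBracket {P : ShiftedArc A} (hP : P ∈ ShiftedArc.deg A 2)
    (a b : Arc A) : (derivedBracket P a b).map (ShiftedArc.fn A) =
    schoutenBracket A (ShiftedArc.fn A a) (brAt A 0 P (ShiftedArc.fn A b)) := by
  rw [derivedBracket_apply]
  refine map_fn_toArcPoly ?_
  have h := schoutenBracket_mem_predDeg (arcFn_mem a) (brAt_zero_mem hP (arcFn_mem b))
  exact h

theorem fn_evalAt_derivedBracket {P : ShiftedArc A} (hP : P ∈ ShiftedArc.deg A 2)
    (z : ℂ) (a b : Arc A) :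
    ShiftedArc.fn A (evalAt z (derivedBracket P a b)) =
      brAt A z (ShiftedArc.fn A a) (brAt A 0 P (ShiftedArc.fn A b)) := by
  rw [← evalAt_map fn_csmul, map_fn_derivedBracket hP]
  rfl

/-- The Jacobi identity for `P, x, y`, in which `{x_w y}` vanishes for reasons of degree.
Skew-symmetry of the derived bracket rests on it. -/
theorem brAt_brAt_zero {P : ShiftedArc A} (hP : P ∈ ShiftedArc.deg A 2)
    {x y : ShiftedArc A} (hx : x ∈ ShiftedArc.deg A 0)
    (hy : y ∈ ShiftedArc.deg A 0) (w : ℂ) :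
    brAt A w (brAt A 0 P x) y = brAt A w x (brAt A 0 P y) := by
  have h := jacobiAt hP hx y 0 w
  rw [brAt_apply w x y, schoutenBracket_deg_zero hx hy, map_zero, map_zero, zero_add,
    show ((-1 : ℂ) ^ ((2 + 1) * (0 + 1))) = -1 by norm_num, neg_one_smul] at h
  exact eq_of_sub_eq_zero (by rw [sub_eq_add_neg, ← h])

theorem derivedBracket_skew {P : ShiftedArc A} (hP : P ∈ ShiftedArc.deg A 2) (a b : Arc A) :
    derivedBracket P b a =
      -negShift (Arc.d A : Arc A →ₗ[ℂ] Arc A) (derivedBracket P a b) := by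
  apply map_fn_injective
  have h : schoutenBracket A (brAt A 0 P (ShiftedArc.fn A b)) (ShiftedArc.fn A a) =
      schoutenBracket A (ShiftedArc.fn A b) (brAt A 0 P (ShiftedArc.fn A a)) :=
    poly_ext_evalAt fun w => brAt_brAt_zero hP (arcFn_mem b) (arcFn_mem a) w
  have h' := schoutenBracket_skew (arcFn_mem a) (brAt_zero_mem hP (arcFn_mem b))
  rw [show ((-1 : ℂ) ^ ((0 + 1 + 1) * (0 + 1))) = 1 by norm_num, one_smul] at h'
  rw [map_fn_derivedBracket hP, Polynomial.map_neg, negShift_map fn_d, map_fn_derivedBracket hP,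
    ← h, h']

theorem derivedBracket_leibniz {P : ShiftedArc A} (hP : P ∈ ShiftedArc.deg A 2) (a b c : Arc A) :
    derivedBracket P a (b * c) =
      derivedBracket P a b * C c + C b * derivedBracket P a c := by
  apply map_fn_injective
  have hb := deg_le_parity (arcFn_mem b)
  have ha := schoutenBracket_lamDer (deg_le_parity (arcFn_mem a))
  have hσ : ∀ n : ℕ, (sigma ^ n) (ShiftedArc.fn A b) = ShiftedArc.fn A b := fun n => by
    rw [sigma_pow_of_mem hb, mul_zero, pow_zero, one_smul]
  have h₁ := brAt_mul (deg_le_parity hP) 0 (ShiftedArc.fn A b) (ShiftedArc.fn A c)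
  rw [hσ] at h₁
  have h₂ := ha.map_mul (brAt A 0 P (ShiftedArc.fn A b)) (ShiftedArc.fn A c)
  rw [schoutenBracket_deg_zero (arcFn_mem a) (arcFn_mem c), mul_zero, add_zero] at h₂
  have h₃ := ha.map_mul (ShiftedArc.fn A b) (brAt A 0 P (ShiftedArc.fn A c))
  rw [schoutenBracket_deg_zero (arcFn_mem a) (arcFn_mem b), zero_mul, zero_add, hσ] at h₃
  rw [map_fn_derivedBracket hP, Polynomial.map_add, Polynomial.map_mul, Polynomial.map_mul,
    map_C, map_C, map_fn_derivedBracket hP, map_fn_derivedBracket hP, map_mul, h₁, map_add, h₂,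
    h₃]

theorem derivedBracket_isSkewLeibniz {P : ShiftedArc A} (hP : P ∈ ShiftedArc.deg A 2) :
    IsSkewLeibniz (Arc.d A : Arc A →ₗ[ℂ] Arc A) (derivedBracket P) where
  left a b := by
    apply map_fn_injective
    rw [map_fn_derivedBracket hP, fn_d, schoutenBracket_d, Polynomial.map_neg, Polynomial.map_mul,
      map_X, map_fn_derivedBracket hP]
  right a b := by
    apply map_fn_injective
    rw [map_fn_derivedBracket hP, fn_d, brAt_d_right, zero_smul, zero_add,
      schoutenBracket_d_right, shiftOp_apply, Polynomial.map_add, Polynomial.map_mul, map_X,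
      coeffMap_map fn_d, map_fn_derivedBracket hP]
  skew := derivedBracket_skew hP
  leibniz := derivedBracket_leibniz hP

/-- The Jacobiator of the derived bracket. -/
theorem derivedBracket_jacobiator {P : ShiftedArc A} (hP : P ∈ ShiftedArc.deg A 2)
    (z w : ℂ) (a b c : Arc A) :
    ShiftedArc.fn A (evalAt z (derivedBracket P a (evalAt w (derivedBracket P b c)))) =
      ShiftedArc.fn A (evalAt (z + w) (derivedBracket P (evalAt z (derivedBracket P a b)) c)) +
      ShiftedArc.fn A (evalAt w (derivedBracket P b (evalAt z (derivedBracket P a c)))) -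
      brAt A z (ShiftedArc.fn A a) (brAt A w (ShiftedArc.fn A b)
        (brAt A 0 P (brAt A 0 P (ShiftedArc.fn A c)))) := by
  have hb := brAt_zero_mem hP (arcFn_mem b)
  have hc := brAt_zero_mem hP (arcFn_mem c)
  -- `h₁` moves `P` past `b` and creates the term with `{P_0 {P_0 c}}`; `h₂` is the Jacobi identity
  -- for `a` and `{P_0 b}`; `h₃` moves `P` from `b` to `{a_z {P_0 c}}`.
  have h₁ := jacobiAt hP (arcFn_mem b) (brAt A 0 P (ShiftedArc.fn A c)) 0 w
  have h₂ := jacobiAt (arcFn_mem a) hb (brAt A 0 P (ShiftedArc.fn A c)) z w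
  have h₃ := brAt_brAt_zero hP (arcFn_mem b) (brAt_fn_mem z a hc) w
  rw [zero_add, show ((-1 : ℂ) ^ ((2 + 1) * (0 + 1))) = -1 by norm_num, neg_one_smul,
    ← sub_eq_add_neg] at h₁
  rw [show ((-1 : ℂ) ^ ((0 + 1) * (0 + 1 + 1))) = 1 by norm_num, one_smul, h₃] at h₂
  rw [fn_evalAt_derivedBracket hP, fn_evalAt_derivedBracket hP, fn_evalAt_derivedBracket hP,
    fn_evalAt_derivedBracket hP, fn_evalAt_derivedBracket hP, fn_evalAt_derivedBracket hP, h₁,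
    map_sub, h₂]

theorem QuasiCoordinates.eq_zero_of_brAt (c : QuasiCoordinates A) {p : ℕ} {y : ShiftedArc A}
    (hy : y ∈ ShiftedArc.deg A (p + 1)) (h : ∀ z a, brAt A z (OddArc.fn A _ a) y = 0) : y = 0 :=
  c.eq_zero p.succ_ne_zero hy fun a => eq_zero_of_evalAt fun z => by
    rw [← schoutenBracket_fn]
    exact h z a

/-- The Jacobiator contracts the degree 2 element `{P_0 {P_0 c}}` with `a` and `b`. Nondegeneracy,
used in degree 2 and then in degree 1, recovers this element from its contractions. -/
theorem derivedBracket_isPVA_iff {P : ShiftedArc A} (hP : P ∈ ShiftedArc.deg A 2)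
    (q : QuasiCoordinates A) :
    IsPVA (Arc.d A : Arc A →ₗ[ℂ] Arc A) (derivedBracket P) ↔
      ∀ c : Arc A, brAt A 0 P (brAt A 0 P (ShiftedArc.fn A c)) = 0 := by
  have hj : ∀ a b c, jacobiLeft (derivedBracket P) a b c =
      jacobiMid (derivedBracket P) a b c + jacobiRight (derivedBracket P) a b c ↔
      ∀ z w, brAt A z (ShiftedArc.fn A a) (brAt A w (ShiftedArc.fn A b)
        (brAt A 0 P (brAt A 0 P (ShiftedArc.fn A c)))) = 0 := fun a b c => by
    have h := jacobi_iff (derivedBracket P) 1 a b c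
    simp only [one_smul] at h
    rw [h]
    refine forall_congr' fun z => forall_congr' fun w => ?_
    rw [← fn_injective.eq_iff, derivedBracket_jacobiator hP, map_add, sub_eq_self]
  constructor
  · intro h c
    have hc := brAt_zero_mem hP (brAt_zero_mem hP (arcFn_mem c))
    refine q.eq_zero_of_brAt hc fun w b => q.eq_zero_of_brAt (brAt_fn_mem w _ hc) fun z a => ?_
    exact (hj (Arc.of A a) (Arc.of A b) c).1 (h.jacobi _ _ _) z w
  · intro h
    exact ⟨derivedBracket_isSkewLeibniz hP, fun a b c => (hj a b c).2 fun z w => by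
      rw [h, map_zero, map_zero]⟩

/-- By the Jacobi identity `{{P_0 P}_0 c} = 2{P_0 {P_0 c}}`. If this vanishes, the Euler formula in
degree 3 makes `{P_0 P}` a total derivative; conversely `{(∂R)_0 c} = 0` for every `R`. -/
theorem derivedBracket_isPVA_iff_integral {P : ShiftedArc A} (hP : P ∈ ShiftedArc.deg A 2)
    (q : QuasiCoordinates A) :
    IsPVA (Arc.d A : Arc A →ₗ[ℂ] Arc A) (derivedBracket P) ↔
      integral (ShiftedArc.d A) (brAt A 0 P P) = 0 := by
  rw [derivedBracket_isPVA_iff hP q]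
  have hQ : ∀ c : Arc A, brAt A 0 (brAt A 0 P P) (ShiftedArc.fn A c) =
      (2 : ℂ) • brAt A 0 P (brAt A 0 P (ShiftedArc.fn A c)) := fun c => by
    have h := jacobiAt hP hP (ShiftedArc.fn A c) 0 0
    rw [zero_add, show ((-1 : ℂ) ^ ((2 + 1) * (2 + 1))) = -1 by norm_num, neg_one_smul,
      ← sub_eq_add_neg, eq_sub_iff_add_eq] at h
    rw [← h, two_smul]
  have hQ3 : brAt A 0 P P ∈ ShiftedArc.deg A 3 := brAt_zero_mem hP hP
  rw [Submodule.mkQ_apply, Submodule.Quotient.mk_eq_zero]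
  constructor
  · intro h
    have h' := q.euler_functional hQ3
    rw [Finset.sum_eq_zero fun i _ => by
      rw [OddArc.fn, hQ, h, smul_zero, mul_zero], smul_zero, sub_zero] at h'
    have h3 := Submodule.smul_mem _ ((3 : ℂ)⁻¹) h'
    rwa [smul_smul, Nat.cast_ofNat, inv_mul_cancel₀ (by norm_num), one_smul] at h3
  · rintro ⟨R, hR⟩ c
    have h := hQ c
    rw [← hR, brAt_d_left, zero_smul, neg_zero] at h
    exact (smul_eq_zero.1 h.symm).resolve_left two_ne_zero

theorem functionalBracket_integral (P : ShiftedArc A) :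
    (schouten A).functionalBracket (integral (ShiftedArc.d A) P) (integral (ShiftedArc.d A) P) =
      integral (ShiftedArc.d A) (brAt A 0 P P) := by
  rw [brAt_apply, evalAt_zero_eq_coeff]
  rfl

theorem derivedBracket_add (P Q : ShiftedArc A) :
    derivedBracket (P + Q) = derivedBracket P + derivedBracket Q := by
  refine LinearMap.ext₂ fun a b => ?_
  rw [LinearMap.add_apply, LinearMap.add_apply, derivedBracket_apply, derivedBracket_apply,
    derivedBracket_apply, map_add, LinearMap.add_apply, map_add, map_add]

theorem derivedBracket_d (P : ShiftedArc A) : derivedBracket (ShiftedArc.d A P) = 0 := by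
  refine LinearMap.ext₂ fun a b => ?_
  rw [derivedBracket_apply, brAt_d_left, zero_smul, neg_zero, map_zero, map_zero]
  rfl

theorem derivedBracket_eq_of_integral_eq {P Q : ShiftedArc A}
    (h : integral (ShiftedArc.d A) P = integral (ShiftedArc.d A) Q) :
    derivedBracket P = derivedBracket Q := by
  obtain ⟨R, hR⟩ := (Submodule.Quotient.eq _).1 h
  rw [← sub_add_cancel P Q, ← hR, derivedBracket_add, derivedBracket_d, zero_add]

/-- The kernel of the derived bracket construction consists of total derivatives. -/
theorem exists_eq_d_of_derivedBracket_eq_zero {P : ShiftedArc A} (hP : P ∈ ShiftedArc.deg A 2)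
    (q : QuasiCoordinates A)
    (h : derivedBracket P = 0) : ∃ Q ∈ ShiftedArc.deg A 2, ShiftedArc.d A Q = P := by
  refine exists_mem_deg_of_mem_range_d hP ?_
  -- All brackets of functions with the degree 1 element `{P_0 b}` vanish. The Euler formula in
  -- degree 2 then shows that `P` is a total derivative.
  have h0 : ∀ b : A, brAt A 0 P (OddArc.fn A _ b) = 0 := fun b =>
    q.eq_zero_of_brAt (brAt_zero_mem hP (arcFn_mem _)) fun z a => by
      refine (fn_evalAt_derivedBracket hP z (Arc.of A a) (Arc.of A b)).symm.trans ?_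
      rw [h, LinearMap.zero_apply, LinearMap.zero_apply, map_zero, map_zero]
  have h' := q.euler_functional hP
  rw [Finset.sum_eq_zero fun i _ => by rw [h0, mul_zero], smul_zero, sub_zero] at h'
  have h2 := Submodule.smul_mem _ ((2 : ℂ)⁻¹) h'
  rwa [smul_smul, Nat.cast_ofNat, inv_mul_cancel₀ (by norm_num), one_smul] at h2

end Derived

/-! ### The density of a bracket. -/

section Density

variable {A : Type} [CommRing A] [Algebra ℂ A] {B : LambdaBracket (Arc A)}

/-- The chain rule: `a ↦ {b_λ a}` is a derivation of `A`, hence determined by its values on the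
`u^i`. Skew-symmetry gives the counterpart `IsSkewLeibniz.left_eq`. -/
theorem IsSkewLeibniz.right_eq (hB : IsSkewLeibniz (Arc.d A : Arc A →ₗ[ℂ] Arc A) B)
    (q : QuasiCoordinates A) (b : Arc A) (a : A) :
    B b (Arc.of A a) = ∑ i, C (Arc.of A (q.D i a)) * B b (Arc.of A (q.u i)) := by
  let _ : Module A (Arc A)[X] :=
    Module.compHom (Arc A)[X] ((C : Arc A →+* (Arc A)[X]).comp (Arc.of A : A →+* Arc A))
  have hs : ∀ (a : A) (x : (Arc A)[X]), a • x = C (Arc.of A a) * x := fun _ _ => rfl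
  have : IsScalarTower ℂ A (Arc A)[X] := ⟨fun c a x => by
    rw [hs, hs, map_smul, ← smul_C, smul_mul_assoc]⟩
  let δ : Derivation ℂ A (Arc A)[X] := Derivation.mk' (B b ∘ₗ (Arc.of A).toLinearMap)
    (fun x y => by
      rw [LinearMap.comp_apply, LinearMap.comp_apply, LinearMap.comp_apply,
        AlgHom.toLinearMap_apply,
        AlgHom.toLinearMap_apply, AlgHom.toLinearMap_apply, map_mul, hB.leibniz, hs, hs, mul_comm,
        add_comm])
  exact q.derivation_eq δ a

theorem Arc.d_mul (x y : Arc A) : (Arc.d A : Arc A →ₗ[ℂ] Arc A) (x * y) =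
    (Arc.d A : Arc A →ₗ[ℂ] Arc A) x * y + x * (Arc.d A : Arc A →ₗ[ℂ] Arc A) y := by
  refine ((Arc.d A).leibniz x y).trans ?_
  rw [smul_eq_mul, smul_eq_mul, mul_comm y, add_comm]
  rfl

theorem IsSkewLeibniz.left_eq (hB : IsSkewLeibniz (Arc.d A : Arc A →ₗ[ℂ] Arc A) B)
    (q : QuasiCoordinates A) (a : A) (b : Arc A) :
    B (Arc.of A a) b = ∑ i, arrow (Arc.d A : Arc A →ₗ[ℂ] Arc A) (C (Arc.of A (q.D i a)))
      (B (Arc.of A (q.u i)) b) := by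
  rw [hB.skew b, hB.right_eq q b a, map_sum, ← Finset.sum_neg_distrib]
  refine Finset.sum_congr rfl fun i _ => ?_
  rw [negShift_C_mul Arc.d_mul, hB.skew b (Arc.of A (q.u i)), map_neg]

/-- Brackets are determined by their values on functions. -/
theorem IsSkewLeibniz.ext_of {B' : LambdaBracket (Arc A)}
    (hB : IsSkewLeibniz (Arc.d A : Arc A →ₗ[ℂ] Arc A) B)
    (hB' : IsSkewLeibniz (Arc.d A : Arc A →ₗ[ℂ] Arc A) B')
    (h : ∀ a b : A, B (Arc.of A a) (Arc.of A b) = B' (Arc.of A a) (Arc.of A b)) : B = B' := by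
  have key : ∀ x, (∀ b, B x (Arc.of A b) = B' x (Arc.of A b)) → ∀ y, B x y = B' x y := by
    intro x hx y
    refine Arc.induction (P := fun y => B x y = B' x y) (fun y z hy hz => ?_)
      (fun y z hy hz => ?_) (fun y hy => ?_) hx y
    · rw [map_add, map_add, hy, hz]
    · rw [hB.leibniz, hB'.leibniz, hy, hz]
    · refine (hB.right x y).trans ?_
      rw [hy]
      exact (hB'.right x y).symm
  refine LinearMap.ext₂ fun x y => key x (fun b => ?_) y
  rw [hB.skew (Arc.of A b), hB'.skew (Arc.of A b), key (Arc.of A b) (h b)]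

theorem OddArc.iterate_d_mem_deg {M : Type} [AddCommGroup M] [Module A M] {p : ℕ}
    {x : OddArc A M} (hx : x ∈ OddArc.deg A M p) (n : ℕ) :
    (OddArc.d A M)^[n] x ∈ OddArc.deg A M p := by
  induction n with
  | zero => exact hx
  | succ n ih =>
    rw [Function.iterate_succ_apply']
    exact OddArc.d_mem_deg ih

/-- The odd function `∑ ∂ˢθ_i {u^i_λ b}_s`. -/
def QuasiCoordinates.field (q : QuasiCoordinates A) (B : LambdaBracket (Arc A)) (b : Arc A) :
    ShiftedArc A :=
  ∑ i, evalAt 0 (arrow (ShiftedArc.d A) (C (q.theta i))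
    ((B (Arc.of A (q.u i)) b).map (ShiftedArc.fn A)))

/-- The density `½ ∑ θ_i ∂ˢθ_j {u^j_λ u^i}_s`. -/
def QuasiCoordinates.density (q : QuasiCoordinates A) (B : LambdaBracket (Arc A)) :
    ShiftedArc A :=
  (1 / 2 : ℂ) • ∑ i, q.theta i * q.field B (Arc.of A (q.u i))

theorem QuasiCoordinates.theta_mem (q : QuasiCoordinates A) (i : Fin q.n) :
    q.theta i ∈ ShiftedArc.deg A 1 := OddArc.odd_mem _

theorem QuasiCoordinates.field_mem (q : QuasiCoordinates A) (b : Arc A) :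
    q.field B b ∈ ShiftedArc.deg A 1 := by
  refine Submodule.sum_mem _ fun i _ => ?_
  rw [evalAt_zero_arrow, evalAt_C]
  refine Submodule.sum_mem _ fun n _ => ?_
  rw [coeff_map]
  have h := mul_mem_deg (OddArc.iterate_d_mem_deg (q.theta_mem i) n)
    (arcFn_mem ((B (Arc.of A (q.u i)) b).coeff n))
  exact h

theorem QuasiCoordinates.density_mem (q : QuasiCoordinates A) :
    q.density B ∈ ShiftedArc.deg A 2 :=
  Submodule.smul_mem _ _ (Submodule.sum_mem _ fun i _ =>
    mul_mem_deg (q.theta_mem i) (q.field_mem _))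

theorem fnBracket_arcFn (a : A) (b : Arc A) : fnBracket A a (ShiftedArc.fn A b) = 0 := by
  rw [← schoutenBracket_fn]
  exact schoutenBracket_deg_zero (OddArc.fn_mem a) (arcFn_mem b)

theorem fnBracket_evalAt_arrow (a : A) (y : ShiftedArc A) (r : (Arc A)[X]) :
    fnBracket A a (evalAt 0 (arrow (ShiftedArc.d A) (C y) (r.map (ShiftedArc.fn A)))) =
      arrow (ShiftedArc.d A) (fnBracket A a y) (r.map (ShiftedArc.fn A)) := by
  induction r using poly_induction generalizing y with
  | hC v =>
    rw [map_C, arrow_C, evalAt_mul_C, evalAt_C, arrow_C, (fnBracket_lamDer a).map_mul,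
      fnBracket_arcFn, mul_zero, add_zero]
  | hadd r s hr hs => rw [Polynomial.map_add, map_add, map_add, map_add, hr, hs, map_add]
  | hX r hr =>
    have h : evalAt 0 (arrow (ShiftedArc.d A) (shiftOp (ShiftedArc.d A) (C y))
        (r.map (ShiftedArc.fn A))) =
        evalAt 0 (arrow (ShiftedArc.d A) (C (ShiftedArc.d A y)) (r.map (ShiftedArc.fn A))) := by
      rw [evalAt_zero_arrow, evalAt_zero_arrow, evalAt_shiftOp, evalAt_C, evalAt_C, zero_smul,
        zero_add]
    rw [Polynomial.map_mul, map_X, arrow_X_mul, arrow_X_mul, h, hr, (fnBracket_lamDer a).map_d]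

/-- The field plays the role of the Hamiltonian vector field of `b`. Contracting it with `a`
replaces `θ_i` by `D_i(a)`, which is the chain rule in the first argument. -/
theorem QuasiCoordinates.fnBracket_field (q : QuasiCoordinates A)
    (hB : IsSkewLeibniz (Arc.d A : Arc A →ₗ[ℂ] Arc A) B) (a : A) (b : Arc A) :
    fnBracket A a (q.field B b) = (B (Arc.of A a) b).map (ShiftedArc.fn A) := by
  rw [hB.left_eq q a b, Polynomial.map_sum, QuasiCoordinates.field, map_sum]
  refine Finset.sum_congr rfl fun i _ => ?_
  rw [fnBracket_evalAt_arrow, arrow_map fn_d, QuasiCoordinates.theta, fnBracket_odd, map_C]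
  rfl

theorem sigma_pow_fn (n : ℕ) (b : Arc A) :
    (sigma ^ n) (ShiftedArc.fn A b) = ShiftedArc.fn A b := by
  rw [sigma_pow_of_mem (deg_le_parity (arcFn_mem b)), mul_zero, pow_zero, one_smul]

theorem QuasiCoordinates.field_eq (q q' : QuasiCoordinates A)
    (hB : IsSkewLeibniz (Arc.d A : Arc A →ₗ[ℂ] Arc A) B) (b : A) :
    q.field B (Arc.of A b) =
      ∑ j, OddArc.fn A _ (q'.D j b) * q.field B (Arc.of A (q'.u j)) := by
  simp only [QuasiCoordinates.field, Finset.mul_sum]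
  rw [Finset.sum_comm]
  refine Finset.sum_congr rfl fun i _ => ?_
  rw [hB.right_eq q', Polynomial.map_sum, map_sum, map_sum]
  refine Finset.sum_congr rfl fun j _ => ?_
  rw [Polynomial.map_mul, map_C, arrow_C_mul (C_mem_polyIn (deg_le_parity (q.theta_mem i))),
    sigma_pow_fn, evalAt_C_mul]
  rfl

theorem QuasiCoordinates.fnBracket_density (q : QuasiCoordinates A)
    (hB : IsSkewLeibniz (Arc.d A : Arc A →ₗ[ℂ] Arc A) B) (b : A) :
    fnBracket A b (q.density B) = (1 / 2 : ℂ) • ∑ i,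
      (C (OddArc.fn A _ (q.D i b)) * C (q.field B (Arc.of A (q.u i))) -
        C (q.theta i) * (B (Arc.of A b) (Arc.of A (q.u i))).map (ShiftedArc.fn A)) := by
  rw [QuasiCoordinates.density, map_smul, map_sum]
  congr 1
  refine Finset.sum_congr rfl fun i _ => ?_
  rw [(fnBracket_lamDer b).map_mul, q.fnBracket_field hB,
    sigma_pow_of_mem (deg_le_parity (q.theta_mem i)), mul_one, pow_one, neg_one_smul, C_neg,
    neg_mul, ← sub_eq_add_neg]
  congr 2
  exact fnBracket_odd b (q.D i)

/-- Each of the two odd factors of the density contributes one copy of the field, the first by the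
chain rule and the second by skew-symmetry of `B`. The factor `1/2` compensates for this. -/
theorem QuasiCoordinates.brAt_density (q : QuasiCoordinates A)
    (hB : IsSkewLeibniz (Arc.d A : Arc A →ₗ[ℂ] Arc A) B) (b : A) :
    brAt A 0 (q.density B) (OddArc.fn A _ b) = q.field B (Arc.of A b) := by
  have h₁ : ∀ i, negShift (ShiftedArc.d A) ((B (Arc.of A b) (Arc.of A (q.u i))).map
      (ShiftedArc.fn A)) = -((B (Arc.of A (q.u i)) (Arc.of A b)).map (ShiftedArc.fn A)) :=
    fun i => by
      rw [hB.skew (Arc.of A b) (Arc.of A (q.u i)), Polynomial.map_neg, neg_neg, negShift_map fn_d]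
  rw [brAt_apply, schoutenBracket_apply_fn (deg_le_parity q.density_mem), q.fnBracket_density hB,
    map_smul, map_smul, map_smul, map_sum, map_sum]
  have h₂ : ∀ i, evalAt 0 (negShift (ShiftedArc.d A)
      (C (OddArc.fn A _ (q.D i b)) * C (q.field B (Arc.of A (q.u i))) -
        C (q.theta i) * (B (Arc.of A b) (Arc.of A (q.u i))).map (ShiftedArc.fn A))) =
      OddArc.fn A _ (q.D i b) * q.field B (Arc.of A (q.u i)) +
        evalAt 0 (arrow (ShiftedArc.d A) (C (q.theta i))
          ((B (Arc.of A (q.u i)) (Arc.of A b)).map (ShiftedArc.fn A))) := fun i => by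
    rw [map_sub, ← C_mul, negShift_C, negShift_C_mul OddArc.d_mul, h₁, map_neg, sub_neg_eq_add,
      map_add, evalAt_C]
  simp only [h₂]
  rw [Finset.sum_add_distrib, ← q.field_eq q hB b, even_two.neg_one_pow, one_smul]
  change (1 / 2 : ℂ) • (q.field B (Arc.of A b) + q.field B (Arc.of A b)) = _
  rw [← two_smul ℂ, smul_smul]
  norm_num

/-- Every bracket is the derived bracket of its density. -/
theorem QuasiCoordinates.derivedBracket_density (q : QuasiCoordinates A)
    (hB : IsSkewLeibniz (Arc.d A : Arc A →ₗ[ℂ] Arc A) B) : derivedBracket (q.density B) = B := by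
  refine (derivedBracket_isSkewLeibniz q.density_mem).ext_of hB fun a b => ?_
  apply map_fn_injective
  rw [map_fn_derivedBracket q.density_mem]
  refine Eq.trans ?_ (q.fnBracket_field hB a (Arc.of A b))
  rw [← q.brAt_density hB, ← schoutenBracket_fn]
  rfl

/-- The fields agree by nondegeneracy, because their brackets with functions are prescribed by `B`.
The rest is the change of frame `θ'_j = ∑ D'_j(u^i) θ_i` and the chain rule for the field. -/
theorem QuasiCoordinates.density_eq (q q' : QuasiCoordinates A)
    (hB : IsSkewLeibniz (Arc.d A : Arc A →ₗ[ℂ] Arc A) B) : q.density B = q'.density B := by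
  have hf : ∀ b, q.field B b = q'.field B b := fun b =>
    sub_eq_zero.1 (q.eq_zero one_ne_zero (sub_mem (q.field_mem b) (q'.field_mem b)) fun a => by
      rw [map_sub, q.fnBracket_field hB, q'.fnBracket_field hB, sub_self])
  have h : ∑ j, q'.theta j * q'.field B (Arc.of A (q'.u j)) =
      ∑ i, q.theta i * q.field B (Arc.of A (q.u i)) := by
    have h₁ : ∀ j, q'.theta j * q'.field B (Arc.of A (q'.u j)) =
        ∑ i, q.theta i * (OddArc.fn A _ (q'.D j (q.u i)) * q'.field B (Arc.of A (q'.u j))) :=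
      fun j => by
        conv_lhs => rw [QuasiCoordinates.theta, q.odd_eq, Finset.sum_mul]
        refine Finset.sum_congr rfl fun i _ => ?_
        rw [OddArc.fn_commutes, mul_assoc]
    simp only [h₁]
    rw [Finset.sum_comm]
    refine Finset.sum_congr rfl fun i _ => ?_
    rw [← Finset.mul_sum, ← q'.field_eq q' hB, hf]
  rw [QuasiCoordinates.density, QuasiCoordinates.density, h]

theorem sum_map_fn (r : (Arc A)[X]) (y : ShiftedArc A) :
    ((r.map (ShiftedArc.fn A)).sum fun n v => (ShiftedArc.d A)^[n] y * v) =
      r.sum fun n h => ShiftedArc.fn A h * (ShiftedArc.d A)^[n] y := by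
  induction r using Polynomial.induction_on' with
  | add r s hr hs =>
    rw [Polynomial.map_add, Polynomial.sum_add_index _ _ _ (by simp) (by simp [mul_add]), hr, hs,
      Polynomial.sum_add_index _ _ _ (by simp) (by simp [add_mul])]
  | monomial n v =>
    rw [Polynomial.map_monomial, sum_monomial_index _ _ (by simp), sum_monomial_index _ _ (by simp)]
    exact (Algebra.commutes v _).symm

theorem density_eq_toQuasi [Algebra.FormallySmooth ℂ A] (c : Coordinates A) :
    density c B = c.toQuasi.density B := by
  rw [density, QuasiCoordinates.density]
  congr 1
  refine Finset.sum_congr rfl fun α _ => ?_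
  rw [QuasiCoordinates.field, Finset.mul_sum]
  refine Finset.sum_congr rfl fun β _ => ?_
  rw [evalAt_zero_arrow, evalAt_C, sum_map_fn, Polynomial.sum, Polynomial.sum, Finset.mul_sum]
  rfl

/-- The Euler formula in degree 1 identifies the field of the derived bracket with `{P_0 b}`. The
density is then the right side of the functional Euler formula for `P`, divided by 2. -/
theorem QuasiCoordinates.integral_density_derivedBracket (q : QuasiCoordinates A)
    {P : ShiftedArc A} (hP : P ∈ ShiftedArc.deg A 2) :
    integral (ShiftedArc.d A) P = integral (ShiftedArc.d A) (q.density (derivedBracket P)) := by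
  have hf : ∀ b, q.field (derivedBracket P) b = brAt A 0 P (ShiftedArc.fn A b) := fun b => by
    have h := q.euler (brAt_zero_mem hP (arcFn_mem b))
    rw [zero_add, Nat.cast_one, one_smul] at h
    rw [h, QuasiCoordinates.field]
    refine Finset.sum_congr rfl fun i _ => ?_
    rw [map_fn_derivedBracket hP, ← schoutenBracket_fn]
    rfl
  have h := q.euler_functional hP
  rw [even_two.neg_one_pow, one_smul] at h
  refine (Submodule.Quotient.eq _).2 ?_
  have h2 := Submodule.smul_mem _ ((1 / 2 : ℂ)) h
  rw [smul_sub, smul_smul, Nat.cast_ofNat, one_div, inv_mul_cancel₀ (by norm_num), one_smul] at h2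
  rw [QuasiCoordinates.density, one_div]
  simp only [hf]
  exact h2

end Density

/-! ### Derived brackets and densities under restriction. -/

section Restriction

variable {A A' : Type} [CommRing A] [Algebra ℂ A] [CommRing A'] [Algebra ℂ A']
  (f : A →ₐ[ℂ] A') (hf : (f : A →+* A').Etale)

theorem ShiftedArc.map_comp_fn :
    (ShiftedArc.map f hf).comp (ShiftedArc.fn A) =
      (ShiftedArc.fn A').comp (Arc.map f : Arc A →+* Arc A') :=
  RingHom.ext fun r => ShiftedArc.map_algebraMap f hf r

theorem ShiftedArc.map_brAt (z : ℂ) (x y : ShiftedArc A) :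
    ShiftedArc.map f hf (brAt A z x y) =
      brAt A' z (ShiftedArc.map f hf x) (ShiftedArc.map f hf y) := by
  rw [brAt_apply, brAt_apply, ShiftedArc.map_schoutenBracket,
    evalAt_map (ShiftedArc.map_isDifferential f hf).map_smul]

theorem derivedBracket_map {P : ShiftedArc A} (hP : P ∈ ShiftedArc.deg A 2) (a b : Arc A) :
    derivedBracket (ShiftedArc.map f hf P) (Arc.map f a) (Arc.map f b) =
      (derivedBracket P a b).map (Arc.map f : Arc A →+* Arc A') := by
  apply map_fn_injective
  rw [map_fn_derivedBracket ((ShiftedArc.map_isDifferential f hf).map_mem hP),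
    Polynomial.map_map, ← ShiftedArc.map_comp_fn f hf, ← Polynomial.map_map,
    map_fn_derivedBracket hP, ← ShiftedArc.map_schoutenBracket, ShiftedArc.map_brAt,
    ShiftedArc.map_algebraMap, ShiftedArc.map_algebraMap]

theorem QuasiCoordinates.map_density (q : QuasiCoordinates A) {B : LambdaBracket (Arc A)}
    {B' : LambdaBracket (Arc A')} (h : ∀ a b, B' (Arc.map f a) (Arc.map f b) =
      (B a b).map (Arc.map f : Arc A →+* Arc A')) :
    ShiftedArc.map f hf (q.density B) = (q.restrict f hf).density B' := by
  have hd := ShiftedArc.map_isDifferential f hf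
  have hθ : ∀ i, ShiftedArc.map f hf (q.theta i) = (q.restrict f hf).theta i :=
    fun i => ShiftedArc.map_odd f hf (q.D i)
  have hfield : ∀ b, ShiftedArc.map f hf (q.field B b) =
      (q.restrict f hf).field B' (Arc.map f b) := fun b => by
    rw [QuasiCoordinates.field, map_sum, QuasiCoordinates.field]
    refine Finset.sum_congr rfl fun i _ => ?_
    rw [← evalAt_map hd.map_smul, arrow_map hd.map_d, map_C, hθ, Polynomial.map_map,
      ShiftedArc.map_comp_fn, ← Polynomial.map_map, ← h, Arc.map_of]
    rfl
  rw [QuasiCoordinates.density, hd.map_smul, map_sum, QuasiCoordinates.density]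
  congr 1
  refine Finset.sum_congr rfl fun i _ => ?_
  rw [map_mul, hθ, hfield, Arc.map_of]
  rfl

end Restriction

/-! ### Locality of functions on the arc space. -/

section Locality

variable {A : Type} [CommRing A] [Algebra ℂ A]

/-- The universal property of the arc algebra. -/
theorem Arc.exists_lift {S : Type} [CommRing S] [Algebra ℂ S] (δ : Derivation ℂ S S)
    (φ : A →ₐ[ℂ] S) : ∃ Φ : Arc A →ₐ[ℂ] S,
      (∀ a, Φ (Arc.of A a) = φ a) ∧ ∀ x, Φ (Arc.d A x) = δ (Φ x) := by
  let Ψ : MvPolynomial (A × ℕ) ℂ →ₐ[ℂ] S := MvPolynomial.aeval fun x => δ^[x.2] (φ x.1)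
  have hX : ∀ a n, Ψ (MvPolynomial.X (a, n)) = δ^[n] (φ a) := fun a n =>
    MvPolynomial.aeval_X _ _
  have hd : ∀ p, Ψ (freeD A p) = δ (Ψ p) := by
    intro p
    induction p using MvPolynomial.induction_on with
    | C c =>
      rw [← MvPolynomial.algebraMap_eq, Derivation.map_algebraMap, map_zero, AlgHom.commutes,
        Derivation.map_algebraMap]
    | add p q hp hq => simp only [map_add, hp, hq]
    | mul_X p x hp =>
      have hx : Ψ (freeD A (MvPolynomial.X x)) = δ (Ψ (MvPolynomial.X x)) := by
        rw [freeD, MvPolynomial.mkDerivation_X, hX, Function.iterate_succ_apply', ← hX]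
      simp only [Derivation.leibniz, smul_eq_mul, map_add, map_mul, hp, hx]
  have h0 : ∀ p ∈ arcIdeal A, Ψ p = 0 := by
    intro p hp
    suffices h : arcIdeal A ≤ RingHom.ker Ψ from h hp
    refine Ideal.span_le.2 ?_
    rintro _ ⟨n, g, hg, rfl⟩
    have hg0 : Ψ g = 0 := by
      have key : ∀ a, Ψ (MvPolynomial.X (a, 0)) = φ a := fun a => hX a 0
      cases hg <;> simp [key]
    have h : ∀ n : ℕ, Ψ ((freeD A)^[n] g) = 0 := by
      intro n
      induction n with
      | zero => exact hg0
      | succ n ih => rw [Function.iterate_succ_apply', hd, ih, map_zero]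
    exact h n
  refine ⟨Ideal.Quotient.liftₐ (arcIdeal A) Ψ h0, fun a => hX a 0, fun x => ?_⟩
  obtain ⟨p, rfl⟩ := Arc.mk_surjective A x
  rw [Arc.d_mk]
  exact hd p

/-- The localization of the arc algebra at `g` receives a map from the arc algebra of the
localization `A'`, compatibly with the maps from `Arc A`. An element that dies in the latter dies in
the former. -/
theorem exists_pow_mul_eq_zero {A' : Type} [CommRing A'] [Algebra ℂ A'] (f : A →ₐ[ℂ] A') (g : A)
    (hloc : letI := (f : A →+* A').toAlgebra; IsLocalization.Away g A') {x : Arc A}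
    (hx : Arc.map f x = 0) : ∃ n : ℕ, Arc.of A g ^ n * x = 0 := by
  let _ : Algebra A A' := (f : A →+* A').toAlgebra
  have : IsScalarTower ℂ A A' := IsScalarTower.of_algebraMap_eq fun c => (f.commutes c).symm
  have : IsLocalization.Away g A' := hloc
  let S := Localization.Away (Arc.of A g)
  let j : Arc A →ₐ[ℂ] S := IsScalarTower.toAlgHom ℂ (Arc A) S
  have hj : (j : Arc A →+* S).Etale :=
    RingHom.etale_algebraMap.2 (Algebra.Etale.of_isLocalizationAway (Arc.of A g))
  have hu : IsUnit ((j.comp (Arc.of A)) g) := IsLocalization.Away.algebraMap_isUnit (Arc.of A g)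
  -- Localization is étale, so `∂` extends to it. As `g` is invertible there, the map from `A`
  -- factors through `A'` and extends to arcs by the universal property.
  obtain ⟨Φ, hΦ, hΦd⟩ := Arc.exists_lift (extendDer j hj (Arc.d A))
    (IsLocalization.Away.liftAlgHom (S := A') g (f := j.comp (Arc.of A)) hu)
  have h : ∀ y, Φ (Arc.map f y) = j y := by
    refine Arc.induction (fun y z hy hz => ?_) (fun y z hy hz => ?_) (fun y hy => ?_) fun a => ?_
    · simp only [map_add, hy, hz]
    · simp only [map_mul, hy, hz]
    · rw [Arc.map_d, hΦd, hy, extendDer_apply]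
    · rw [Arc.map_of, hΦ]
      exact IsLocalization.Away.lift_eq (S := A') g hu a
  have hjx : algebraMap (Arc A) S x = 0 := by
    have h' := h x
    rw [hx, map_zero] at h'
    exact h'.symm
  obtain ⟨⟨_, n, rfl⟩, hm⟩ := (IsLocalization.map_eq_zero_iff (.powers (Arc.of A g)) S x).1 hjx
  exact ⟨n, hm⟩

/-- Functions on the arc space are determined by their restrictions to a cover. -/
theorem arc_eq_zero_of_cover {t : Set A} (ht : Ideal.span t = ⊤) {x : Arc A}
    (h : ∀ g ∈ t, ∃ n : ℕ, Arc.of A g ^ n * x = 0) : x = 0 := by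
  -- The annihilator of `x` in `A`. It contains a power of every element of `t`, so it is the unit
  -- ideal.
  let I : Ideal A := Ideal.comap (Arc.of A : A →+* Arc A)
    (LinearMap.ker (LinearMap.toSpanSingleton (Arc A) (Arc A) x))
  have hI : ∀ a, a ∈ I ↔ Arc.of A a * x = 0 := fun a => Iff.rfl
  have hle : Ideal.span t ≤ I.radical := by
    refine Ideal.span_le.2 fun g hg => ?_
    obtain ⟨n, hn⟩ := h g hg
    exact ⟨n, (hI _).2 (by rw [map_pow, hn])⟩
  rw [ht, top_le_iff, Ideal.radical_eq_top, Ideal.eq_top_iff_one, hI, map_one, one_mul] at hle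
  exact hle

end Locality

/-! ### Existence of coordinates on standard smooth algebras. -/

section Charts

variable {A : Type} [CommRing A] [Algebra ℂ A]

/-- The frame is the dual basis of a basis of exact differentials, under the identification of
vector fields with functionals on differentials. -/
theorem nonempty_coordinates_of_basis {n : ℕ} (b : Module.Basis (Fin n) A Ω[A⁄ℂ])
    (hb : Set.range b ⊆ Set.range (KaehlerDifferential.D ℂ A)) : Nonempty (Coordinates A) := by
  have hu : ∀ i, ∃ u, KaehlerDifferential.D ℂ A u = b i := fun i => hb ⟨i, rfl⟩
  choose u hu using hu
  refine ⟨⟨n, u, b.dualBasis.map (KaehlerDifferential.linearMapEquivDerivation ℂ A),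
    fun α β => ?_⟩⟩
  rw [Module.Basis.map_apply]
  change b.dualBasis α (KaehlerDifferential.D ℂ A (u β)) = _
  rw [hu, Module.Basis.dualBasis_apply_self]
  exact if_congr eq_comm rfl rfl

/-- Coordinates exist on standard smooth algebras. -/
theorem nonempty_coordinates [Algebra.IsStandardSmooth ℂ A] : Nonempty (Coordinates A) := by
  obtain ⟨-, I, b, hb⟩ :=
    Algebra.IsStandardSmooth.iff_exists_basis_kaehlerDifferential.1 ‹Algebra.IsStandardSmooth ℂ A›
  -- Over the zero ring a basis may have any index set, so finiteness cannot be deduced and the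
  -- empty coordinate system is taken.
  rcases subsingleton_or_nontrivial A with hA | hA
  · have : Subsingleton Ω[A⁄ℂ] := Module.subsingleton A _
    exact nonempty_coordinates_of_basis (n := 0) (Module.Basis.empty _)
      (by rintro _ ⟨i, -⟩; exact i.elim0)
  · have : Finite I := Module.Finite.finite_basis b
    exact nonempty_coordinates_of_basis (b.reindex (Finite.equivFin I))
      (by rw [Module.Basis.range_reindex]; exact hb)

end Charts

/-! ### Globalization over the scheme. -/

section Sheaves

open AlgebraicGeometry CategoryTheory

variable {X : Scheme.{0}} {s : X ⟶ Spec (CommRingCat.of ℂ)}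

theorem sec_smooth [Smooth s] (U : X.affineOpens) : Algebra.Smooth ℂ (Sec s U.1) := by
  refine RingHom.smooth_algebraMap.1 ?_
  have h₁ : ((Scheme.ΓSpecIso (CommRingCat.of ℂ)).inv.hom).Smooth :=
    .of_bijective (ConcreteCategory.bijective_of_isIso (Scheme.ΓSpecIso (CommRingCat.of ℂ)).inv)
  exact h₁.comp (Scheme.Hom.smooth_appLE s (isAffineOpen_top _) U.2 le_top)

theorem sec_res_isLocalization (U : X.affineOpens) (g : Sec s U.1) :
    letI := (Sec.res s (X.basicOpen_le (U := U.1) g) :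
      Sec s U.1 →+* Sec s (X.basicOpen (U := U.1) g)).toAlgebra
    IsLocalization.Away g (Sec s (X.basicOpen (U := U.1) g)) :=
  U.2.isLocalization_basicOpen g

variable (s) in
/-- The basic open subset of a function. -/
def basicAffine (U : X.affineOpens) (g : Sec s U.1) : X.affineOpens :=
  ⟨X.basicOpen (U := U.1) g, U.2.basicOpen g⟩

theorem basicAffine_le (U : X.affineOpens) (g : Sec s U.1) : (basicAffine s U g).1 ≤ U.1 :=
  X.basicOpen_le _

theorem nonempty_coordinates_basicAffine (U : X.affineOpens) (g : Sec s U.1)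
    (h : Algebra.IsStandardSmooth ℂ (Localization.Away g)) :
    Nonempty (Coordinates (Sec s (basicAffine s U g).1)) := by
  let f := Sec.res s (basicAffine_le U g)
  let _ : Algebra (Sec s U.1) (Sec s (basicAffine s U g).1) :=
    (f : Sec s U.1 →+* Sec s (basicAffine s U g).1).toAlgebra
  have : IsScalarTower ℂ (Sec s U.1) (Sec s (basicAffine s U g).1) :=
    IsScalarTower.of_algebraMap_eq fun c => (f.commutes c).symm
  have : IsLocalization.Away g (Sec s (basicAffine s U g).1) := sec_res_isLocalization U g
  let e := (IsLocalization.algEquiv (.powers g) (Localization.Away g)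
    (Sec s (basicAffine s U g).1)).restrictScalars ℂ
  have := Algebra.IsStandardSmooth.of_algEquiv e
  exact nonempty_coordinates

/-- Functions on the arc space are determined by their restrictions to coordinate charts. -/
theorem arcSec_eq_zero [Smooth s] {U : X.affineOpens} {x : ArcSec s U}
    (h : ∀ (V : X.affineOpens) (hV : V.1 ≤ U.1), Nonempty (Coordinates (Sec s V.1)) →
      ArcSec.res s hV x = 0) : x = 0 := by
  have := sec_smooth (s := s) U
  obtain ⟨t, ht, hst⟩ := Algebra.Smooth.exists_span_eq_top_isStandardSmooth ℂ (Sec s U.1)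
  refine arc_eq_zero_of_cover ht fun g hg => ?_
  exact exists_pow_mul_eq_zero (Sec.res s (basicAffine_le U g)) g (sec_res_isLocalization U g)
    (h _ (basicAffine_le U g) (nonempty_coordinates_basicAffine U g (hst g hg)))

theorem nonempty_quasiCoordinates [Smooth s] (U : X.affineOpens) :
    Nonempty (QuasiCoordinates (Sec s U.1)) := by
  have := sec_smooth (s := s) U
  exact QuasiCoordinates.nonempty

/-- The derived bracket of a global section. -/
def GlobalSection.bracket (P : GlobalSection s 2) : SheafBracket s where
  br U := derivedBracket (P.val U)
  res U V h a b := by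
    rw [← P.res U V h]
    exact derivedBracket_map (Sec.res s h) (Sec.res_etale s h) (P.mem U) a b

theorem GlobalSection.bracket_isSkewLeibniz (P : GlobalSection s 2) :
    P.bracket.IsSkewLeibniz := fun U => derivedBracket_isSkewLeibniz (P.mem U)

theorem GlobalSection.bracket_corresponds [Smooth s] (P : GlobalSection s 2) :
    Corresponds P.bracket P := fun U c => by
  have := sec_smooth (s := s) U
  rw [density_eq_toQuasi c]
  exact c.toQuasi.integral_density_derivedBracket (P.mem U)

/-- On a chart, `P` and the density of `B` differ by a total derivative, which does not affect the
derived bracket. On affine opens without coordinates the correspondence says nothing, and the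
brackets are compared after restriction to charts. -/
theorem Corresponds.eq_bracket [Smooth s] {B : SheafBracket s} {P : GlobalSection s 2}
    (hB : B.IsSkewLeibniz) (h : Corresponds B P) : B = P.bracket := by
  have hchart : ∀ V : X.affineOpens, Nonempty (Coordinates (Sec s V.1)) →
      B.br V = derivedBracket (P.val V) := by
    rintro V ⟨c⟩
    have := sec_smooth (s := s) V
    have h' := h V c
    rw [density_eq_toQuasi c] at h'
    rw [derivedBracket_eq_of_integral_eq h', c.toQuasi.derivedBracket_density (hB V)]
  refine SheafBracket.ext (funext fun U => LinearMap.ext₂ fun a b => ?_)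
  rw [← sub_eq_zero]
  ext n
  rw [coeff_zero]
  refine arcSec_eq_zero fun V hV hc => ?_
  have hV' : (B.br U a b - P.bracket.br U a b).map
      (ArcSec.res s hV : ArcSec s U →+* ArcSec s V) = 0 := by
    rw [Polynomial.map_sub, ← B.res U V hV, ← P.bracket.res U V hV, hchart V hc]
    exact sub_self _
  have h' := congrArg (fun q => q.coeff n) hV'
  simp only [coeff_map, coeff_zero] at h'
  exact h'

theorem GlobalSection.bracket_isPVA_iff [Smooth s] {G : ChiralFamily s}
    (hG : ∀ U, ExtendsSchouten (G U)) (P : GlobalSection s 2) :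
    P.bracket.IsPVA ↔ SelfCommutes G P :=
  forall_congr' fun U => by
    obtain ⟨q⟩ := nonempty_quasiCoordinates (s := s) U
    rw [(hG U).eq_schouten, functionalBracket_integral]
    exact derivedBracket_isPVA_iff_integral (P.mem U) q

/-- The density of a bracket, a global section. -/
def SheafBracket.density [Smooth s] (B : SheafBracket s) (hB : B.IsSkewLeibniz) :
    GlobalSection s 2 where
  -- The quasi-coordinates on different opens are chosen independently; compatibility holds because
  -- the density does not depend on them.
  val U := (nonempty_quasiCoordinates (s := s) U).some.density (B.br U)
  mem U := QuasiCoordinates.density_mem _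
  res U V h := by
    refine (QuasiCoordinates.map_density (Sec.res s h) (Sec.res_etale s h) _ (B.res U V h)).trans ?_
    exact QuasiCoordinates.density_eq _ _ (hB V)

theorem SheafBracket.density_corresponds [Smooth s] (B : SheafBracket s) (hB : B.IsSkewLeibniz) :
    Corresponds B (B.density hB) := fun U c => by
  have := sec_smooth (s := s) U
  rw [density_eq_toQuasi c]
  exact congrArg _ (QuasiCoordinates.density_eq _ _ (hB U))

theorem EqModTotalDerivative.corresponds {B : SheafBracket s} {P P' : GlobalSection s 2}
    (h : EqModTotalDerivative P P') (hP : Corresponds B P) : Corresponds B P' := fun U c => by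
  obtain ⟨Q, hQ⟩ := h
  rw [← hP U c, hQ U, map_add, add_eq_left]
  exact (Submodule.Quotient.mk_eq_zero _).2 ⟨_, rfl⟩

/-- Over each affine open, `P' - P` has zero derived bracket and is therefore a total derivative.
Injectivity of `∂` in degree 2 makes the primitives unique, so they agree under restriction. -/
theorem eqModTotalDerivative_of_bracket_eq [Smooth s] {P P' : GlobalSection s 2}
    (h : P.bracket = P'.bracket) : EqModTotalDerivative P P' := by
  have key : ∀ U : X.affineOpens, ∃ Q ∈ ShiftedArc.deg (Sec s U.1) 2,
      ShiftedArc.d (Sec s U.1) Q = P'.val U - P.val U := fun U => by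
    obtain ⟨q⟩ := nonempty_quasiCoordinates (s := s) U
    refine exists_eq_d_of_derivedBracket_eq_zero (sub_mem (P'.mem U) (P.mem U)) q ?_
    have h₁ := derivedBracket_add (P'.val U - P.val U) (P.val U)
    have h₂ : derivedBracket (P.val U) = derivedBracket (P'.val U) :=
      congrArg (fun B : SheafBracket s => B.br U) h
    rw [sub_add_cancel, ← h₂] at h₁
    exact LinearMap.ext₂ fun a b => right_eq_add.1 (LinearMap.congr_fun₂ h₁ a b)
  choose Q hQ hdQ using key
  refine ⟨⟨Q, hQ, fun U V hUV => ?_⟩, fun U => by rw [hdQ, add_sub_cancel]⟩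
  have hd := ShiftedArc.map_isDifferential (Sec.res s hUV) (Sec.res_etale s hUV)
  obtain ⟨q⟩ := nonempty_quasiCoordinates (s := s) V
  refine sub_eq_zero.1 (q.eq_zero_of_d two_ne_zero (sub_mem (hd.map_mem (hQ U)) (hQ V)) ?_)
  rw [map_sub, ← hd.map_d, hdQ, hdQ, map_sub, sub_eq_zero]
  exact congrArg₂ _ (P'.res U V hUV) (P.res U V hUV)

theorem SheafBracket.density_selfCommutes [Smooth s] {G : ChiralFamily s}
    (hG : ∀ U, ExtendsSchouten (G U)) (B : SheafBracket s) (hB : B.IsPVA)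
    (hB' : B.IsSkewLeibniz) : SelfCommutes G (B.density hB') := by
  refine ((B.density hB').bracket_isPVA_iff hG).1 ?_
  have h := (B.density_corresponds hB').eq_bracket hB'
  generalize B.density hB' = P at h
  exact h ▸ hB

theorem corresponds_iff_eqModTotalDerivative [Smooth s] {B : SheafBracket s}
    (hB : B.IsSkewLeibniz) {P : GlobalSection s 2} (hP : Corresponds B P)
    (P' : GlobalSection s 2) : Corresponds B P' ↔ EqModTotalDerivative P P' :=
  ⟨fun h => eqModTotalDerivative_of_bracket_eq
    ((hP.eq_bracket hB).symm.trans (h.eq_bracket hB)), fun h => h.corresponds hP⟩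

end Sheaves

end ArcPVA

end

theorem mainTheorem1 (X : AlgebraicGeometry.Scheme.{0})
    (s : X ⟶ AlgebraicGeometry.Spec (CommRingCat.of ℂ)) [AlgebraicGeometry.Smooth s]
    [AlgebraicGeometry.LocallyOfFiniteType s] [AlgebraicGeometry.QuasiCompact s]
    [AlgebraicGeometry.IsReduced X] :
    -- the chiral Gerstenhaber bracket on the functions on the arc space of `T*[1]X`
    (∀ U : X.affineOpens,
      ∃! G : ArcPVA.ChiralGerstenhaber (ArcPVA.ShiftedArc.deg (ArcPVA.Sec s U.1))
          (ArcPVA.ShiftedArc.d (ArcPVA.Sec s U.1)),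
        ArcPVA.ExtendsSchouten G) ∧
    ∀ G : ArcPVA.ChiralFamily s, (∀ U, ArcPVA.ExtendsSchouten (G U)) →
      -- every `P` has exactly one skew-symmetric bracket, and this is a PVA bracket
      -- if and only if `[∫ P, ∫ P] = 0`
      (∀ P : ArcPVA.GlobalSection s 2, ∃ B : ArcPVA.SheafBracket s,
        (B.IsSkewLeibniz ∧ ArcPVA.Corresponds B P ∧
          ∀ B' : ArcPVA.SheafBracket s,
            B'.IsSkewLeibniz → ArcPVA.Corresponds B' P → B' = B) ∧
        (B.IsPVA ↔ ArcPVA.SelfCommutes G P)) ∧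
      -- every PVA bracket comes from a `P`, which is unique modulo total derivatives
      (∀ B : ArcPVA.SheafBracket s, B.IsPVA → ∃ P : ArcPVA.GlobalSection s 2,
        ArcPVA.Corresponds B P ∧ ArcPVA.SelfCommutes G P ∧
          ∀ P' : ArcPVA.GlobalSection s 2,
            ArcPVA.Corresponds B P' ↔ ArcPVA.EqModTotalDerivative P P') := by
  refine ⟨fun U => ArcPVA.existsUnique_extendsSchouten, fun G hG =>
    ⟨fun P => ⟨P.bracket, ⟨P.bracket_isSkewLeibniz, P.bracket_corresponds,
      fun B' hB' h => h.eq_bracket hB'⟩, P.bracket_isPVA_iff hG⟩, fun B hB => ?_⟩⟩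
  have hB' : B.IsSkewLeibniz := fun U => (hB U).toIsSkewLeibniz
  exact ⟨B.density hB', B.density_corresponds hB', B.density_selfCommutes hG hB hB',
    ArcPVA.corresponds_iff_eqModTotalDerivative hB' (B.density_corresponds hB')⟩
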